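/- **Theorem 3 (general $(k,j)$-projective clustering with squared distances).** A $j$-flat is a $j$-dimensional affine subspace of $\mathbb{R}^d$, and $\|p,\mathcal F\|$ denotes the Euclidean distance from the point $p$ to the flat $\mathcal F$. For integers $k\ge 1$, $1\le j\le d$ and a finite family $P$ of $n\ge 1$ points of $\mathbb{R}^d$ (repetitions allowed), let $$Opt=\inf_{\mathcal F_1,\dots,\mathcal F_k}\ \frac1{|P|}\sum_{p\in P}\min_{1\le l\le k}\|p,\mathcal F_l\|^2 ,$$ where the infimum is over all $k$-tuples of $j$-flats. There are a randomized algorithm (a single program for the real RAM, that is, with unit-cost arithmetic operations, square roots and comparisons on real numbers, unit-cost addition, subtraction and comparison of integer counters and addresses, and unit-cost uniform random integers from a given range), a polynomial $q$ and constants $C,c>0$ such that for all $n,d,k,j$ as above, all $0<\epsilon,\gamma\le 1$ and all families $P$ of $n$ points of $\mathbb{R}^d$, the algorithm on the input $(P,k,j,\epsilon,\gamma)$ always halts within $C\cdot 2^{q(kj/(\epsilon\gamma))}\,n\,d$ steps and, with probability at least $c$, outputs $k$ $j$-flats $\mathcal F_1,\dots,\mathcal F_k$ (each given by a point on it and $j$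 vectors that span its direction) for which there is a nonempty subfamily $P'$ of $P$ with $|P'|\ge(1-\gamma)|P|$ and $$\frac1{|P'|}\sum_{p\in P'}\min_{1\le l\le k}\|p,\mathcal F_l\|^2\le(1+\epsilon)\,Opt .$$ -/

import Mathlib

/-! ### Projective clustering with squared distances -/

namespace ProjectiveClustering

/-- A `j`-flat of `ℝ^d`: a nonempty affine subspace of dimension `j`. -/
def IsFlat {d : ℕ} (j : ℕ) (F : AffineSubspace ℝ (EuclideanSpace ℝ (Fin d))) : Prop :=
  (F : Set (EuclideanSpace ℝ (Fin d))).Nonempty ∧ Module.finrank ℝ F.direction = j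

/-- The average over the index set `Q` of the squared distance from the point `p i` to the
nearest of the `k` flats. -/
noncomputable def avgCost {n d k : ℕ} (p : Fin n → EuclideanSpace ℝ (Fin d))
    (Q : Finset (Fin n)) (F : Fin k → AffineSubspace ℝ (EuclideanSpace ℝ (Fin d))) : ℝ :=
  (∑ i ∈ Q, ⨅ l : Fin k,
    Metric.infDist (p i) (F l : Set (EuclideanSpace ℝ (Fin d))) ^ 2) / (Q.card : ℝ)

/-- The optimal value of `(k,j)`-projective clustering on all the points. -/
noncomputable def opt {n d : ℕ} (k j : ℕ) (p : Fin n → EuclideanSpace ℝ (Fin d)) : ℝ :=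
  ⨅ F : Fin k → {F : AffineSubspace ℝ (EuclideanSpace ℝ (Fin d)) // IsFlat j F},
    avgCost p Finset.univ (fun l => (F l : AffineSubspace ℝ (EuclideanSpace ℝ (Fin d))))

/-- `F` is a family of `j`-flats whose average squared distance, on some nonempty set of at least
`(1 - γ) n` of the points, is at most `(1 + ε)` times the optimum for all the points. -/
def IsGoodSolution {n d k : ℕ} (j : ℕ) (ε γ : ℝ) (p : Fin n → EuclideanSpace ℝ (Fin d))
    (F : Fin k → AffineSubspace ℝ (EuclideanSpace ℝ (Fin d))) : Prop :=
  (∀ l, IsFlat j (F l)) ∧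
    ∃ Q : Finset (Fin n), Q.Nonempty ∧ (1 - γ) * (n : ℝ) ≤ (Q.card : ℝ) ∧
      avgCost p Q F ≤ (1 + ε) * opt k j p

end ProjectiveClustering

/-! ### A randomized real RAM

Programs of a small imperative language over arrays of natural numbers (counters and addresses)
and arrays of real numbers. A program is a fixed finite text, so it names finitely many arrays and
all its expressions have bounded size; hence one step per executed command is the unit-cost measure
up to a constant factor that depends on the program only. Natural numbers support addition and
truncated subtraction, real numbers the four arithmetic operations, square roots and exact
comparison. There is no conversion from real to natural numbers (no rounding). -/

namespace RealRAM

/-- The memory: `nat a i` and `real a i` are the entries with index `i` of the arrays named `a`. -/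
structure Store where
  nat : ℕ → ℕ → ℕ
  real : ℕ → ℕ → ℝ

/-- Expressions for natural numbers; `get a e` is the entry with index `e` of the array `a`. -/
inductive NExp where
  | const (c : ℕ)
  | get (a : ℕ) (e : NExp)
  | add (e₁ e₂ : NExp)
  | sub (e₁ e₂ : NExp)

def NExp.eval (s : Store) : NExp → ℕ
  | .const c => c
  | .get a e => s.nat a (e.eval s)
  | .add e₁ e₂ => e₁.eval s + e₂.eval s
  | .sub e₁ e₂ => e₁.eval s - e₂.eval s

/-- Expressions for real numbers; `ofNat e` is a natural number read as a real one. -/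
inductive RExp where
  | ofNat (e : NExp)
  | get (a : ℕ) (e : NExp)
  | add (e₁ e₂ : RExp)
  | sub (e₁ e₂ : RExp)
  | mul (e₁ e₂ : RExp)
  | div (e₁ e₂ : RExp)
  | sqrt (e : RExp)

noncomputable def RExp.eval (s : Store) : RExp → ℝ
  | .ofNat e => (e.eval s : ℝ)
  | .get a e => s.real a (e.eval s)
  | .add e₁ e₂ => e₁.eval s + e₂.eval s
  | .sub e₁ e₂ => e₁.eval s - e₂.eval s
  | .mul e₁ e₂ => e₁.eval s * e₂.eval s
  | .div e₁ e₂ => e₁.eval s / e₂.eval s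
  | .sqrt e => Real.sqrt (e.eval s)

/-- Tests. -/
inductive Test where
  | natLT (e₁ e₂ : NExp)
  | realLT (e₁ e₂ : RExp)
  | not (b : Test)
  | and (b₁ b₂ : Test)

def Test.Holds (s : Store) : Test → Prop
  | .natLT e₁ e₂ => e₁.eval s < e₂.eval s
  | .realLT e₁ e₂ => e₁.eval s < e₂.eval s
  | .not b => ¬ b.Holds s
  | .and b₁ b₂ => b₁.Holds s ∧ b₂.Holds s

/-- Commands. `setNat a i e` and `setReal a i e` assign the value of `e` to the entry with index
`i` of the array `a`; `rand a i e` assigns a fresh uniformly random element of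
`{0, …, e - 1}`; `loop b c` is `while b do c`. -/
inductive Cmd where
  | setNat (a : ℕ) (i e : NExp)
  | setReal (a : ℕ) (i : NExp) (e : RExp)
  | rand (a : ℕ) (i e : NExp)
  | seq (c₁ c₂ : Cmd)
  | cond (b : Test) (c₁ c₂ : Cmd)
  | loop (b : Test) (c : Cmd)

def Store.setNat (s : Store) (a i v : ℕ) : Store :=
  { s with nat := Function.update s.nat a (Function.update (s.nat a) i v) }

noncomputable def Store.setReal (s : Store) (a i : ℕ) (v : ℝ) : Store :=
  { s with real := Function.update s.real a (Function.update (s.real a) i v) }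

/-- The uniform distribution on `{0, …, m - 1}` (the constant `0` if `m = 0`). -/
noncomputable def uniformBelow (m : ℕ) : PMF ℕ :=
  PMF.uniformOfFinset (Finset.range (max m 1)) ⟨0, by simp⟩

/-- A configuration: the commands still to be executed, and the memory. -/
abbrev Config := List Cmd × Store

open Classical in
/-- One step of the machine. A configuration with no command left has halted. -/
noncomputable def step : Config → PMF Config
  | ([], s) => PMF.pure ([], s)
  | (.setNat a i e :: K, s) => PMF.pure (K, s.setNat a (i.eval s) (e.eval s))
  | (.setReal a i e :: K, s) => PMF.pure (K, s.setReal a (i.eval s) (e.eval s))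
  | (.rand a i e :: K, s) =>
      (uniformBelow (e.eval s)).map fun v => (K, s.setNat a (i.eval s) v)
  | (.seq c₁ c₂ :: K, s) => PMF.pure (c₁ :: c₂ :: K, s)
  | (.cond b c₁ c₂ :: K, s) => PMF.pure (if b.Holds s then (c₁ :: K, s) else (c₂ :: K, s))
  | (.loop b c :: K, s) => PMF.pure (if b.Holds s then (c :: .loop b c :: K, s) else (K, s))

/-- The distribution of the configuration after `t` steps from `x`. -/
noncomputable def runFor (x : Config) : ℕ → PMF Config
  | 0 => PMF.pure x
  | t + 1 => (runFor x t).bind step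

/-- Whatever the random choices, the program `c` started on the memory `s` halts within `t`
steps. -/
def HaltsWithin (c : Cmd) (s : Store) (t : ℕ) : Prop :=
  ∀ x ∈ (runFor ([c], s) t).support, x.1 = []

/-- The probability that the program `c` started on the memory `s` has halted after `t` steps with
a memory in `A`. -/
noncomputable def probHaltsIn (c : Cmd) (s : Store) (t : ℕ) (A : Set Store) : ENNReal :=
  (runFor ([c], s) t).toOuterMeasure {x | x.1 = [] ∧ x.2 ∈ A}

end RealRAM

/-! ### Input and output of programs for projective clustering -/

namespace ProjectiveClustering

/-- The initial memory: `n, d, k, j` in the array `0` of natural numbers; the coordinates of the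
points, one point after the other, in the array `0` of real numbers; `ε, γ` in the array `1` of
real numbers; and `0` elsewhere. -/
noncomputable def input {n d : ℕ} (k j : ℕ) (ε γ : ℝ) (p : Fin n → EuclideanSpace ℝ (Fin d)) :
    RealRAM.Store where
  nat a i :=
    match a, i with
    | 0, 0 => n
    | 0, 1 => d
    | 0, 2 => k
    | 0, 3 => j
    | _, _ => 0
  real a i :=
    match a, i with
    | 0, i => if h : i / d < n then if h' : i % d < d then p ⟨i / d, h⟩ ⟨i % d, h'⟩ else 0 else 0
    | 1, 0 => ε
    | 1, 1 => γ
    | _, _ => 0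

/-- The vector stored in the block number `b` (of length `d`) of the array `2` of real numbers. -/
noncomputable def outVec (d : ℕ) (s : RealRAM.Store) (b : ℕ) : EuclideanSpace ℝ (Fin d) :=
  WithLp.toLp 2 fun c : Fin d => s.real 2 (b * d + c)

/-- The flats read off the final memory: the flat number `l` is given by `j + 1` consecutive
vectors, a point on it followed by `j` vectors that span its direction. -/
noncomputable def output (d k j : ℕ) (s : RealRAM.Store) :
    Fin k → AffineSubspace ℝ (EuclideanSpace ℝ (Fin d)) := fun l =>
  AffineSubspace.mk' (outVec d s (l * (j + 1)))
    (Submodule.span ℝ (Set.range fun v : Fin j => outVec d s (l * (j + 1) + 1 + v)))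

end ProjectiveClustering

/-! ### Averages over finitely many sequential draws -/

/-! Fix nearly optimal reference flats and assign every point to a nearest one. The program guesses
flats from a few uniformly drawn points with uniformly drawn integer coefficients. One guess
succeeds with a probability that depends on `k`, `j`, `ε`, `γ` only, so enough independent guesses,
whose number is free of `n` and `d`, contain a success with probability at least one half.

The heart is the replacement of one reference direction at a time. Suppose that, modulo the span of
the other directions, `x i - a = w i + t i • v`, where `a` is known but `v`, `t`, `w` are not. A
combination `u` of sampled vectors `x i - a` with coefficients `g` equals `s • (v + e)` modulo that
span, with `s = ∑ g t` and `e = s⁻¹ • ∑ g w`. Using `u` as a direction therefore changes the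
residuals from `w i` to `w i - t i • e` (`replace_direction`), although the program never sees `t`
or `w`. The centre arises in the same way with `t = 1` (`ClusterState.first`). It is enough that `e`
is, up to a factor `1 + 1/E` and outside a fraction `1/E` of the indices, no worse than `0` as a
regression vector of `w` on `t`.

Such an `e` appears with a probability independent of `n` (`le_avg_goodDraw`). Let `T` be the
quantile of `|t i|` at the fraction `1/E`; the indices above `T` are given up. If many `|t i|`
exceed `K T`, with `K = 8 E²`, then samples among them with moderate `w i` give an `e` too small to
matter at scales up to `T` (`goodDraw_of_gap`). Otherwise the indices with `T/K ≤ |t i| ≤ K T` carry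
enough of `∑ t²`. There, integer coefficients of size at most `K²` make all products `g i * t i`
comparable. For samples weighted by `t i / g i`, the deviation of `e` from the least squares vector
is a centred sum of small second moment divided by a large `s` (`regression_sample`), and indices of
smaller scale hardly notice `e` (`sum_le_of_regression`). Both sampling laws have bounded density
relative to the uniform law on pairs of an index and a coefficient, so uniform draws succeed too
(`le_avg_unif_of_density`).

Chaining over the `j + 1` blocks of a cluster (`le_avg_cluster`) and over the clusters
(`le_avg_trialState`) multiplies the probabilities and loses a fraction `(2k + j + 1)/E` of the
points, tiny clusters included. Gram–Schmidt with spare standard basis vectors makes the dimension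
exactly `j`. The points to be dropped are unknown. However, keeping the points up to a random pivot
in the order of their costs leaves a suitable number of them with probability at least `γ/2`
(`card_good_pivots`), and such trimming does not worsen the average (`sum_trimmed_le`). Trials are
compared by their own average costs, so `opt` need not be computed.

On the machine all random choices are first written on a tape, whose law is the iterated average
`avg` (`drawLoop_succeeds`). What follows is deterministic and is handled by a calculus of commands
with step bounds (`Ends`), in which the arrays that a command never writes are preserved
automatically (`Frame`). -/

namespace Tape

open Filter Topology

variable {α : Type*}

/-- The expectation of `φ` after the entries `i, …, i + L - 1` of the tape `A` have been redrawn
independently from `S` with the weights `w`. -/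
noncomputable def avg (S : Finset α) (w : α → ℝ) : ℕ → ℕ → ((ℕ → α) → ℝ) → (ℕ → α) → ℝ
  | _, 0, φ, A => φ A
  | i, L + 1, φ, A => ∑ v ∈ S, w v * avg S w (i + 1) L φ (Function.update A i v)

open Classical in
/-- The indicator function of an event. -/
noncomputable def ind (P : (ℕ → α) → Prop) (A : ℕ → α) : ℝ := if P A then 1 else 0

theorem ind_nonneg (P : (ℕ → α) → Prop) (A : ℕ → α) : 0 ≤ ind P A := by
  unfold ind; split_ifs <;> norm_num

theorem ind_le_one (P : (ℕ → α) → Prop) (A : ℕ → α) : ind P A ≤ 1 := by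
  unfold ind; split_ifs <;> norm_num

theorem ind_of {P : (ℕ → α) → Prop} {A : ℕ → α} (h : P A) : ind P A = 1 := by simp [ind, h]

theorem ind_of_not {P : (ℕ → α) → Prop} {A : ℕ → α} (h : ¬ P A) : ind P A = 0 := by simp [ind, h]

theorem ind_mono {P Q : (ℕ → α) → Prop} {A : ℕ → α} (h : P A → Q A) : ind P A ≤ ind Q A := by
  by_cases hP : P A
  · rw [ind_of hP, ind_of (h hP)]
  · rw [ind_of_not hP]; exact ind_nonneg _ _

/-- `A'` is obtained from `A` by redrawing the entries `i, …, i + L - 1` from `S`. -/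
def Redrawn (S : Finset α) (i L : ℕ) (A A' : ℕ → α) : Prop :=
  (∀ q, q < i ∨ i + L ≤ q → A' q = A q) ∧ ∀ q, i ≤ q → q < i + L → A' q ∈ S

theorem Redrawn.succ {S : Finset α} {i L : ℕ} {A A' : ℕ → α} {v : α} (hv : v ∈ S)
    (h : Redrawn S (i + 1) L (Function.update A i v) A') :
    Redrawn S i (L + 1) A A' ∧ A' i = v := by
  have hi : A' i = v := by rw [h.1 i (by omega)]; simp
  refine ⟨⟨fun q hq => ?_, fun q h1 h2 => ?_⟩, hi⟩
  · rw [h.1 q (by omega), Function.update_of_ne (by omega)]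
  · rcases Nat.eq_or_lt_of_le h1 with rfl | h1
    · rwa [hi]
    · exact h.2 q h1 (by omega)

/-- The comparison is needed only on tapes that can actually arise. Pointwise arguments may thus use
that new entries lie in `S` and that all other entries are unchanged. -/
theorem avg_mono {S : Finset α} {w : α → ℝ} (hw : ∀ v ∈ S, 0 ≤ w v) {φ ψ : (ℕ → α) → ℝ}
    (i L : ℕ) (A : ℕ → α) (h : ∀ A', Redrawn S i L A A' → φ A' ≤ ψ A') :
    avg S w i L φ A ≤ avg S w i L ψ A := by
  induction L generalizing i A with
  | zero => exact h A ⟨fun _ _ => rfl, fun q h1 h2 => by omega⟩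
  | succ L ih =>
    refine Finset.sum_le_sum fun v hv => mul_le_mul_of_nonneg_left ?_ (hw v hv)
    exact ih _ _ fun A' hA' => h A' (hA'.succ hv).1

theorem avg_congr {S : Finset α} {w : α → ℝ} {φ ψ : (ℕ → α) → ℝ}
    (i L : ℕ) (A : ℕ → α) (h : ∀ A', Redrawn S i L A A' → φ A' = ψ A') :
    avg S w i L φ A = avg S w i L ψ A := by
  induction L generalizing i A with
  | zero => exact h A ⟨fun _ _ => rfl, fun q h1 h2 => by omega⟩
  | succ L ih =>
    refine Finset.sum_congr rfl fun v hv => ?_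
    rw [ih _ _ fun A' hA' => h A' (hA'.succ hv).1]

theorem avg_const {S : Finset α} {w : α → ℝ} (hw : ∑ v ∈ S, w v = 1) (c : ℝ)
    (i L : ℕ) (A : ℕ → α) : avg S w i L (fun _ => c) A = c := by
  induction L generalizing i A with
  | zero => rfl
  | succ L ih => simp only [avg, ih, ← Finset.sum_mul, hw, one_mul]

theorem avg_mul_left {S : Finset α} {w : α → ℝ} (c : ℝ) (φ : (ℕ → α) → ℝ)
    (i L : ℕ) (A : ℕ → α) : avg S w i L (fun A => c * φ A) A = c * avg S w i L φ A := by
  induction L generalizing i A with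
  | zero => rfl
  | succ L ih =>
    simp only [avg, ih, Finset.mul_sum]
    exact Finset.sum_congr rfl fun v _ => by ring

theorem avg_sub {S : Finset α} {w : α → ℝ} (φ ψ : (ℕ → α) → ℝ)
    (i L : ℕ) (A : ℕ → α) :
    avg S w i L (fun A => φ A - ψ A) A = avg S w i L φ A - avg S w i L ψ A := by
  induction L generalizing i A with
  | zero => rfl
  | succ L ih =>
    simp only [avg, ih, ← Finset.sum_sub_distrib]
    exact Finset.sum_congr rfl fun v _ => by ring

theorem avg_nonneg {S : Finset α} {w : α → ℝ} (hw : ∀ v ∈ S, 0 ≤ w v) {φ : (ℕ → α) → ℝ}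
    (hφ : ∀ A, 0 ≤ φ A) (i L : ℕ) (A : ℕ → α) : 0 ≤ avg S w i L φ A := by
  induction L generalizing i A with
  | zero => exact hφ A
  | succ L ih => exact Finset.sum_nonneg fun v hv => mul_nonneg (hw v hv) (ih _ _)

/-- The inner average is the conditional expectation given the first block. The chaining of blocks,
the pivot and the repetition of trials rest on this identity. -/
theorem avg_append (S : Finset α) (w : α → ℝ) (φ : (ℕ → α) → ℝ) (i L₁ L₂ : ℕ) (A : ℕ → α) :
    avg S w i (L₁ + L₂) φ A = avg S w i L₁ (fun A' => avg S w (i + L₁) L₂ φ A') A := by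
  induction L₁ generalizing i A with
  | zero => simp [avg]
  | succ L ih =>
    rw [show L + 1 + L₂ = (L + L₂) + 1 by ring]
    simp only [avg]
    refine Finset.sum_congr rfl fun v _ => ?_
    rw [ih]
    simp only [show i + 1 + L = i + (L + 1) by ring]

/-- Comparison of two sampling distributions with bounded density. -/
theorem avg_le_of_weight_le {S S' : Finset α} {w w' : α → ℝ} {κ : ℝ} (hS : S ⊆ S')
    (hw : ∀ v ∈ S, 0 ≤ w v) (hw' : ∀ v ∈ S', 0 ≤ w' v) (hκ : 0 ≤ κ)
    (h : ∀ v ∈ S, w v ≤ κ * w' v) {φ : (ℕ → α) → ℝ} (hφ : ∀ A, 0 ≤ φ A) (i L : ℕ) (A : ℕ → α) :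
    avg S w i L φ A ≤ κ ^ L * avg S' w' i L φ A := by
  induction L generalizing i A with
  | zero => simp [avg]
  | succ L ih =>
    simp only [avg, Finset.mul_sum]
    calc ∑ v ∈ S, w v * avg S w (i + 1) L φ (Function.update A i v)
        ≤ ∑ v ∈ S, κ ^ (L + 1) * (w' v * avg S' w' (i + 1) L φ (Function.update A i v)) := by
          refine Finset.sum_le_sum fun v hv => ?_
          calc w v * avg S w (i + 1) L φ (Function.update A i v)
              ≤ (κ * w' v) * (κ ^ L * avg S' w' (i + 1) L φ (Function.update A i v)) :=
                mul_le_mul (h v hv) (ih _ _) (avg_nonneg hw hφ _ _ _)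
                  (mul_nonneg hκ (hw' v (hS hv)))
            _ = _ := by ring
      _ ≤ _ := Finset.sum_le_sum_of_subset_of_nonneg hS fun v hv _ =>
          mul_nonneg (pow_nonneg hκ _) (mul_nonneg (hw' v hv) (avg_nonneg hw' hφ _ _ _))

/-- A chain of events, each of conditional probability at least `ρ` given the previous one. -/
theorem pow_le_avg_chain {S : Finset α} {w : α → ℝ} (hw : ∀ v ∈ S, 0 ≤ w v) {ρ : ℝ} (hρ : 0 ≤ ρ)
    (i B T : ℕ) (P : ℕ → (ℕ → α) → Prop)
    (hP : ∀ t < T, ∀ A, P t A → ρ ≤ avg S w (i + t * B) B (ind (P (t + 1))) A)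
    (A : ℕ → α) (h0 : P 0 A) : ρ ^ T ≤ avg S w i (T * B) (ind (P T)) A := by
  induction T with
  | zero => simp [avg, ind_of h0]
  | succ T ih =>
    rw [Nat.succ_mul, avg_append]
    calc ρ ^ (T + 1) = ρ * ρ ^ T := by ring
      _ ≤ ρ * avg S w i (T * B) (ind (P T)) A :=
          mul_le_mul_of_nonneg_left (ih fun t ht => hP t (by omega)) hρ
      _ = avg S w i (T * B) (fun A => ρ * ind (P T) A) A := (avg_mul_left _ _ _ _ _).symm
      _ ≤ _ := by
          refine avg_mono hw _ _ _ fun A' _ => ?_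
          -- Where `P T` holds, the hypothesis bounds the conditional probability from below;
          -- elsewhere the left side is zero.
          by_cases h : P T A'
          · rw [ind_of h, mul_one]; exact hP T (by omega) A' h
          · rw [ind_of_not h, mul_zero]; exact avg_nonneg hw (ind_nonneg _) _ _ _

/-- The averages are finite sums, so pointwise convergence suffices. This serves to pass from nearly
optimal reference flats to the infimum. -/
theorem avg_tendsto {ι : Type*} {l : Filter ι} {S : Finset α} {w : α → ℝ}
    {φ : ι → (ℕ → α) → ℝ} {ψ : (ℕ → α) → ℝ} (h : ∀ A, Tendsto (fun a => φ a A) l (𝓝 (ψ A)))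
    (i L : ℕ) (A : ℕ → α) : Tendsto (fun a => avg S w i L (φ a) A) l (𝓝 (avg S w i L ψ A)) := by
  induction L generalizing i A with
  | zero => exact h A
  | succ L ih => exact tendsto_finsetSum _ fun v _ => (ih _ _).const_mul _

/-- The second moment of a sum of independent centred vectors. -/
theorem avg_norm_sq_sum {H : Type*} [NormedAddCommGroup H] [InnerProductSpace ℝ H]
    {S : Finset α} {w : α → ℝ} (hw : ∑ v ∈ S, w v = 1) (ξ : α → H) (hξ : ∑ v ∈ S, w v • ξ v = 0)
    (i L : ℕ) (x : H) (A : ℕ → α) :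
    avg S w i L (fun A => ‖x + ∑ r ∈ Finset.range L, ξ (A (i + r))‖ ^ 2) A
      = ‖x‖ ^ 2 + L * ∑ v ∈ S, w v * ‖ξ v‖ ^ 2 := by
  -- The offset `x` must vary: drawing the first summand moves it to `x + ξ v`.
  induction L generalizing i A x with
  | zero => simp [avg]
  | succ L ih =>
    simp only [avg]
    have h1 : ∀ v ∈ S, avg S w (i + 1) L
        (fun A => ‖x + ∑ r ∈ Finset.range (L + 1), ξ (A (i + r))‖ ^ 2) (Function.update A i v)
        = ‖x + ξ v‖ ^ 2 + L * ∑ v ∈ S, w v * ‖ξ v‖ ^ 2 := by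
      intro v hv
      rw [← ih (i + 1) (x + ξ v) (Function.update A i v)]
      refine avg_congr _ _ _ fun A' hA' => ?_
      rw [Finset.sum_range_succ', add_zero, (hA'.succ hv).2, add_comm _ (ξ v), ← add_assoc]
      simp only [show ∀ r, i + 1 + r = i + (r + 1) by intro r; ring]
    rw [Finset.sum_congr rfl fun v hv => by rw [h1 v hv]]
    have h2 : ∀ v, w v * (‖x + ξ v‖ ^ 2 + L * ∑ v ∈ S, w v * ‖ξ v‖ ^ 2)
        = w v * (‖x‖ ^ 2 + L * ∑ v ∈ S, w v * ‖ξ v‖ ^ 2) + 2 * inner ℝ x (w v • ξ v)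
          + w v * ‖ξ v‖ ^ 2 := by
      intro v
      rw [norm_add_sq_real, real_inner_smul_right]; ring
    simp only [h2, Finset.sum_add_distrib, ← Finset.sum_mul, ← Finset.mul_sum, ← inner_sum, hw, hξ,
      inner_zero_right]
    push_cast; ring

/-- Markov's inequality for the sum of independent centred vectors. -/
theorem half_le_avg_norm_sq_le {H : Type*} [NormedAddCommGroup H] [InnerProductSpace ℝ H]
    {S : Finset α} {w : α → ℝ} (hw0 : ∀ v ∈ S, 0 < w v) (hw : ∑ v ∈ S, w v = 1) (ξ : α → H)
    (hξ : ∑ v ∈ S, w v • ξ v = 0) (i L : ℕ) (A : ℕ → α) :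
    1 / 2 ≤ avg S w i L (ind fun A => ‖∑ r ∈ Finset.range L, ξ (A (i + r))‖ ^ 2
      ≤ 2 * (L * ∑ v ∈ S, w v * ‖ξ v‖ ^ 2)) A := by
  have hw' : ∀ v ∈ S, 0 ≤ w v := fun v hv => (hw0 v hv).le
  have hσ : 0 ≤ ∑ v ∈ S, w v * ‖ξ v‖ ^ 2 :=
    Finset.sum_nonneg fun v hv => mul_nonneg (hw' v hv) (sq_nonneg _)
  have h0 : 0 ≤ L * ∑ v ∈ S, w v * ‖ξ v‖ ^ 2 := by positivity
  -- Markov's inequality would divide by the second moment. If that is zero, positivity of the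
  -- weights forces each drawn `ξ` to vanish, and the event is certain.
  rcases h0.eq_or_lt with h | h
  · have hle : (1 : ℝ) / 2 ≤ avg S w i L (fun _ => 1) A := by rw [avg_const hw]; norm_num
    refine hle.trans (avg_mono hw' _ _ _ fun A' hA' => ?_)
    rw [ind_of]
    have : ∑ r ∈ Finset.range L, ξ (A' (i + r)) = 0 := by
      refine Finset.sum_eq_zero fun r hr => ?_
      have hr := Finset.mem_range.1 hr
      have hL : (L : ℝ) ≠ 0 := by
        have : 0 < L := by omega
        positivity
      have hz : ∑ v ∈ S, w v * ‖ξ v‖ ^ 2 = 0 := by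
        rcases mul_eq_zero.1 h.symm with h | h
        · exact absurd h hL
        · exact h
      have hm := hA'.2 (i + r) (by omega) (by omega)
      have := (Finset.sum_eq_zero_iff_of_nonneg
        fun v hv => mul_nonneg (hw' v hv) (sq_nonneg _)).1 hz _ hm
      simpa [(hw0 _ hm).ne'] using this
    rw [this]; simp [h0]
  · set σ := L * ∑ v ∈ S, w v * ‖ξ v‖ ^ 2 with hσdef
    have hm := avg_norm_sq_sum hw ξ hξ i L 0 A
    simp only [zero_add, norm_zero, ne_eq, OfNat.ofNat_ne_zero, not_false_eq_true, zero_pow] at hm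
    -- The affine function `1 - X / (2σ)` lies below the indicator of `X ≤ 2σ` and has mean `1/2`.
    have : avg S w i L (fun A => 1 - (1 / (2 * σ)) *
        ‖∑ r ∈ Finset.range L, ξ (A (i + r))‖ ^ 2) A = 1 / 2 := by
      rw [avg_sub, avg_const hw, avg_mul_left, hm, ← hσdef]; field_simp; norm_num
    rw [← this]
    refine avg_mono hw' _ _ _ fun A' _ => ?_
    by_cases hc : ‖∑ r ∈ Finset.range L, ξ (A' (i + r))‖ ^ 2 ≤ 2 * σ
    · rw [ind_of hc]
      have : 0 ≤ (1 / (2 * σ)) * ‖∑ r ∈ Finset.range L, ξ (A' (i + r))‖ ^ 2 := by positivity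
      linarith
    · rw [ind_of_not hc]
      push Not at hc
      have : 1 ≤ (1 / (2 * σ)) * ‖∑ r ∈ Finset.range L, ξ (A' (i + r))‖ ^ 2 := by
        rw [one_div, inv_mul_eq_div, le_div_iff₀ (by positivity)]; linarith
      linarith

end Tape

/-! ### Robust regression from a uniform sample -/

namespace ProjectiveClustering

open Tape

variable {H : Type*} [NormedAddCommGroup H] [InnerProductSpace ℝ H]

/-- The signed coefficient encoded by a draw. -/
def coef (G : ℕ) (v : ℕ × ℕ) : ℝ := (v.2 : ℝ) - G

/-- The possible draws: an index below `n` and an encoded coefficient of absolute value at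
most `G`. -/
def draws (n G : ℕ) : Finset (ℕ × ℕ) := Finset.range n ×ˢ Finset.range (2 * G + 1)

/-- The uniform weights on the draws. -/
noncomputable def unif (n G : ℕ) (_ : ℕ × ℕ) : ℝ := 1 / (n * (2 * G + 1 : ℕ))

theorem unif_nonneg (n G : ℕ) (v : ℕ × ℕ) : 0 ≤ unif n G v := by unfold unif; positivity

theorem sum_unif {n : ℕ} (hn : 1 ≤ n) (G : ℕ) : ∑ v ∈ draws n G, unif n G v = 1 := by
  have : (n : ℝ) ≠ 0 := by positivity
  simp only [unif, draws, Finset.sum_const, Finset.card_product, Finset.card_range, nsmul_eq_mul]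
  push_cast
  field_simp

/-- The draws `f 0, …, f (m - 1)` yield a vector `e` for which `t i • e` predicts `w i` about as
well as `0` does, apart from a small fraction of the indices. -/
def GoodDraw (E G m : ℕ) (Y : Finset ℕ) (t : ℕ → ℝ) (w : ℕ → H) (f : ℕ → ℕ × ℕ) : Prop :=
  ∃ R ⊆ Y, (1 - 1 / (E : ℝ)) * Y.card ≤ R.card ∧ ∃ e : H,
    ((∀ i ∈ R, t i = 0) ∨ ((∀ r < m, (f r).1 ∈ Y) ∧
      ∑ r ∈ Finset.range m, coef G (f r) * t (f r).1 ≠ 0 ∧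
      e = (∑ r ∈ Finset.range m, coef G (f r) * t (f r).1)⁻¹ •
        ∑ r ∈ Finset.range m, coef G (f r) • w (f r).1)) ∧
    ∑ i ∈ R, ‖w i - t i • e‖ ^ 2 ≤ (1 + 1 / (E : ℝ)) * ∑ i ∈ Y, ‖w i‖ ^ 2

/-- Take for `T` the largest `|t i|` that is reached by at least a fraction `η` of the indices. The
next larger value, if any, violates this condition, which gives the upper bound. The weak and the
strict inequality account for ties at `T`. -/
theorem exists_quantile {Y : Finset ℕ} (hY : Y.Nonempty) (t : ℕ → ℝ) {η : ℝ} (hη0 : 0 ≤ η)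
    (hη1 : η ≤ 1) :
    ∃ T : ℝ, 0 ≤ T ∧ η * Y.card ≤ ((Y.filter fun i => T ≤ |t i|).card : ℝ) ∧
      ((Y.filter fun i => T < |t i|).card : ℝ) ≤ η * Y.card := by
  set Z := Y.filter fun i => η * Y.card ≤ ((Y.filter fun k => |t i| ≤ |t k|).card : ℝ) with hZ
  have hZne : Z.Nonempty := by
    obtain ⟨i, hi, hmin⟩ := Y.exists_min_image (fun i => |t i|) hY
    refine ⟨i, Finset.mem_filter.2 ⟨hi, ?_⟩⟩
    rw [Finset.filter_true_of_mem hmin]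
    exact mul_le_of_le_one_left (by positivity) hη1
  obtain ⟨i, hi, hmax⟩ := Z.exists_max_image (fun i => |t i|) hZne
  refine ⟨|t i|, abs_nonneg _, (Finset.mem_filter.1 hi).2, ?_⟩
  rcases (Y.filter fun k => |t i| < |t k|).eq_empty_or_nonempty with h | h
  · have : 0 ≤ η * Y.card := by positivity
    rw [h]; simpa using this
  · obtain ⟨a, ha, hmin⟩ := Finset.exists_min_image _ (fun i => |t i|) h
    obtain ⟨haY, hia⟩ := Finset.mem_filter.1 ha
    have hna : a ∉ Z := fun haZ => absurd (hmax a haZ) (not_le.2 hia)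
    have : ((Y.filter fun k => |t a| ≤ |t k|).card : ℝ) < η * Y.card := by
      by_contra hc
      exact hna (Finset.mem_filter.2 ⟨haY, not_lt.1 hc⟩)
    refine le_trans ?_ this.le
    exact_mod_cast Finset.card_le_card fun b hb =>
      Finset.mem_filter.2 ⟨(Finset.mem_filter.1 hb).1, hmin b hb⟩

theorem norm_sub_sq_le_weighted {H : Type*} [NormedAddCommGroup H] {δ : ℝ} (hδ : 0 < δ) (x y : H) :
    ‖x - y‖ ^ 2 ≤ (1 + δ) * ‖x‖ ^ 2 + (1 + 1 / δ) * ‖y‖ ^ 2 := by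
  have h1 : ‖x - y‖ ≤ ‖x‖ + ‖y‖ := norm_sub_le x y
  have h2 : ‖x - y‖ ^ 2 ≤ (‖x‖ + ‖y‖) ^ 2 := pow_le_pow_left₀ (norm_nonneg _) h1 2
  have h3 : 0 ≤ (1 / δ) * (δ * ‖x‖ - ‖y‖) ^ 2 := by positivity
  have h4 : (1 / δ) * (δ * ‖x‖ - ‖y‖) ^ 2
      = δ * ‖x‖ ^ 2 - 2 * ‖x‖ * ‖y‖ + (1 / δ) * ‖y‖ ^ 2 := by field_simp; ring
  nlinarith

/-- The encoding of the signed coefficient `g`. -/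
def encode (G : ℕ) (g : ℕ → ℤ) (i : ℕ) : ℕ × ℕ := (i, (g i + G).toNat)

theorem coef_encode {G : ℕ} {g : ℕ → ℤ} {i : ℕ} (hg : |g i| ≤ G) :
    coef G (encode G g i) = g i := by
  have h : ((g i + G).toNat : ℤ) = g i + G := Int.toNat_of_nonneg (by have := abs_le.1 hg; omega)
  have h' : ((g i + G).toNat : ℝ) = g i + G := by exact_mod_cast h
  simp [coef, encode, h']

theorem encode_mem_draws {n G : ℕ} {g : ℕ → ℤ} {i : ℕ} (hi : i < n) (hg : |g i| ≤ G) :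
    encode G g i ∈ draws n G := by
  have := abs_le.1 hg
  simp only [encode, draws, Finset.mem_product, Finset.mem_range]
  omega

theorem encode_injective (G : ℕ) (g : ℕ → ℤ) : Function.Injective (encode G g) :=
  fun _ _ h => congrArg Prod.fst h

/-- Passage from a sampling distribution of bounded density on encoded coefficients to the
uniform distribution on all draws. -/
theorem le_avg_unif_of_density {n G m : ℕ} {B : Finset ℕ} {g : ℕ → ℤ} {π : ℕ → ℝ} {κ c : ℝ}
    (hB : B ⊆ Finset.range n) (hg : ∀ i ∈ B, |g i| ≤ G) (hπ : ∀ i ∈ B, 0 ≤ π i)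
    (hκ : 0 < κ) (hd : ∀ i ∈ B, π i * n ≤ κ)
    (P : (ℕ → ℕ × ℕ) → Prop) (i : ℕ) (A : ℕ → ℕ × ℕ)
    (h : c ≤ avg (B.image (encode G g)) (fun v => π v.1) i m (ind P) A) :
    c / (κ * (2 * G + 1 : ℕ)) ^ m ≤ avg (draws n G) (unif n G) i m (ind P) A := by
  have hκ' : 0 < κ * (2 * G + 1 : ℕ) := by positivity
  rw [div_le_iff₀ (by positivity), mul_comm]
  refine h.trans (avg_le_of_weight_le ?_ ?_ (fun v _ => unif_nonneg _ _ _) hκ'.le ?_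
    (ind_nonneg _) _ _ _)
  · intro v hv
    obtain ⟨b, hb, rfl⟩ := Finset.mem_image.1 hv
    exact encode_mem_draws (Finset.mem_range.1 (hB hb)) (hg b hb)
  · intro v hv
    obtain ⟨b, hb, rfl⟩ := Finset.mem_image.1 hv
    exact hπ b hb
  · intro v hv
    obtain ⟨b, hb, rfl⟩ := Finset.mem_image.1 hv
    have hn : 0 < n := lt_of_le_of_lt (Nat.zero_le _) (Finset.mem_range.1 (hB hb))
    have hn' : (0 : ℝ) < n := by exact_mod_cast hn
    have h2 : κ * ((2 * G + 1 : ℕ) : ℝ) * unif n G (encode G g b) = κ / n := by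
      unfold unif; push_cast; field_simp
    rw [h2, le_div_iff₀ hn']
    exact hd b hb

/-- Least squares: the optimal coefficient vector and the excess of any other one. -/
theorem sum_norm_sub_smul_sq (B : Finset ℕ) (t : ℕ → ℝ) (w : ℕ → H) (b e : H)
    (hb : ∑ i ∈ B, t i • (w i - t i • b) = 0) :
    ∑ i ∈ B, ‖w i - t i • e‖ ^ 2
      = ∑ i ∈ B, ‖w i - t i • b‖ ^ 2 + (∑ i ∈ B, t i ^ 2) * ‖e - b‖ ^ 2 := by
  -- The cross term is linear in `e - b` and cancels in the sum by the normal equation `hb`.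
  have h : ∀ i, ‖w i - t i • e‖ ^ 2 = ‖w i - t i • b‖ ^ 2
      - 2 * inner ℝ (t i • (w i - t i • b)) (e - b) + t i ^ 2 * ‖e - b‖ ^ 2 := by
    intro i
    have : w i - t i • e = (w i - t i • b) - t i • (e - b) := by rw [smul_sub]; abel
    rw [this, norm_sub_sq_real, real_inner_smul_right, real_inner_smul_left, norm_smul, mul_pow,
      Real.norm_eq_abs, sq_abs]
  simp only [h, Finset.sum_add_distrib, Finset.sum_sub_distrib, ← Finset.mul_sum, ← sum_inner, hb,
    inner_zero_left, ← Finset.sum_mul]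
  ring

/-- The regression vector computed from weighted draws is nearly optimal with probability at least
one half, for draws from a suitable distribution of bounded density. -/
theorem regression_sample {m G : ℕ} (hm : 0 < m) {B : Finset ℕ} (hB : B.Nonempty) {t : ℕ → ℝ}
    {g : ℕ → ℤ} {a : ℝ} (ha : 0 < a) (hg : ∀ i ∈ B, |g i| ≤ G)
    (hgt : ∀ i ∈ B, a / 2 ≤ g i * t i ∧ g i * t i ≤ a) (w : ℕ → H) :
    ∃ π : ℕ → ℝ, (∀ i ∈ B, 0 ≤ π i) ∧
      (∀ i ∈ B, π i * ∑ i ∈ B, t i ^ 2 ≤ a * (t i / g i)) ∧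
      ∀ (i₀ : ℕ) (A : ℕ → ℕ × ℕ), 1 / 2 ≤ avg (B.image (encode G g)) (fun v => π v.1) i₀ m
        (ind fun A => (∀ r < m, (A (i₀ + r)).1 ∈ B) ∧
          ∑ r ∈ Finset.range m, coef G (A (i₀ + r)) * t (A (i₀ + r)).1 ≠ 0 ∧
          ∑ i ∈ B, ‖w i - t i • ((∑ r ∈ Finset.range m,
              coef G (A (i₀ + r)) * t (A (i₀ + r)).1)⁻¹ •
            ∑ r ∈ Finset.range m, coef G (A (i₀ + r)) • w (A (i₀ + r)).1)‖ ^ 2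
          ≤ (1 + 8 / m) * ∑ i ∈ B, ‖w i‖ ^ 2) A := by
  have hm' : (0 : ℝ) < m := by exact_mod_cast hm
  have hpos : ∀ i ∈ B, 0 < t i / g i := by
    intro i hi
    have h1 : 0 < g i * t i := by have := (hgt i hi).1; linarith
    have h2 : (g i : ℝ) ≠ 0 := left_ne_zero_of_mul h1.ne'
    have : t i / g i = g i * t i / (g i) ^ 2 := by field_simp
    rw [this]; positivity
  set Z := ∑ i ∈ B, t i / g i with hZ
  set lam := ∑ i ∈ B, t i ^ 2 with hlam
  have hZpos : 0 < Z := Finset.sum_pos hpos hB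
  have hlamZ : lam ≤ a * Z := by
    rw [hlam, hZ, Finset.mul_sum]
    refine Finset.sum_le_sum fun i hi => ?_
    have h2 : (g i : ℝ) ≠ 0 := by
      have := hpos i hi; intro h; rw [h] at this; simp at this
    have : t i ^ 2 = (g i * t i) * (t i / g i) := by field_simp
    rw [this]
    exact mul_le_mul_of_nonneg_right (hgt i hi).2 (hpos i hi).le
  have hlampos : 0 < lam := by
    refine Finset.sum_pos (fun i hi => ?_) hB
    have := hpos i hi
    have : t i ≠ 0 := by intro h; rw [h] at this; simp at this
    positivity
  set b : H := lam⁻¹ • ∑ i ∈ B, t i • w i with hb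
  have hbz : ∑ i ∈ B, t i • (w i - t i • b) = 0 := by
    simp only [smul_sub, Finset.sum_sub_distrib, smul_smul, ← Finset.sum_smul, ← pow_two]
    rw [← hlam, hb, smul_smul, mul_inv_cancel₀ hlampos.ne', one_smul, sub_self]
  set Φ := ∑ i ∈ B, ‖w i - t i • b‖ ^ 2 with hΦ
  have hΦw : Φ ≤ ∑ i ∈ B, ‖w i‖ ^ 2 := by
    have := sum_norm_sub_smul_sq B t w b 0 hbz
    simp only [smul_zero, sub_zero] at this
    rw [this]
    have : 0 ≤ lam * ‖0 - b‖ ^ 2 := by positivity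
    linarith
  have hΦ0 : 0 ≤ Φ := Finset.sum_nonneg fun _ _ => sq_nonneg _
  -- With these weights the coefficient cancels from the mean: `∑ π g (w - t b) = Z⁻¹ ∑ t (w - t b)
  -- = 0`. In the second moment `π g² = g t / Z ≤ a / Z`.
  refine ⟨fun i => t i / g i / Z, fun i hi => (div_pos (hpos i hi) hZpos).le, fun i hi => ?_,
    fun i₀ A => ?_⟩
  · rw [div_mul_eq_mul_div, div_le_iff₀ hZpos]
    have := mul_le_mul_of_nonneg_left hlamZ (hpos i hi).le
    nlinarith
  · have hinj := (encode_injective G g).injOn (s := (B : Set ℕ))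
    set S := B.image (encode G g) with hS
    have hS1 : ∀ v ∈ S, v.1 ∈ B ∧ coef G v = g v.1 := by
      intro v hv
      obtain ⟨c, hc, rfl⟩ := Finset.mem_image.1 hv
      exact ⟨hc, coef_encode (hg c hc)⟩
    set ξ : ℕ × ℕ → H := fun v => coef G v • (w v.1 - t v.1 • b) with hξ
    have hw0 : ∀ v ∈ S, 0 < (fun v : ℕ × ℕ => t v.1 / g v.1 / Z) v :=
      fun v hv => div_pos (hpos _ (hS1 v hv).1) hZpos
    have hw1 : ∑ v ∈ S, (fun v : ℕ × ℕ => t v.1 / g v.1 / Z) v = 1 := by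
      rw [hS, Finset.sum_image hinj]
      simp only [encode]
      rw [← Finset.sum_div, ← hZ, div_self hZpos.ne']
    have hmean : ∑ v ∈ S, (fun v : ℕ × ℕ => t v.1 / g v.1 / Z) v • ξ v = 0 := by
      rw [hS, Finset.sum_image hinj]
      have : ∑ i ∈ B, (t i / g i / Z) • ((g i : ℝ) • (w i - t i • b)) = 0 := by
        rw [← smul_zero (Z⁻¹ : ℝ), ← hbz, Finset.smul_sum]
        refine Finset.sum_congr rfl fun i hi => ?_
        have h2 : (g i : ℝ) ≠ 0 := by
          have := hpos i hi; intro h; rw [h] at this; simp at this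
        rw [smul_smul, smul_smul Z⁻¹ (t i)]; congr 1; field_simp
      rw [← this]
      refine Finset.sum_congr rfl fun i hi => ?_
      simp only [hξ, coef_encode (hg i hi)]
      rfl
    have hvar : ∑ v ∈ S, (fun v : ℕ × ℕ => t v.1 / g v.1 / Z) v * ‖ξ v‖ ^ 2 ≤ a / Z * Φ := by
      rw [hS, Finset.sum_image hinj, hΦ, Finset.mul_sum]
      refine Finset.sum_le_sum fun i hi => ?_
      simp only [hξ, coef_encode (hg i hi)]
      simp only [encode]
      have h2 : (g i : ℝ) ≠ 0 := by
        have := hpos i hi; intro h; rw [h] at this; simp at this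
      rw [norm_smul, mul_pow, Real.norm_eq_abs, sq_abs]
      have : t i / g i / Z * ((g i : ℝ) ^ 2 * ‖w i - t i • b‖ ^ 2)
          = (g i * t i) / Z * ‖w i - t i • b‖ ^ 2 := by field_simp
      rw [this]
      have := (hgt i hi).2
      gcongr
    refine (half_le_avg_norm_sq_le hw0 hw1 ξ hmean i₀ m A).trans
      (avg_mono (fun v hv => (hw0 v hv).le) _ _ _ fun A' hA' => ind_mono fun hle => ?_)
    have hmem : ∀ r ∈ Finset.range m, (A' (i₀ + r)) ∈ S := fun r hr => by
      have := Finset.mem_range.1 hr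
      exact hA'.2 _ (by omega) (by omega)
    set s := ∑ r ∈ Finset.range m, coef G (A' (i₀ + r)) * t (A' (i₀ + r)).1 with hs
    have hsge : m * (a / 2) ≤ s := by
      rw [hs, ← nsmul_eq_mul, ← Finset.card_range m, ← Finset.sum_const, Finset.card_range]
      refine Finset.sum_le_sum fun r hr => ?_
      have := hS1 _ (hmem r hr)
      rw [this.2]
      exact (hgt _ this.1).1
    have hspos : 0 < s := lt_of_lt_of_le (by positivity) hsge
    refine ⟨fun r hr => (hS1 _ (hmem r (Finset.mem_range.2 hr))).1, hspos.ne', ?_⟩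
    set e := s⁻¹ • ∑ r ∈ Finset.range m, coef G (A' (i₀ + r)) • w (A' (i₀ + r)).1 with he
    -- Since `s` is the sum of the products of coefficients and `t`, subtracting `b` from `e`
    -- centres each sampled term.
    have heb : e - b = s⁻¹ • ∑ r ∈ Finset.range m, ξ (A' (i₀ + r)) := by
      simp only [hξ, smul_sub, Finset.sum_sub_distrib, smul_smul, ← Finset.sum_smul]
      rw [← hs, inv_mul_cancel₀ hspos.ne', one_smul]
    -- From `lam ≤ a Z`, `s ≥ m a / 2` and the Markov bound `2 m (a / Z) Φ`, the product is at most
    -- `8 Φ / m`.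
    have hn : lam * ‖e - b‖ ^ 2 ≤ 8 / m * Φ := by
      rw [heb, norm_smul, mul_pow, Real.norm_eq_abs, sq_abs, inv_pow]
      have h1 : ‖∑ r ∈ Finset.range m, ξ (A' (i₀ + r))‖ ^ 2 ≤ 2 * (m * (a / Z * Φ)) := by
        refine hle.trans ?_
        gcongr
      have h2 : (m * (a / 2)) ^ 2 ≤ s ^ 2 := pow_le_pow_left₀ (by positivity) hsge 2
      have h3 : (s ^ 2)⁻¹ ≤ ((m * (a / 2)) ^ 2)⁻¹ := inv_anti₀ (by positivity) h2
      calc lam * ((s ^ 2)⁻¹ * ‖∑ r ∈ Finset.range m, ξ (A' (i₀ + r))‖ ^ 2)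
          ≤ (a * Z) * (((m * (a / 2)) ^ 2)⁻¹ * (2 * (m * (a / Z * Φ)))) := by gcongr
        _ = 8 / m * Φ := by field_simp; ring
    rw [sum_norm_sub_smul_sq B t w b e hbz, ← hΦ, ← hlam]
    have : 0 ≤ 8 / (m : ℝ) := by positivity
    nlinarith

/-- The bound on the ratios of the scales that are told apart. -/
def scaleBound (E : ℕ) : ℕ := 8 * E ^ 2

/-- The bound on the coefficients. -/
def coefBound (E : ℕ) : ℕ := scaleBound E ^ 2

/-- The number of draws per regression. -/
def sampleSize (E : ℕ) : ℕ := 16 * E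

/-- The density of the regression distribution relative to the uniform one. -/
noncomputable def densityBound (E : ℕ) : ℝ :=
  2 * (scaleBound E : ℝ) ^ 2 * (E : ℝ) ^ 2 * (2 * coefBound E + 1 : ℕ)

theorem one_le_densityBound {E : ℕ} (hE : 1 ≤ E) : 1 ≤ densityBound E := by
  unfold densityBound scaleBound
  have h1 : (1 : ℝ) ≤ E := by exact_mod_cast hE
  push_cast
  have h2 : (1 : ℝ) ≤ (E : ℝ) ^ 2 := one_le_pow₀ h1
  have h3 : (1 : ℝ) ≤ (8 * (E : ℝ) ^ 2) ^ 2 := one_le_pow₀ (by linarith)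
  have h4 : (1 : ℝ) ≤ 2 * (coefBound E : ℝ) + 1 := by
    have : (0 : ℝ) ≤ coefBound E := by positivity
    linarith
  have h5 := one_le_mul_of_one_le_of_one_le h3 h2
  have h6 := one_le_mul_of_one_le_of_one_le h5 h4
  nlinarith

/-- Few indices exceed the quantile. -/
theorem card_le_quantile {Y : Finset ℕ} {t : ℕ → ℝ} {T η : ℝ}
    (hT : ((Y.filter fun i => T < |t i|).card : ℝ) ≤ η * Y.card) :
    (1 - η) * Y.card ≤ ((Y.filter fun i => |t i| ≤ T).card : ℝ) := by
  have h := Finset.card_filter_add_card_filter_not (s := Y) (fun i => |t i| ≤ T)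
  simp only [not_le] at h
  have h' : ((Y.filter fun i => |t i| ≤ T).card : ℝ) + ((Y.filter fun i => T < |t i|).card : ℝ)
      = Y.card := by exact_mod_cast h
  linarith

/-- This fixes the size of `scaleBound`. A perturbation of squared norm `c E W / (N K²)` per index,
weighted by the factor `1 + 2E` of Young's inequality, must use at most half of the admissible
excess `W / E`. The values `c = 4` and `c = 10` occur. -/
theorem mul_div_sq_le {E K c : ℝ} (hE : 2 ≤ E) (hK : K = 8 * E ^ 2) (hc : c ≤ 10) :
    (1 + 2 * E) * (c * E / K ^ 2) ≤ 1 / (2 * E) := by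
  have h : (1 + 2 * E) * (10 * E / K ^ 2) ≤ 1 / (2 * E) := by
    rw [hK, ← mul_div_assoc, div_le_div_iff₀ (by positivity) (by positivity)]
    have h1 : 0 ≤ 64 * E ^ 2 - 40 * E - 20 := by nlinarith
    nlinarith [mul_nonneg (sq_nonneg E) h1]
  refine le_trans ?_ h
  gcongr

/-- A vector so small that it hardly matters at the scales up to `T`. -/
theorem sum_le_of_norm_le {E : ℕ} (hE : 2 ≤ E) {Y : Finset ℕ} {t : ℕ → ℝ} {w : ℕ → H} {T K : ℝ}
    (hKE : K = 8 * (E : ℝ) ^ 2) (hNpos : (0 : ℝ) < Y.card) {e : H}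
    (hTe2 : (T * ‖e‖) ^ 2 ≤ 4 * E * (∑ i ∈ Y, ‖w i‖ ^ 2) / Y.card / K ^ 2) :
    ∑ i ∈ Y.filter (fun i => |t i| ≤ T), ‖w i - t i • e‖ ^ 2
      ≤ (1 + 1 / (E : ℝ)) * ∑ i ∈ Y, ‖w i‖ ^ 2 := by
  have hE' : (2 : ℝ) ≤ E := by exact_mod_cast hE
  have hKpos : 0 < K := by rw [hKE]; positivity
  set N : ℝ := ((Y.card : ℕ) : ℝ) with hN
  set W := ∑ i ∈ Y, ‖w i‖ ^ 2 with hW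
  have hW0 : 0 ≤ W := Finset.sum_nonneg fun _ _ => sq_nonneg _
  -- Half of the excess `1/E` goes to Young's inequality for `‖w i‖²`, the other half to the
  -- perturbation `t i • e`.
  have hδ : (0 : ℝ) < 1 / (2 * E) := by positivity
  calc ∑ i ∈ Y.filter (fun i => |t i| ≤ T), ‖w i - t i • e‖ ^ 2
      ≤ ∑ i ∈ Y.filter (fun i => |t i| ≤ T), ((1 + 1 / (2 * E)) * ‖w i‖ ^ 2
        + (1 + 2 * E) * (4 * E * W / N / K ^ 2)) := by
        refine Finset.sum_le_sum fun i hi => ?_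
        refine (norm_sub_sq_le_weighted hδ _ _).trans ?_
        rw [one_div_one_div]
        have : ‖t i • e‖ ^ 2 ≤ 4 * E * W / N / K ^ 2 := by
          refine le_trans ?_ hTe2
          rw [norm_smul, Real.norm_eq_abs]
          have := (Finset.mem_filter.1 hi).2
          gcongr
        gcongr
    _ ≤ ∑ i ∈ Y, ((1 + 1 / (2 * E)) * ‖w i‖ ^ 2 + (1 + 2 * E) * (4 * E * W / N / K ^ 2)) :=
        Finset.sum_le_sum_of_subset_of_nonneg (Finset.filter_subset _ _)
          fun i _ _ => by positivity
    _ = (1 + 1 / (2 * E)) * W + (1 + 2 * E) * (4 * E / K ^ 2) * W := by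
        rw [Finset.sum_add_distrib, ← Finset.mul_sum, ← hW, Finset.sum_const, nsmul_eq_mul, ← hN]
        field_simp
    _ ≤ (1 + 1 / E) * W := by
        have : (1 + 2 * (E : ℝ)) * (4 * E / K ^ 2) ≤ 1 / (2 * E) :=
          mul_div_sq_le hE' hKE (by norm_num)
        have h2 : (1 : ℝ) / E = 1 / (2 * E) + 1 / (2 * E) := by field_simp; norm_num
        rw [h2]
        nlinarith

/-- The case of many indices with `|t i|` far above the quantile `T`. -/
theorem goodDraw_of_gap {n E : ℕ} (hn : 1 ≤ n) (hE : 2 ≤ E) {Y : Finset ℕ}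
    (hY : Y ⊆ Finset.range n) (hYn : n ≤ E * Y.card) (t : ℕ → ℝ) (w : ℕ → H) {T : ℝ} (hT0 : 0 < T)
    (hT : ((Y.filter fun i => T < |t i|).card : ℝ) ≤ 1 / (E : ℝ) * Y.card)
    (hL : 1 / (E : ℝ) * Y.card / 2 ≤
      ((Y.filter fun i => scaleBound E * T < |t i|).card : ℝ))
    (i₀ : ℕ) (A : ℕ → ℕ × ℕ) :
    1 / densityBound E ^ sampleSize E ≤ avg (draws n (coefBound E)) (unif n (coefBound E)) i₀
      (sampleSize E) (ind fun A => GoodDraw E (coefBound E) (sampleSize E) Y t w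
        fun r => A (i₀ + r)) A := by
  have hE' : (2 : ℝ) ≤ E := by exact_mod_cast hE
  have hn' : (1 : ℝ) ≤ n := by exact_mod_cast hn
  set N : ℝ := ((Y.card : ℕ) : ℝ) with hN
  have hYn' : (n : ℝ) ≤ E * N := by rw [hN]; exact_mod_cast hYn
  have hNpos : 0 < N := by
    by_contra h
    push Not at h
    nlinarith
  set K : ℝ := ((scaleBound E : ℕ) : ℝ) with hK
  have hKE : K = 8 * (E : ℝ) ^ 2 := by rw [hK]; simp [scaleBound]
  have hKpos : 0 < K := by rw [hKE]; positivity
  set W := ∑ i ∈ Y, ‖w i‖ ^ 2 with hW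
  have hW0 : 0 ≤ W := Finset.sum_nonneg fun _ _ => sq_nonneg _
  set L := Y.filter fun i => K * T < |t i| with hLdef
  -- By Markov's inequality at most `N / (4E)` indices have `‖w i‖²` above `4E` times the mean `W /
  -- N`. As `L` has at least `N / (2E)` elements, at least `N / (4E)` are left.
  set B := L.filter fun i => ‖w i‖ ^ 2 ≤ 4 * E * W / N with hB
  have hBY : B ⊆ Y := (Finset.filter_subset _ _).trans (Finset.filter_subset _ _)
  have hBcard : 1 / (E : ℝ) * N / 4 ≤ B.card := by
    have h := Finset.card_filter_add_card_filter_not (s := L) (fun i => ‖w i‖ ^ 2 ≤ 4 * E * W / N)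
    simp only [not_le] at h
    have h' : (B.card : ℝ) + ((L.filter fun i => 4 * E * W / N < ‖w i‖ ^ 2).card : ℝ)
        = L.card := by rw [hB, ← Nat.cast_add, h]
    have hbad : ((L.filter fun i => 4 * E * W / N < ‖w i‖ ^ 2).card : ℝ) ≤ 1 / (E : ℝ) * N / 4 := by
      rcases hW0.eq_or_lt with h0 | h0
      · have : (L.filter fun i => 4 * E * W / N < ‖w i‖ ^ 2) = ∅ := by
          refine Finset.filter_eq_empty_iff.2 fun i hi => ?_
          have := (Finset.sum_eq_zero_iff_of_nonneg fun i _ => sq_nonneg (‖w i‖)).1 h0.symm i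
            (Finset.mem_filter.1 hi).1
          rw [this, ← h0]; simp
        rw [this]; simp; positivity
      · have h1 : ((L.filter fun i => 4 * E * W / N < ‖w i‖ ^ 2).card : ℝ) * (4 * E * W / N) ≤ W := by
          rw [← nsmul_eq_mul]
          refine (Finset.card_nsmul_le_sum _ (fun i => ‖w i‖ ^ 2) _ fun i hi =>
            (Finset.mem_filter.1 hi).2.le).trans ?_
          exact Finset.sum_le_sum_of_subset_of_nonneg
            ((Finset.filter_subset _ _).trans (Finset.filter_subset _ _)) fun i _ _ => sq_nonneg _
        have h3 : 0 < 4 * E * W / N := by positivity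
        have h2 : W = (1 / (E : ℝ) * N / 4) * (4 * E * W / N) := by
          rw [div_mul_div_comm, one_div_mul_eq_div, div_mul_eq_mul_div, div_div, eq_div_iff
            (by positivity)]
          ring
        exact le_of_mul_le_mul_right (h1.trans h2.le) h3
    linarith
  have hBpos : (0 : ℝ) < B.card := lt_of_lt_of_le (by positivity) hBcard
  -- Signs suffice here: they prevent cancellation in `s`, and no balancing of the sizes is needed.
  set g : ℕ → ℤ := fun i => if 0 < t i then 1 else -1 with hg
  have hgt : ∀ i, (g i : ℝ) * t i = |t i| := by
    intro i
    simp only [hg]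
    split_ifs with h
    · simp [abs_of_pos h]
    · simp [abs_of_nonpos (not_lt.1 h)]
  have hgabs : ∀ i, |(g i : ℝ)| = 1 := by intro i; simp only [hg]; split_ifs <;> simp
  have hgG : ∀ i ∈ B, |g i| ≤ (coefBound E : ℤ) := by
    intro i _
    have : |g i| = 1 := by simp only [hg]; split_ifs <;> simp
    rw [this]
    have : 1 ≤ coefBound E := Nat.one_le_iff_ne_zero.2 (by simp [coefBound, scaleBound]; omega)
    exact_mod_cast this
  have hdens : densityBound E = (2 * K ^ 2 * (E : ℝ) ^ 2) * (2 * coefBound E + 1 : ℕ) := by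
    simp [densityBound, hK]
  rw [hdens]
  refine le_avg_unif_of_density (B := B) (g := g) (π := fun _ => 1 / (B.card : ℝ))
    (hBY.trans hY) hgG (fun i _ => by positivity) (by positivity) ?_ _ _ _ ?_
  · intro i _
    rw [one_div, inv_mul_le_iff₀ hBpos]
    have h1 : 2 ≤ K := by rw [hKE]; nlinarith
    calc (n : ℝ) ≤ E * N := hYn'
      _ = (1 / (E : ℝ) * N / 4) * (4 * (E : ℝ) ^ 2) := by field_simp
      _ ≤ B.card * (2 * K ^ 2 * (E : ℝ) ^ 2) := by
        gcongr
        nlinarith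
  · have hsum : ∑ v ∈ B.image (encode (coefBound E) g), (fun v : ℕ × ℕ => 1 / (B.card : ℝ)) v = 1 := by
      rw [Finset.sum_image (encode_injective _ _).injOn]
      simp [hBpos.ne']
    -- Every sample from `B` is good, so the probability is one before the change of measure.
    refine (avg_const hsum 1 i₀ (sampleSize E) A).symm.le.trans
      (avg_mono (fun v _ => by positivity) _ _ _ fun A' hA' => ?_)
    rw [ind_of]
    set m := sampleSize E with hm
    have hmpos : 0 < m := by simp [hm, sampleSize]; omega
    have hmem : ∀ r < m, (A' (i₀ + r)).1 ∈ B ∧ coef (coefBound E) (A' (i₀ + r))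
        = g (A' (i₀ + r)).1 := by
      intro r hr
      obtain ⟨c, hc, hc'⟩ := Finset.mem_image.1 (hA'.2 (i₀ + r) (by omega) (by omega))
      rw [← hc']
      exact ⟨hc, coef_encode (hgG c hc)⟩
    have hBprop : ∀ i ∈ B, K * T < |t i| ∧ ‖w i‖ ^ 2 ≤ 4 * E * W / N := fun i hi =>
      ⟨(Finset.mem_filter.1 (Finset.mem_filter.1 hi).1).2, (Finset.mem_filter.1 hi).2⟩
    set s := ∑ r ∈ Finset.range m, coef (coefBound E) (A' (i₀ + r)) * t (A' (i₀ + r)).1 with hs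
    have hsge : m * (K * T) ≤ s := by
      rw [hs, ← nsmul_eq_mul, ← Finset.card_range m, ← Finset.sum_const, Finset.card_range]
      refine Finset.sum_le_sum fun r hr => ?_
      obtain ⟨h1, h2⟩ := hmem r (Finset.mem_range.1 hr)
      rw [h2, hgt]
      exact (hBprop _ h1).1.le
    have hspos : 0 < s := lt_of_lt_of_le (by positivity) hsge
    refine ⟨Y.filter fun i => |t i| ≤ T, Finset.filter_subset _ _, card_le_quantile hT, _,
      Or.inr ⟨fun r hr => hBY (hmem r hr).1, hspos.ne', rfl⟩, ?_⟩
    set e := s⁻¹ • ∑ r ∈ Finset.range m, coef (coefBound E) (A' (i₀ + r)) • w (A' (i₀ + r)).1 with he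
    have hnum : ‖∑ r ∈ Finset.range m, coef (coefBound E) (A' (i₀ + r)) • w (A' (i₀ + r)).1‖
        ≤ m * Real.sqrt (4 * E * W / N) := by
      refine (norm_sum_le _ _).trans ?_
      rw [← nsmul_eq_mul, ← Finset.card_range m, ← Finset.sum_const, Finset.card_range]
      refine Finset.sum_le_sum fun r hr => ?_
      obtain ⟨h1, h2⟩ := hmem r (Finset.mem_range.1 hr)
      rw [norm_smul, h2, Real.norm_eq_abs, hgabs, one_mul]
      exact Real.le_sqrt_of_sq_le (hBprop _ h1).2
    -- The numerator of `e` has norm at most `m √(4EW/N)`, while `s ≥ m K T`.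
    have hTe : T * ‖e‖ ≤ Real.sqrt (4 * E * W / N) / K := by
      rw [he, norm_smul, norm_inv, Real.norm_eq_abs, abs_of_pos hspos, le_div_iff₀ hKpos,
        mul_assoc, mul_comm _ K, ← mul_assoc, inv_mul_eq_div, ← mul_div_assoc, div_le_iff₀ hspos]
      calc T * K * ‖∑ r ∈ Finset.range m, coef (coefBound E) (A' (i₀ + r)) • w (A' (i₀ + r)).1‖
          ≤ T * K * (m * Real.sqrt (4 * E * W / N)) := by gcongr
        _ = Real.sqrt (4 * E * W / N) * (m * (K * T)) := by ring
        _ ≤ _ := by gcongr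
    have hTe2 : (T * ‖e‖) ^ 2 ≤ 4 * E * W / N / K ^ 2 := by
      refine (pow_le_pow_left₀ (by positivity) hTe 2).trans ?_
      rw [div_pow, Real.sq_sqrt (by positivity)]
    exact sum_le_of_norm_le hE hKE hNpos hTe2

/-- A regression vector for the indices `B` of moderate scale also serves the indices of small
scale. -/
theorem sum_le_of_regression {E : ℕ} (hE : 2 ≤ E) {Y : Finset ℕ} {t : ℕ → ℝ} {w : ℕ → H} {T K : ℝ}
    (hT0 : 0 < T) (hKE : K = 8 * (E : ℝ) ^ 2) (hNpos : (0 : ℝ) < Y.card)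
    (hlam : 1 / (E : ℝ) * Y.card / 2 * T ^ 2 ≤
      ∑ i ∈ Y.filter (fun i => T / K ≤ |t i| ∧ |t i| ≤ K * T), t i ^ 2) {e : H}
    (hle : ∑ i ∈ Y.filter (fun i => T / K ≤ |t i| ∧ |t i| ≤ K * T), ‖w i - t i • e‖ ^ 2 ≤
      (1 + 1 / (2 * E)) * ∑ i ∈ Y.filter (fun i => T / K ≤ |t i| ∧ |t i| ≤ K * T), ‖w i‖ ^ 2) :
    ∑ i ∈ Y.filter (fun i => |t i| ≤ T), ‖w i - t i • e‖ ^ 2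
      ≤ (1 + 1 / (E : ℝ)) * ∑ i ∈ Y, ‖w i‖ ^ 2 := by
  have hE' : (2 : ℝ) ≤ E := by exact_mod_cast hE
  have hKpos : 0 < K := by rw [hKE]; positivity
  have hK1 : 1 ≤ K := by rw [hKE]; nlinarith
  have hδ : (0 : ℝ) < 1 / (2 * E) := by positivity
  set N : ℝ := ((Y.card : ℕ) : ℝ) with hN
  set W := ∑ i ∈ Y, ‖w i‖ ^ 2 with hW
  have hW0 : 0 ≤ W := Finset.sum_nonneg fun _ _ => sq_nonneg _
  set B := Y.filter fun i => T / K ≤ |t i| ∧ |t i| ≤ K * T with hB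
  have hBY : B ⊆ Y := Finset.filter_subset _ _
  set lam := ∑ i ∈ B, t i ^ 2 with hlamdef
  set WB := ∑ i ∈ B, ‖w i‖ ^ 2 with hWB
  have hWBW : WB ≤ W := Finset.sum_le_sum_of_subset_of_nonneg hBY fun _ _ _ => sq_nonneg _
  have hWB0 : 0 ≤ WB := Finset.sum_nonneg fun _ _ => sq_nonneg _
  have hδ1 : 1 / (2 * (E : ℝ)) ≤ 1 / 2 := by
    rw [div_le_div_iff₀ (by positivity) (by positivity)]; linarith
  -- Write `t i • e` as `w i` minus the residual. The two halves contribute at most `2 W` and `2 ·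
  -- (3/2) W`.
  have hlame : lam * ‖e‖ ^ 2 ≤ 5 * W := by
    have h1 : lam * ‖e‖ ^ 2 ≤ ∑ i ∈ B, (2 * ‖w i - t i • e‖ ^ 2 + 2 * ‖w i‖ ^ 2) := by
      rw [hlamdef, Finset.sum_mul]
      refine Finset.sum_le_sum fun i _ => ?_
      have h2 : t i ^ 2 * ‖e‖ ^ 2 = ‖w i - (w i - t i • e)‖ ^ 2 := by
        rw [sub_sub_cancel, norm_smul, mul_pow, Real.norm_eq_abs, sq_abs]
      rw [h2]
      have := norm_sub_sq_le_weighted one_pos (w i) (w i - t i • e)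
      norm_num at this ⊢
      linarith
    rw [Finset.sum_add_distrib, ← Finset.mul_sum, ← Finset.mul_sum] at h1
    nlinarith
  have hTe : T ^ 2 * ‖e‖ ^ 2 ≤ 10 * E * W / N := by
    rw [le_div_iff₀ hNpos]
    have h1 : 1 / (E : ℝ) * N / 2 * T ^ 2 * ‖e‖ ^ 2 ≤ 5 * W :=
      (mul_le_mul_of_nonneg_right hlam (sq_nonneg _)).trans hlame
    have h2 : T ^ 2 * ‖e‖ ^ 2 * N = 2 * E * (1 / (E : ℝ) * N / 2 * T ^ 2 * ‖e‖ ^ 2) := by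
      field_simp
    rw [h2]
    nlinarith
  -- An index of scale at most `T` outside `B` must have `|t i| < T / K`. There `t i • e` is
  -- negligible, because `T ‖e‖` is bounded by `hTe`.
  have hsplit : (Y.filter fun i => |t i| ≤ T) ⊆ B ∪ (Y \ B).filter fun i => |t i| < T / K := by
    intro i hi
    obtain ⟨h1, h2⟩ := Finset.mem_filter.1 hi
    by_cases hiB : i ∈ B
    · exact Finset.mem_union_left _ hiB
    · refine Finset.mem_union_right _ (Finset.mem_filter.2 ⟨Finset.mem_sdiff.2 ⟨h1, hiB⟩, ?_⟩)
      by_contra hc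
      exact hiB (Finset.mem_filter.2 ⟨h1, not_lt.1 hc, h2.trans (le_mul_of_one_le_left hT0.le hK1)⟩)
  calc ∑ i ∈ Y.filter (fun i => |t i| ≤ T), ‖w i - t i • e‖ ^ 2
      ≤ ∑ i ∈ B ∪ (Y \ B).filter (fun i => |t i| < T / K), ‖w i - t i • e‖ ^ 2 :=
        Finset.sum_le_sum_of_subset_of_nonneg hsplit fun _ _ _ => sq_nonneg _
    _ = ∑ i ∈ B, ‖w i - t i • e‖ ^ 2
        + ∑ i ∈ (Y \ B).filter (fun i => |t i| < T / K), ‖w i - t i • e‖ ^ 2 :=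
        Finset.sum_union ((Finset.disjoint_sdiff).mono_right (Finset.filter_subset _ _))
    _ ≤ (1 + 1 / (2 * E)) * WB + ∑ i ∈ (Y \ B).filter (fun i => |t i| < T / K),
        ((1 + 1 / (2 * E)) * ‖w i‖ ^ 2 + (1 + 2 * E) * (10 * E * W / N / K ^ 2)) := by
        refine add_le_add hle (Finset.sum_le_sum fun i hi => ?_)
        refine (norm_sub_sq_le_weighted hδ _ _).trans ?_
        rw [one_div_one_div]
        have : ‖t i • e‖ ^ 2 ≤ 10 * E * W / N / K ^ 2 := by
          rw [norm_smul, Real.norm_eq_abs, mul_pow, le_div_iff₀ (by positivity)]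
          refine le_trans ?_ hTe
          have h1 : |t i| ^ 2 ≤ (T / K) ^ 2 :=
            pow_le_pow_left₀ (abs_nonneg _) (Finset.mem_filter.1 hi).2.le 2
          have h2 : T ^ 2 * ‖e‖ ^ 2 = (T / K) ^ 2 * ‖e‖ ^ 2 * K ^ 2 := by field_simp
          rw [h2]
          gcongr
        gcongr
    _ ≤ (1 + 1 / (2 * E)) * WB + (∑ i ∈ Y \ B, (1 + 1 / (2 * E)) * ‖w i‖ ^ 2
        + ∑ i ∈ Y, (1 + 2 * E) * (10 * E * W / N / K ^ 2)) := by
        rw [Finset.sum_add_distrib]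
        refine add_le_add le_rfl (add_le_add
          (Finset.sum_le_sum_of_subset_of_nonneg (Finset.filter_subset _ _)
            fun i _ _ => by positivity)
          (Finset.sum_le_sum_of_subset_of_nonneg
            ((Finset.filter_subset _ _).trans Finset.sdiff_subset) fun i _ _ => by positivity))
    _ = (1 + 1 / (2 * E)) * W + (1 + 2 * E) * (10 * E / K ^ 2) * W := by
        rw [← Finset.mul_sum, Finset.sum_const, nsmul_eq_mul, ← hN, hW,
          ← Finset.sum_sdiff hBY, ← hWB]
        field_simp
        ring
    _ ≤ (1 + 1 / E) * W := by
        have : (1 + 2 * (E : ℝ)) * (10 * E / K ^ 2) ≤ 1 / (2 * E) :=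
          mul_div_sq_le hE' hKE (by norm_num)
        have h2 : (1 : ℝ) / E = 1 / (2 * E) + 1 / (2 * E) := by field_simp; norm_num
        rw [h2]
        nlinarith

/-- The case of few indices with `|t i|` far above the quantile `T`. -/
theorem goodDraw_of_no_gap {n E : ℕ} (hn : 1 ≤ n) (hE : 2 ≤ E) {Y : Finset ℕ}
    (hY : Y ⊆ Finset.range n) (hYn : n ≤ E * Y.card) (t : ℕ → ℝ) (w : ℕ → H) {T : ℝ} (hT0 : 0 < T)
    (hT' : 1 / (E : ℝ) * Y.card ≤ ((Y.filter fun i => T ≤ |t i|).card : ℝ))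
    (hT : ((Y.filter fun i => T < |t i|).card : ℝ) ≤ 1 / (E : ℝ) * Y.card)
    (hL : ((Y.filter fun i => scaleBound E * T < |t i|).card : ℝ) ≤ 1 / (E : ℝ) * Y.card / 2)
    (i₀ : ℕ) (A : ℕ → ℕ × ℕ) :
    1 / 2 / densityBound E ^ sampleSize E ≤ avg (draws n (coefBound E)) (unif n (coefBound E)) i₀
      (sampleSize E) (ind fun A => GoodDraw E (coefBound E) (sampleSize E) Y t w
        fun r => A (i₀ + r)) A := by
  have hE' : (2 : ℝ) ≤ E := by exact_mod_cast hE
  have hn' : (1 : ℝ) ≤ n := by exact_mod_cast hn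
  set N : ℝ := ((Y.card : ℕ) : ℝ) with hN
  have hYn' : (n : ℝ) ≤ E * N := by rw [hN]; exact_mod_cast hYn
  have hNpos : 0 < N := by
    by_contra h
    push Not at h
    nlinarith
  set K : ℝ := ((scaleBound E : ℕ) : ℝ) with hK
  have hKE : K = 8 * (E : ℝ) ^ 2 := by rw [hK]; simp [scaleBound]
  have hKpos : 0 < K := by rw [hKE]; positivity
  have hK1 : 1 ≤ K := by rw [hKE]; nlinarith
  set W := ∑ i ∈ Y, ‖w i‖ ^ 2 with hW
  have hW0 : 0 ≤ W := Finset.sum_nonneg fun _ _ => sq_nonneg _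
  set B := Y.filter fun i => T / K ≤ |t i| ∧ |t i| ≤ K * T with hB
  have hBY : B ⊆ Y := Finset.filter_subset _ _
  have hTK : T / K ≤ T := div_le_self hT0.le hK1
  -- At least `N / E` indices reach `T` and at most half that number exceed `K T`; each of the
  -- others contributes at least `T²`.
  have hlam : 1 / (E : ℝ) * N / 2 * T ^ 2 ≤ ∑ i ∈ B, t i ^ 2 := by
    have h1 : (Y.filter fun i => T ≤ |t i|) ⊆
        (Y.filter fun i => T ≤ |t i| ∧ |t i| ≤ K * T) ∪ Y.filter fun i => K * T < |t i| := by
      intro i hi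
      obtain ⟨h, h'⟩ := Finset.mem_filter.1 hi
      rcases le_or_gt |t i| (K * T) with h2 | h2
      · exact Finset.mem_union_left _ (Finset.mem_filter.2 ⟨h, h', h2⟩)
      · exact Finset.mem_union_right _ (Finset.mem_filter.2 ⟨h, h2⟩)
    have h2 := (Finset.card_le_card h1).trans (Finset.card_union_le _ _)
    have h2' : ((Y.filter fun i => T ≤ |t i|).card : ℝ) ≤
        ((Y.filter fun i => T ≤ |t i| ∧ |t i| ≤ K * T).card : ℝ)
        + ((Y.filter fun i => K * T < |t i|).card : ℝ) := by exact_mod_cast h2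
    calc 1 / (E : ℝ) * N / 2 * T ^ 2
        ≤ ((Y.filter fun i => T ≤ |t i| ∧ |t i| ≤ K * T).card : ℝ) * T ^ 2 := by
          gcongr; linarith
      _ ≤ ∑ i ∈ Y.filter (fun i => T ≤ |t i| ∧ |t i| ≤ K * T), t i ^ 2 := by
          rw [← nsmul_eq_mul]
          refine Finset.card_nsmul_le_sum _ _ _ fun i hi => ?_
          rw [← sq_abs (t i)]
          exact pow_le_pow_left₀ hT0.le (Finset.mem_filter.1 hi).2.1 2
      _ ≤ _ := by
          refine Finset.sum_le_sum_of_subset_of_nonneg (fun i hi => ?_) fun i _ _ => sq_nonneg _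
          obtain ⟨h, h', h''⟩ := Finset.mem_filter.1 hi
          exact Finset.mem_filter.2 ⟨h, hTK.trans h', h''⟩
  set lam := ∑ i ∈ B, t i ^ 2 with hlamdef
  have hlampos : 0 < lam := lt_of_lt_of_le (by positivity) hlam
  have hBne : B.Nonempty := by
    rcases B.eq_empty_or_nonempty with h | h
    · rw [hlamdef, h] at hlampos; simp at hlampos
    · exact h
  have hBprop : ∀ i ∈ B, T / K ≤ |t i| ∧ |t i| ≤ K * T := fun i hi => (Finset.mem_filter.1 hi).2
  have htpos : ∀ i ∈ B, 0 < |t i| := fun i hi => lt_of_lt_of_le (by positivity) (hBprop i hi).1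
  -- Rounding `K T / |t i| ≥ 1` down loses at most a factor of two, so `g i * t i` lies between `K T
  -- / 2` and `K T`. Since `|t i| ≥ T / K`, the coefficient is at most `K²`, which is `coefBound`.
  set g : ℕ → ℤ := fun i => (if 0 < t i then 1 else -1) * (⌊K * T / |t i|⌋₊ : ℤ) with hg
  have hgt : ∀ i, (g i : ℝ) * t i = ⌊K * T / |t i|⌋₊ * |t i| := by
    intro i
    simp only [hg]
    split_ifs with h
    · simp [abs_of_pos h]
    · simp [abs_of_nonpos (not_lt.1 h)]
  have hgabs : ∀ i, |g i| = (⌊K * T / |t i|⌋₊ : ℤ) := by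
    intro i
    simp only [hg]
    split_ifs <;> simp
  have hx1 : ∀ i ∈ B, 1 ≤ K * T / |t i| := fun i hi => by
    rw [le_div_iff₀ (htpos i hi)]; linarith [(hBprop i hi).2]
  have hfl1 : ∀ i ∈ B, 1 ≤ ⌊K * T / |t i|⌋₊ := fun i hi => by
    rw [Nat.one_le_floor_iff]; exact hx1 i hi
  have hgG : ∀ i ∈ B, |g i| ≤ (coefBound E : ℤ) := by
    intro i hi
    rw [hgabs]
    have : ⌊K * T / |t i|⌋₊ ≤ coefBound E := by
      refine Nat.floor_le_of_le ?_
      rw [div_le_iff₀ (htpos i hi)]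
      have h1 := (hBprop i hi).1
      rw [div_le_iff₀ hKpos] at h1
      have : (coefBound E : ℝ) = K ^ 2 := by simp [coefBound, hK]
      rw [this]
      nlinarith
    exact_mod_cast this
  have hgt' : ∀ i ∈ B, K * T / 2 ≤ g i * t i ∧ g i * t i ≤ K * T := by
    intro i hi
    rw [hgt]
    have h1 := Nat.floor_le (le_trans zero_le_one (hx1 i hi))
    have h2 := Nat.lt_floor_add_one (K * T / |t i|)
    have h3 : (1 : ℝ) ≤ ⌊K * T / |t i|⌋₊ := by exact_mod_cast hfl1 i hi
    rw [le_div_iff₀ (htpos i hi)] at h1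
    rw [div_lt_iff₀ (htpos i hi)] at h2
    exact ⟨by nlinarith [htpos i hi], h1⟩
  set m := sampleSize E with hm
  have hmpos : 0 < m := by simp [hm, sampleSize]; omega
  obtain ⟨π, hπ0, hπ1, hπ⟩ := regression_sample hmpos hBne (a := K * T) (by positivity) hgG hgt' w
  have hdens : densityBound E = (2 * K ^ 2 * (E : ℝ) ^ 2) * (2 * coefBound E + 1 : ℕ) := by
    simp [densityBound, hK]
  rw [hdens]
  refine le_avg_unif_of_density (B := B) (g := g) (π := π)
    (hBY.trans hY) hgG hπ0 (by positivity) ?_ _ _ _ ((hπ i₀ A).trans ?_)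
  · intro i hi
    have h1 := hπ1 i hi
    have hgpos : (1 : ℝ) ≤ |(g i : ℝ)| := by
      rw [← Int.cast_abs, hgabs]; exact_mod_cast hfl1 i hi
    have h2 : t i / g i ≤ K * T := by
      refine (le_abs_self _).trans ?_
      rw [abs_div, div_le_iff₀ (by linarith)]
      have := (hBprop i hi).2
      have : 0 < K * T := by positivity
      nlinarith
    -- Density bound: `π i * lam` is at most `K T · (t i / g i) ≤ (K T)²`, and `lam` is at least of
    -- order `N T² / E`. The powers of `T` cancel.
    have h3 : π i * (1 / (E : ℝ) * N / 2 * T ^ 2) ≤ K * T * (K * T) := by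
      calc π i * (1 / (E : ℝ) * N / 2 * T ^ 2) ≤ π i * lam :=
            mul_le_mul_of_nonneg_left hlam (hπ0 i hi)
        _ ≤ _ := h1
        _ ≤ _ := by gcongr
    have h4 : π i * N ≤ 2 * K ^ 2 * E := by
      have h5 : π i * (1 / (E : ℝ) * N / 2 * T ^ 2) = (π i * N) * (T ^ 2 / (2 * E)) := by
        field_simp
      have h6 : K * T * (K * T) = (2 * K ^ 2 * E) * (T ^ 2 / (2 * E)) := by field_simp
      rw [h5, h6] at h3
      exact le_of_mul_le_mul_right h3 (by positivity)
    calc π i * n ≤ π i * (E * N) := mul_le_mul_of_nonneg_left hYn' (hπ0 i hi)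
      _ = E * (π i * N) := by ring
      _ ≤ E * (2 * K ^ 2 * E) := by gcongr
      _ = _ := by ring
  · have hπ' : ∀ v ∈ B.image (encode (coefBound E) g), 0 ≤ (fun v : ℕ × ℕ => π v.1) v := by
      intro v hv
      obtain ⟨c, hc, rfl⟩ := Finset.mem_image.1 hv
      exact hπ0 c hc
    refine avg_mono hπ' _ _ _ fun A' _ => ind_mono ?_
    rintro ⟨hmem, hs, hle⟩
    refine ⟨Y.filter fun i => |t i| ≤ T, Finset.filter_subset _ _, card_le_quantile hT, _,
      Or.inr ⟨fun r hr => hBY (hmem r hr), hs, rfl⟩, ?_⟩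
    -- This is where the sample size `16 E` comes from: the sampling error `8 / m` becomes half of
    -- `1 / E`.
    have hm8 : 8 / (m : ℝ) = 1 / (2 * E) := by
      simp only [hm, sampleSize]; push_cast; field_simp; norm_num
    rw [hm8] at hle
    exact sum_le_of_regression hE hT0 hKE hNpos hlam hle

/-- Uniform draws are good with a probability that depends on `E` only. -/
theorem le_avg_goodDraw {n E : ℕ} (hn : 1 ≤ n) (hE : 2 ≤ E) {Y : Finset ℕ}
    (hY : Y ⊆ Finset.range n) (hYn : n ≤ E * Y.card) (t : ℕ → ℝ) (w : ℕ → H)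
    (i₀ : ℕ) (A : ℕ → ℕ × ℕ) :
    1 / 2 / densityBound E ^ sampleSize E ≤ avg (draws n (coefBound E)) (unif n (coefBound E)) i₀
      (sampleSize E) (ind fun A => GoodDraw E (coefBound E) (sampleSize E) Y t w
        fun r => A (i₀ + r)) A := by
  have hE' : (2 : ℝ) ≤ E := by exact_mod_cast hE
  have hd := one_le_densityBound (E := E) (by omega)
  have hd' : 1 ≤ densityBound E ^ sampleSize E := one_le_pow₀ hd
  have hYne : Y.Nonempty := by
    rw [Finset.nonempty_iff_ne_empty]; rintro rfl; simp at hYn; omega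
  obtain ⟨T, hT0, hT1, hT2⟩ := exists_quantile hYne t (η := 1 / (E : ℝ)) (by positivity)
    (by rw [div_le_one (by positivity)]; linarith)
  -- If the quantile is zero, `t` vanishes outside a fraction `1/E` of the indices. Giving those up
  -- makes every draw good, with `e = 0`.
  rcases hT0.eq_or_lt with rfl | hT0
  · have h1 : 1 / 2 / densityBound E ^ sampleSize E ≤ 1 := by
      rw [div_le_one (by positivity)]; linarith
    refine h1.trans ?_
    rw [← avg_const (sum_unif hn (coefBound E)) 1 i₀ (sampleSize E) A]
    refine avg_mono (fun v _ => unif_nonneg _ _ _) _ _ _ fun A' _ => ?_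
    rw [ind_of]
    refine ⟨Y.filter fun i => |t i| ≤ 0, Finset.filter_subset _ _, card_le_quantile hT2, 0,
      Or.inl fun i hi => by simpa using (Finset.mem_filter.1 hi).2, ?_⟩
    simp only [smul_zero, sub_zero]
    refine (Finset.sum_le_sum_of_subset_of_nonneg (Finset.filter_subset _ _)
      fun _ _ _ => sq_nonneg _).trans ?_
    have h0 : 0 ≤ ∑ i ∈ Y, ‖w i‖ ^ 2 := Finset.sum_nonneg fun _ _ => sq_nonneg _
    have h2 : (0 : ℝ) ≤ 1 / E := by positivity
    nlinarith
  · rcases le_total (1 / (E : ℝ) * Y.card / 2)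
      ((Y.filter fun i => scaleBound E * T < |t i|).card : ℝ) with h | h
    · refine le_trans ?_ (goodDraw_of_gap hn hE hY hYn t w hT0 hT2 h i₀ A)
      gcongr
      norm_num
    · exact goodDraw_of_no_gap hn hE hY hYn t w hT0 hT1 hT2 h i₀ A

end ProjectiveClustering

/-! ### Flats spanned by combinations of sampled points -/

namespace ProjectiveClustering

open Tape

variable {H : Type*} [NormedAddCommGroup H] [InnerProductSpace ℝ H]

/-- The weighted mean of the points drawn at the positions `b, …, b + m - 1`. -/
noncomputable def centre (G m : ℕ) (x : ℕ → H) (A : ℕ → ℕ × ℕ) (b : ℕ) : H :=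
  (∑ r ∈ Finset.range m, coef G (A (b + r)))⁻¹ •
    ∑ r ∈ Finset.range m, coef G (A (b + r)) • x (A (b + r)).1

/-- The `l`-th direction: a combination of the points drawn in the block after the centre and the
first `l` directions. -/
noncomputable def dirVec (G m : ℕ) (x : ℕ → H) (A : ℕ → ℕ × ℕ) (b l : ℕ) : H :=
  ∑ r ∈ Finset.range m, coef G (A (b + (l + 1) * m + r)) •
    (x (A (b + (l + 1) * m + r)).1 - centre G m x A b)

theorem centre_congr {G m : ℕ} {x : ℕ → H} {A A' : ℕ → ℕ × ℕ} {b : ℕ}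
    (h : ∀ q, b ≤ q → q < b + m → A' q = A q) : centre G m x A' b = centre G m x A b := by
  unfold centre
  have : ∀ r ∈ Finset.range m, A' (b + r) = A (b + r) := fun r hr =>
    h _ (by omega) (by have := Finset.mem_range.1 hr; omega)
  rw [Finset.sum_congr rfl fun r hr => by rw [this r hr],
    Finset.sum_congr (g := fun r => coef G (A (b + r)) • x (A (b + r)).1) rfl
      fun r hr => by rw [this r hr]]

theorem dirVec_congr {G m : ℕ} {x : ℕ → H} {A A' : ℕ → ℕ × ℕ} {b l : ℕ}
    (h : ∀ q, b ≤ q → q < b + (l + 2) * m → A' q = A q) :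
    dirVec G m x A' b l = dirVec G m x A b l := by
  unfold dirVec
  have h2 : (l + 2) * m = (l + 1) * m + m := by ring
  have h3 : (l + 1) * m = l * m + m := by ring
  rw [centre_congr (A := A) fun q h1 h4 => h q h1 (by omega)]
  refine Finset.sum_congr rfl fun r hr => ?_
  have := Finset.mem_range.1 hr
  rw [h _ (by omega) (by omega)]

/-- After `l` blocks of draws for the cluster `X`: a large part of `X` is about as close to the flat
through the centre spanned by the new directions and the remaining reference directions as `X` is
to the reference flat (`C` is the cost of `X` with respect to the latter). -/
def ClusterState (E G m j : ℕ) (x : ℕ → H) (X : Finset ℕ) (v : ℕ → H) (C : ℝ) (b : ℕ) :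
    ℕ → (ℕ → ℕ × ℕ) → Prop
  | 0, _ => True
  | l + 1, A => ∃ Y ⊆ X, (1 - ((l + 1 : ℕ) : ℝ) / E) * X.card ≤ Y.card ∧ ∃ w : ℕ → H,
      (∀ i ∈ Y, x i - centre G m x A b - w i ∈
        Submodule.span ℝ (dirVec G m x A b '' Set.Iio l ∪ v '' Set.Ico l j)) ∧
      ∑ i ∈ Y, ‖w i‖ ^ 2 ≤ (1 + 1 / (E : ℝ)) ^ (l + 1) * C

/-- The event reads only the first `l` blocks, so draws for later clusters leave it intact. -/
theorem ClusterState.congr {E G m j : ℕ} {x : ℕ → H} {X : Finset ℕ} {v : ℕ → H} {C : ℝ} {b l : ℕ}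
    {A A' : ℕ → ℕ × ℕ} (h : ∀ q, b ≤ q → q < b + l * m → A' q = A q)
    (hA : ClusterState E G m j x X v C b l A) : ClusterState E G m j x X v C b l A' := by
  cases l with
  | zero => trivial
  | succ l =>
    obtain ⟨Y, hY, hc, w, hw, hs⟩ := hA
    refine ⟨Y, hY, hc, w, fun i hi => ?_, hs⟩
    have h3 : (l + 1) * m = l * m + m := by ring
    rw [centre_congr (A := A) fun q h1 h4 => h q h1 (by omega)]
    have : dirVec G m x A' b '' Set.Iio l = dirVec G m x A b '' Set.Iio l := by
      refine Set.image_congr fun s hs => dirVec_congr fun q h1 h4 => h q h1 (h4.trans_le ?_)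
      have : s + 2 ≤ l + 1 := by have := Set.mem_Iio.1 hs; omega
      exact Nat.add_le_add_left (Nat.mul_le_mul_right m this) b
    rw [this]
    exact hw i hi

theorem sum_smul_mem_span {ι : Type*} {s : Finset ι} {W : Submodule ℝ H} {c : ι → ℝ} {u : ι → H}
    (h : ∀ i ∈ s, u i ∈ W) : ∑ i ∈ s, c i • u i ∈ W :=
  Submodule.sum_mem _ fun i hi => Submodule.smul_mem _ _ (h i hi)

/-- The first block: from the reference flat to the parallel flat through the centre. -/
theorem ClusterState.first {E G m j : ℕ} (hE : 2 ≤ E) {x : ℕ → H} {X : Finset ℕ}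
    (hX : X.Nonempty) {v : ℕ → H} {f : H} {w₀ : ℕ → H}
    (hw₀ : ∀ i ∈ X, x i - f - w₀ i ∈ Submodule.span ℝ (v '' Set.Iio j)) {b : ℕ} {A : ℕ → ℕ × ℕ}
    (h : GoodDraw E G m X (fun _ => 1) w₀ fun r => A (b + r)) :
    ClusterState E G m j x X v (∑ i ∈ X, ‖w₀ i‖ ^ 2) b 1 A := by
  obtain ⟨R, hRX, hRc, e, he, hle⟩ := h
  have hE' : (2 : ℝ) ≤ E := by exact_mod_cast hE
  have hRne : R.Nonempty := by
    rw [← Finset.card_pos]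
    have h1 : (0 : ℝ) < X.card := by exact_mod_cast hX.card_pos
    have h2 : 1 / (E : ℝ) ≤ 1 / 2 := one_div_le_one_div_of_le (by norm_num) hE'
    have : (0 : ℝ) < R.card := lt_of_lt_of_le (by nlinarith) hRc
    exact_mod_cast this
  -- With `t = 1` and `R` nonempty the degenerate alternative of `GoodDraw` is impossible, so the
  -- sum of coefficients is nonzero.
  rcases he with he | ⟨hmem, hs, he⟩
  · obtain ⟨i, hi⟩ := hRne
    exact absurd (he i hi) one_ne_zero
  simp only [mul_one] at hs he
  refine ⟨R, hRX, by simpa using hRc, fun i => w₀ i - e, fun i hi => ?_, by simpa using hle⟩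
  set s := ∑ r ∈ Finset.range m, coef G (A (b + r)) with hsdef
  -- The centre is `f + e` up to a vector of the reference direction, so passing to it amounts to
  -- subtracting `e` from the residuals.
  have hc : centre G m x A b = f + e +
      s⁻¹ • ∑ r ∈ Finset.range m, coef G (A (b + r)) •
        (x (A (b + r)).1 - f - w₀ (A (b + r)).1) := by
    simp only [smul_sub, Finset.sum_sub_distrib, ← Finset.sum_smul]
    rw [← hsdef, smul_smul, inv_mul_cancel₀ hs, one_smul, ← he]
    unfold centre
    rw [← hsdef]; abel
  have : x i - centre G m x A b - (w₀ i - e) = (x i - f - w₀ i) -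
      s⁻¹ • ∑ r ∈ Finset.range m, coef G (A (b + r)) •
        (x (A (b + r)).1 - f - w₀ (A (b + r)).1) := by rw [hc]; abel
  have hz : dirVec G m x A b '' Set.Iio 0 ∪ v '' Set.Ico 0 j = v '' Set.Iio j := by
    ext; simp
  rw [this, hz]
  exact Submodule.sub_mem _ (hw₀ i (hRX hi)) (Submodule.smul_mem _ _
    (sum_smul_mem_span fun r hr => hw₀ _ (hmem r (Finset.mem_range.1 hr))))

/-- Geometry of one block: the reference direction `v` is replaced by the vector `u`. -/
theorem replace_direction {m G : ℕ} {x : ℕ → H} {a v u : H} {W : Set H} {Y R : Finset ℕ}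
    (hRY : R ⊆ Y) {t : ℕ → ℝ} {w : ℕ → H}
    (hw : ∀ i ∈ Y, x i - a - w i - t i • v ∈ Submodule.span ℝ W) {f : ℕ → ℕ × ℕ} {e : H}
    (hu : u = ∑ r ∈ Finset.range m, coef G (f r) • (x (f r).1 - a))
    (he : (∀ i ∈ R, t i = 0) ∨ ((∀ r < m, (f r).1 ∈ Y) ∧
      ∑ r ∈ Finset.range m, coef G (f r) * t (f r).1 ≠ 0 ∧
      e = (∑ r ∈ Finset.range m, coef G (f r) * t (f r).1)⁻¹ •
        ∑ r ∈ Finset.range m, coef G (f r) • w (f r).1)) {i : ℕ} (hi : i ∈ R) :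
    x i - a - (w i - t i • e) ∈ Submodule.span ℝ (insert u W) := by
  have hmono : Submodule.span ℝ W ≤ Submodule.span ℝ (insert u W) :=
    Submodule.span_mono (Set.subset_insert _ _)
  rcases he with he | ⟨hmem, hs, he⟩
  · have := hw i (hRY hi)
    rw [he i hi, zero_smul, sub_zero] at this ⊢
    exact hmono this
  · set s := ∑ r ∈ Finset.range m, coef G (f r) * t (f r).1 with hsdef
    set z := ∑ r ∈ Finset.range m, coef G (f r) •
      (x (f r).1 - a - w (f r).1 - t (f r).1 • v) with hz
    have hzmem : z ∈ Submodule.span ℝ W :=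
      sum_smul_mem_span fun r hr => hw _ (hmem r (Finset.mem_range.1 hr))
    -- Split each sampled `x - a` into its part in the span of `W`, its residual and its multiple of
    -- `v`, and sum the three parts separately.
    have huz : u = z + s • e + s • v := by
      rw [he, smul_smul, mul_inv_cancel₀ hs, one_smul, hz, hu, hsdef, Finset.sum_smul]
      simp only [smul_sub, Finset.sum_sub_distrib, smul_smul]
      abel
    have hev : e + v = s⁻¹ • (u - z) := by
      rw [huz]
      rw [show z + s • e + s • v - z = s • (e + v) by rw [smul_add]; abel, smul_smul,
        inv_mul_cancel₀ hs, one_smul]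
    have : x i - a - (w i - t i • e) = (x i - a - w i - t i • v) + t i • (s⁻¹ • (u - z)) := by
      rw [← hev, smul_add]; abel
    rw [this]
    exact Submodule.add_mem _ (hmono (hw i (hRY hi))) (Submodule.smul_mem _ _
      (Submodule.smul_mem _ _ (Submodule.sub_mem _
        (Submodule.subset_span (Set.mem_insert _ _)) (hmono hzmem))))

/-- The first block finds the centre, each later one replaces a reference direction. Before each
later regression at most a fraction `(j + 1) / E ≤ 1/2` of the cluster has been lost. As `X` has at
least `2n / E` points, at least `n / E` remain, as `le_avg_goodDraw` requires. -/
theorem le_avg_cluster {n E j : ℕ} (hn : 1 ≤ n) (hE : 2 ≤ E) (hj : 2 * (j + 1) ≤ E) {x : ℕ → H}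
    {X : Finset ℕ} (hX : X ⊆ Finset.range n) (hXn : 2 * n ≤ E * X.card) {v : ℕ → H} {f : H}
    {w₀ : ℕ → H} (hw₀ : ∀ i ∈ X, x i - f - w₀ i ∈ Submodule.span ℝ (v '' Set.Iio j))
    (b : ℕ) (A : ℕ → ℕ × ℕ) :
    (1 / 2 / densityBound E ^ sampleSize E) ^ (j + 1) ≤
      avg (draws n (coefBound E)) (unif n (coefBound E)) b ((j + 1) * sampleSize E)
        (ind (ClusterState E (coefBound E) (sampleSize E) j x X v (∑ i ∈ X, ‖w₀ i‖ ^ 2) b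
          (j + 1))) A := by
  have hE' : (2 : ℝ) ≤ E := by exact_mod_cast hE
  have hd := one_le_densityBound (E := E) (by omega)
  have hρ : 0 ≤ 1 / 2 / densityBound E ^ sampleSize E := by positivity
  set G := coefBound E
  set m := sampleSize E
  have hXne : X.Nonempty := by
    rw [Finset.nonempty_iff_ne_empty]; rintro rfl; simp at hXn; omega
  refine pow_le_avg_chain (fun v _ => unif_nonneg _ _ _) hρ b m (j + 1)
    (ClusterState E G m j x X v (∑ i ∈ X, ‖w₀ i‖ ^ 2) b) ?_ A trivial
  intro l hl A hA
  cases l with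
  | zero =>
    simp only [zero_mul, add_zero, zero_add]
    refine (le_avg_goodDraw hn hE hX (by omega) (fun _ => 1) w₀ b A).trans
      (avg_mono (fun v _ => unif_nonneg _ _ _) _ _ _ fun A' _ => ind_mono fun h => ?_)
    exact ClusterState.first hE hXne hw₀ h
  | succ l =>
    obtain ⟨Y, hYX, hYc, w, hw, hwC⟩ := hA
    have hl' : 2 * ((l + 1 : ℕ) : ℝ) ≤ E := by
      have : 2 * (l + 1) ≤ E := by omega
      exact_mod_cast this
    have hYn : n ≤ E * Y.card := by
      have h1 : 2 * (n : ℝ) ≤ E * X.card := by exact_mod_cast hXn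
      have h2 : ((l + 1 : ℕ) : ℝ) / E ≤ 1 / 2 := by
        rw [div_le_div_iff₀ (by positivity) (by norm_num)]; linarith
      have h3 : (X.card : ℝ) / 2 ≤ Y.card := by
        have : (0 : ℝ) ≤ X.card := by positivity
        nlinarith
      have : (n : ℝ) ≤ E * Y.card := by nlinarith
      exact_mod_cast this
    set a := centre G m x A b with ha
    set W := dirVec G m x A b '' Set.Iio l ∪ v '' Set.Ico (l + 1) j with hW
    have hins : dirVec G m x A b '' Set.Iio l ∪ v '' Set.Ico l j = insert (v l) W := by
      have : Set.Ico l j = insert l (Set.Ico (l + 1) j) := by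
        ext q; simp only [Set.mem_Ico, Set.mem_insert_iff]; omega
      rw [this, Set.image_insert_eq, Set.union_insert]
    -- The scalar `t i` is the coefficient of `v l` in a representation of `x i - a - w i`. It need
    -- not be unique; any choice serves the regression.
    have hdec : ∀ i, ∃ τ : ℝ, i ∈ Y → x i - a - w i - τ • v l ∈ Submodule.span ℝ W := by
      intro i
      by_cases hi : i ∈ Y
      · have h1 := hw i hi
        rw [hins] at h1
        obtain ⟨τ, z, hz, hxz⟩ := Submodule.mem_span_insert.1 h1
        refine ⟨τ, fun _ => ?_⟩
        rw [hxz, add_sub_cancel_left]; exact hz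
      · exact ⟨0, fun h => absurd h hi⟩
    choose t ht using hdec
    refine (le_avg_goodDraw hn hE (hYX.trans hX) hYn t w (b + (l + 1) * m) A).trans
      (avg_mono (fun v _ => unif_nonneg _ _ _) _ _ _ fun A' hA' => ind_mono ?_)
    rintro ⟨R, hRY, hRc, e, he, hle⟩
    have hcen : centre G m x A' b = a := by
      refine centre_congr fun q h1 h2 => hA'.1 q (Or.inl (h2.trans_le ?_))
      exact Nat.add_le_add_left (Nat.le_mul_of_pos_left m (by omega)) b
    have hdir : dirVec G m x A' b '' Set.Iio (l + 1) ∪ v '' Set.Ico (l + 1) j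
        = insert (dirVec G m x A' b l) W := by
      have h1 : Set.Iio (l + 1) = insert l (Set.Iio l) := by
        ext q; simp only [Set.mem_Iio, Set.mem_insert_iff]; omega
      have h2 : dirVec G m x A' b '' Set.Iio l = dirVec G m x A b '' Set.Iio l := by
        refine Set.image_congr fun s hs => dirVec_congr fun q h3 h4 => hA'.1 q (Or.inl ?_)
        refine h4.trans_le (Nat.add_le_add_left (Nat.mul_le_mul_right m ?_) b)
        have := Set.mem_Iio.1 hs
        omega
      rw [h1, Set.image_insert_eq, Set.insert_union, h2]
    refine ⟨R, hRY.trans hYX, ?_, fun i => w i - t i • e, fun i hi => ?_, ?_⟩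
    · have h1 : ((l + 1 + 1 : ℕ) : ℝ) / E = ((l + 1 : ℕ) : ℝ) / E + 1 / E := by
        push_cast; ring
      rw [h1]
      have h2 : (0 : ℝ) ≤ ((l + 1 : ℕ) : ℝ) / E * (1 / E) := by positivity
      have h3 : (0 : ℝ) ≤ X.card := by positivity
      have h4 : (0 : ℝ) ≤ 1 - 1 / (E : ℝ) := by
        rw [sub_nonneg, div_le_one (by positivity)]; linarith
      calc (1 - (((l + 1 : ℕ) : ℝ) / E + 1 / E)) * (X.card : ℝ)
          ≤ (1 - 1 / (E : ℝ)) * ((1 - ((l + 1 : ℕ) : ℝ) / E) * X.card) := by nlinarith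
        _ ≤ (1 - 1 / (E : ℝ)) * Y.card := mul_le_mul_of_nonneg_left hYc h4
        _ ≤ R.card := hRc
    · rw [hcen, hdir]
      refine replace_direction hRY (fun i hi => ht i hi) (f := fun r => A' (b + (l + 1) * m + r))
        ?_ he hi
      rw [← hcen]; rfl
    · refine hle.trans ?_
      rw [pow_succ' _ (l + 1), mul_assoc]
      gcongr

/-- The draws from the position `b` on yield `k` flats that approximate most of the points, with
total cost at most `C`. -/
def TrialState (G m k j : ℕ) (x : ℕ → H) (b : ℕ) (Q : Finset ℕ) (C : ℝ) (A : ℕ → ℕ × ℕ) : Prop :=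
  ∃ w : ℕ → H, (∀ i ∈ Q, ∃ c < k, x i - centre G m x A (b + c * ((j + 1) * m)) - w i ∈
      Submodule.span ℝ (dirVec G m x A (b + c * ((j + 1) * m)) '' Set.Iio j)) ∧
    ∑ i ∈ Q, ‖w i‖ ^ 2 ≤ C

/-- The clusters are the fibres of `κ` and use disjoint stretches of the tape, so their events can
be chained. Clusters of fewer than `2n / E` points are abandoned; this costs at most `2kn / E`
points in all, besides the fraction `(j + 1) / E` lost within the others. -/
theorem le_avg_trialState {n E k j : ℕ} (hn : 1 ≤ n) (hE : 2 ≤ E) (hj : 2 * (j + 1) ≤ E)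
    {x : ℕ → H} {κ : ℕ → ℕ} (hκ : ∀ i < n, κ i < k) {v : ℕ → ℕ → H} {f : ℕ → H} {w₀ : ℕ → H}
    (hw₀ : ∀ i < n, x i - f (κ i) - w₀ i ∈ Submodule.span ℝ (v (κ i) '' Set.Iio j))
    (b : ℕ) (A : ℕ → ℕ × ℕ) :
    (1 / 2 / densityBound E ^ sampleSize E) ^ ((j + 1) * k) ≤
      avg (draws n (coefBound E)) (unif n (coefBound E)) b (k * ((j + 1) * sampleSize E))
        (ind fun A => ∃ Q ⊆ Finset.range n, (1 - ((2 * k + j + 1 : ℕ) : ℝ) / E) * n ≤ Q.card ∧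
          TrialState (coefBound E) (sampleSize E) k j x b Q
            ((1 + 1 / (E : ℝ)) ^ (j + 1) * ∑ i ∈ Finset.range n, ‖w₀ i‖ ^ 2) A) A := by
  have hE' : (2 : ℝ) ≤ E := by exact_mod_cast hE
  have hd := one_le_densityBound (E := E) (by omega)
  have hρ : 0 ≤ 1 / 2 / densityBound E ^ sampleSize E := by positivity
  set ρ := 1 / 2 / densityBound E ^ sampleSize E with hρdef
  have hρ1 : ρ ≤ 1 := by
    rw [hρdef, div_le_one (by positivity)]
    have := one_le_pow₀ (n := sampleSize E) hd
    linarith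
  set G := coefBound E
  set m := sampleSize E
  set X : ℕ → Finset ℕ := fun c => (Finset.range n).filter fun i => κ i = c with hXdef
  set Good : ℕ → (ℕ → ℕ × ℕ) → Prop := fun c =>
    ClusterState E G m j x (X c) (v c) (∑ i ∈ X c, ‖w₀ i‖ ^ 2) (b + c * ((j + 1) * m)) (j + 1)
    with hGood
  have hchain := pow_le_avg_chain (S := draws n G) (fun v _ => unif_nonneg n G v) (pow_nonneg hρ (j + 1)) b
    ((j + 1) * m) k (fun T A => ∀ c < T, 2 * n ≤ E * (X c).card → Good c A) ?_ A
    (fun c hc => absurd hc (by omega))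
  · rw [← pow_mul] at hchain
    refine hchain.trans (avg_mono (fun v _ => unif_nonneg _ _ _) _ _ _ fun A' _ => ind_mono ?_)
    intro hall
    have hex : ∀ c, ∃ (Y : Finset ℕ) (w : ℕ → H), Y ⊆ X c ∧
        (c < k → 2 * n ≤ E * (X c).card → (1 - ((j + 1 : ℕ) : ℝ) / E) * (X c).card ≤ Y.card) ∧
        (∀ i ∈ Y, x i - centre G m x A' (b + c * ((j + 1) * m)) - w i ∈
          Submodule.span ℝ (dirVec G m x A' (b + c * ((j + 1) * m)) '' Set.Iio j)) ∧
        ∑ i ∈ Y, ‖w i‖ ^ 2 ≤ (1 + 1 / (E : ℝ)) ^ (j + 1) * ∑ i ∈ X c, ‖w₀ i‖ ^ 2 := by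
      intro c
      by_cases hc : c < k ∧ 2 * n ≤ E * (X c).card
      · obtain ⟨Y, hY, hYc, w, hw, hs⟩ := hall c hc.1 hc.2
        refine ⟨Y, w, hY, fun _ _ => hYc, fun i hi => ?_, hs⟩
        have := hw i hi
        rwa [Set.Ico_self, Set.image_empty, Set.union_empty] at this
      -- Nothing is kept from an abandoned cluster.
      · refine ⟨∅, fun _ => 0, by simp, fun h1 h2 => absurd ⟨h1, h2⟩ hc, by simp, ?_⟩
        simp only [Finset.sum_empty]
        exact mul_nonneg (by positivity) (Finset.sum_nonneg fun _ _ => sq_nonneg _)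
    choose Y w hYX hYc hYw hYs using hex
    have hdisj : ∀ c₁ ∈ Finset.range k, ∀ c₂ ∈ Finset.range k, c₁ ≠ c₂ →
        Disjoint (X c₁) (X c₂) := by
      intro c₁ _ c₂ _ hne
      rw [Finset.disjoint_left]
      intro i h1 h2
      exact hne ((Finset.mem_filter.1 h1).2.symm.trans (Finset.mem_filter.1 h2).2)
    have hdisjY : ∀ c₁ ∈ Finset.range k, ∀ c₂ ∈ Finset.range k, c₁ ≠ c₂ →
        Disjoint (Y c₁) (Y c₂) := fun c₁ h1 c₂ h2 hne =>
      (hdisj c₁ h1 c₂ h2 hne).mono (hYX c₁) (hYX c₂)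
    have hXU : Finset.range n = (Finset.range k).biUnion X := by
      ext i
      simp only [Finset.mem_biUnion, hXdef, Finset.mem_filter, Finset.mem_range]
      exact ⟨fun h => ⟨κ i, hκ i h, h, rfl⟩, fun ⟨_, _, h, _⟩ => h⟩
    have hmemκ : ∀ c, ∀ i ∈ Y c, κ i = c := fun c i hi => (Finset.mem_filter.1 (hYX c hi)).2
    refine ⟨(Finset.range k).biUnion Y, ?_, ?_, fun i => w (κ i) i, ?_, ?_⟩
    · rw [hXU]; exact Finset.biUnion_mono fun c _ => hYX c
    · rw [Finset.card_biUnion hdisjY]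
      have hsum : (n : ℝ) = ∑ c ∈ Finset.range k, ((X c).card : ℝ) := by
        rw [← Nat.cast_sum, ← Finset.card_biUnion hdisj, ← hXU, Finset.card_range]
      -- One bound for both kinds of clusters: for an abandoned one the left side is not positive,
      -- for a large one the subtracted term is harmless.
      have hcard : ∀ c ∈ Finset.range k,
          (1 - ((j + 1 : ℕ) : ℝ) / E) * ((X c).card - 2 * n / E) ≤ (Y c).card := by
        intro c hc
        have hpos : (0 : ℝ) ≤ 1 - ((j + 1 : ℕ) : ℝ) / E := by
          rw [sub_nonneg, div_le_one (by positivity)]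
          have : ((2 * (j + 1) : ℕ) : ℝ) ≤ E := by exact_mod_cast hj
          push_cast at this ⊢
          have : (0 : ℝ) ≤ j := by positivity
          linarith
        by_cases hbig : 2 * n ≤ E * (X c).card
        · refine le_trans ?_ (hYc c (Finset.mem_range.1 hc) hbig)
          refine mul_le_mul_of_nonneg_left ?_ hpos
          have : (0 : ℝ) ≤ 2 * n / E := by positivity
          linarith
        · refine le_trans (mul_nonpos_of_nonneg_of_nonpos hpos ?_) (Nat.cast_nonneg _)
          push Not at hbig
          have : (E : ℝ) * (X c).card < 2 * n := by exact_mod_cast hbig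
          rw [sub_nonpos, le_div_iff₀ (by positivity)]
          linarith
      have h1 := Finset.sum_le_sum hcard
      rw [← Finset.mul_sum, Finset.sum_sub_distrib, ← hsum, Finset.sum_const, Finset.card_range,
        nsmul_eq_mul] at h1
      push_cast
      refine le_trans ?_ h1
      have h2 : (0 : ℝ) ≤ ((j + 1 : ℕ) : ℝ) / E * (k * (2 * n / E)) := by positivity
      have h3 : (1 - (2 * (k : ℝ) + j + 1) / E) * n
          = n - k * (2 * n / E) - ((j + 1 : ℕ) : ℝ) / E * n := by push_cast; ring
      rw [h3]
      nlinarith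
    · intro i hi
      obtain ⟨c, hc, hic⟩ := Finset.mem_biUnion.1 hi
      refine ⟨c, Finset.mem_range.1 hc, ?_⟩
      simp only [hmemκ c i hic]
      exact hYw c i hic
    · rw [Finset.sum_biUnion fun c₁ h1 c₂ h2 hne => hdisjY c₁ h1 c₂ h2 hne, hXU,
        Finset.sum_biUnion fun c₁ h1 c₂ h2 hne => hdisj c₁ h1 c₂ h2 hne, Finset.mul_sum]
      refine Finset.sum_le_sum fun c _ => le_trans (le_of_eq ?_) (hYs c)
      exact Finset.sum_congr rfl fun i hi => by simp only [hmemκ c i hi]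
  · intro T hT A hA
    by_cases hbig : 2 * n ≤ E * (X T).card
    · refine (le_avg_cluster hn hE hj (x := x) (X := X T) (v := v T) (f := f T) (w₀ := w₀)
        (Finset.filter_subset _ _) hbig ?_ _ A).trans
        (avg_mono (fun v _ => unif_nonneg _ _ _) _ _ _ fun A' hA' => ind_mono fun h => ?_)
      · intro i hi
        obtain ⟨h1, h2⟩ := Finset.mem_filter.1 hi
        have := hw₀ i (Finset.mem_range.1 h1)
        rwa [h2] at this
      · intro c hc hcbig
        rcases Nat.lt_succ_iff_lt_or_eq.1 hc with hc | rfl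
        · refine ClusterState.congr (fun q h1 h2 => hA'.1 q (Or.inl ?_)) (hA c hc hcbig)
          have h3 : (c + 1) * ((j + 1) * m) ≤ T * ((j + 1) * m) := Nat.mul_le_mul_right _ hc
          have h4 : (c + 1) * ((j + 1) * m) = c * ((j + 1) * m) + (j + 1) * m := by ring
          omega
        · exact h
    -- A small cluster demands nothing from its draws, so the conditional probability is one.
    · have h1 : ρ ^ (j + 1) ≤ 1 := pow_le_one₀ hρ hρ1
      refine h1.trans ?_
      rw [← avg_const (sum_unif hn G) 1 (b + T * ((j + 1) * m)) ((j + 1) * m) A]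
      refine avg_mono (fun v _ => unif_nonneg _ _ _) _ _ _ fun A' hA' => ?_
      rw [ind_of]
      intro c hc hcbig
      rcases Nat.lt_succ_iff_lt_or_eq.1 hc with hc | rfl
      · refine ClusterState.congr (fun q h1 h2 => hA'.1 q (Or.inl ?_)) (hA c hc hcbig)
        have h3 : (c + 1) * ((j + 1) * m) ≤ T * ((j + 1) * m) := Nat.mul_le_mul_right _ hc
        have h4 : (c + 1) * ((j + 1) * m) = c * ((j + 1) * m) + (j + 1) * m := by ring
        omega
      · exact absurd hcbig hbig

end ProjectiveClustering

/-! ### Orthogonalization -/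

namespace ProjectiveClustering

variable {H : Type*} [NormedAddCommGroup H] [InnerProductSpace ℝ H]

/-- The vector `v` with its components along `b 0, …, b (l - 1)` removed one after the other. -/
noncomputable def resid (b : ℕ → H) : ℕ → H → H
  | 0, v => v
  | s + 1, v => resid b s v - (inner ℝ (b s) (resid b s v) / inner ℝ (b s) (b s)) • b s

open Classical in
/-- The residue of `u`, replaced by the residue of one of `e 0, …, e (r - 1)` if it vanishes. -/
noncomputable def pick (e b : ℕ → H) (l : ℕ) (u : H) : ℕ → H
  | 0 => resid b l u
  | r + 1 => if pick e b l u r = 0 then resid b l (e r) else pick e b l u r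

/-- Gram–Schmidt without normalization, with replacements for vanishing residues. -/
noncomputable def gramSchmidtPick (e : ℕ → H) (j : ℕ) (u : ℕ → H) : ℕ → ℕ → H
  | 0 => fun _ => 0
  | l + 1 => Function.update (gramSchmidtPick e j u l) l
      (pick e (gramSchmidtPick e j u l) l (u l) j)

/-- The first `l` vectors are nonzero and pairwise orthogonal. -/
def OrthFamily (b : ℕ → H) (l : ℕ) : Prop :=
  (∀ s < l, b s ≠ 0) ∧ ∀ s < l, ∀ s' < l, s ≠ s' → inner ℝ (b s) (b s') = 0

theorem OrthFamily.mono {b : ℕ → H} {l l' : ℕ} (h : OrthFamily b l) (hl : l' ≤ l) :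
    OrthFamily b l' :=
  ⟨fun s hs => h.1 s (by omega), fun s hs s' hs' => h.2 s (by omega) s' (by omega)⟩

theorem sub_resid_mem (b : ℕ → H) (l : ℕ) (v : H) :
    v - resid b l v ∈ Submodule.span ℝ (b '' Set.Iio l) := by
  induction l with
  | zero => simp [resid]
  | succ l ih =>
    have h1 : Submodule.span ℝ (b '' Set.Iio l) ≤ Submodule.span ℝ (b '' Set.Iio (l + 1)) :=
      Submodule.span_mono (Set.image_mono (Set.Iio_subset_Iio (by omega)))
    simp only [resid]
    rw [← sub_add]
    exact Submodule.add_mem _ (h1 ih) (Submodule.smul_mem _ _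
      (Submodule.subset_span ⟨l, by simp, rfl⟩))

theorem inner_resid {b : ℕ → H} {l : ℕ} (hb : OrthFamily b l) (v : H) :
    ∀ s < l, inner ℝ (b s) (resid b l v) = 0 := by
  induction l with
  | zero => intro s hs; omega
  | succ l ih =>
    intro s hs
    simp only [resid, inner_sub_right, inner_smul_right]
    rcases Nat.lt_succ_iff_lt_or_eq.1 hs with hs' | rfl
    · rw [ih (hb.mono (by omega)) s hs', hb.2 s hs l (by omega) (by omega)]; simp
    · have : inner ℝ (b s) (b s) ≠ 0 := inner_self_ne_zero.2 (hb.1 s hs)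
      rw [div_mul_cancel₀ _ this, sub_self]

theorem inner_eq_zero_of_mem_span {S : Set H} {z r : H} (hz : z ∈ Submodule.span ℝ S)
    (h : ∀ y ∈ S, inner ℝ y r = 0) : inner ℝ z r = 0 := by
  induction hz using Submodule.span_induction with
  | mem y hy => exact h y hy
  | zero => simp
  | add y y' _ _ h1 h2 => rw [inner_add_left, h1, h2, add_zero]
  | smul a y _ h1 => rw [inner_smul_left, h1, mul_zero]

/-- Pythagoras: `v - z` is the sum of the residue and a vector of the span, and the residue is
orthogonal to the span. -/
theorem norm_resid_le {b : ℕ → H} {l : ℕ} (hb : OrthFamily b l) {v z : H}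
    (hz : z ∈ Submodule.span ℝ (b '' Set.Iio l)) : ‖resid b l v‖ ≤ ‖v - z‖ := by
  have h1 : v - z = (v - resid b l v - z) + resid b l v := by abel
  have h2 : inner ℝ (v - resid b l v - z) (resid b l v) = 0 := by
    refine inner_eq_zero_of_mem_span (Submodule.sub_mem _ (sub_resid_mem b l v) hz) ?_
    rintro _ ⟨s, hs, rfl⟩
    exact inner_resid hb v s hs
  have h3 := norm_add_sq_eq_norm_sq_add_norm_sq_of_inner_eq_zero _ _ h2
  rw [← h1] at h3
  refine le_of_sq_le_sq ?_ (norm_nonneg _)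
  nlinarith [norm_nonneg (v - resid b l v - z)]

/-- The first fact gives orthogonality, the second keeps `u` in the span of the new family, and the
third confines failure to the case that all spare vectors already lie in the old span. -/
theorem pick_spec (e b : ℕ → H) (l : ℕ) (u : H) (r : ℕ) :
    (∃ z, pick e b l u r = resid b l z) ∧ (resid b l u = 0 ∨ pick e b l u r = resid b l u) ∧
      (pick e b l u r = 0 → ∀ s < r, resid b l (e s) = 0) := by
  induction r with
  | zero => exact ⟨⟨u, rfl⟩, Or.inr rfl, fun _ s hs => by omega⟩
  | succ r ih =>
    obtain ⟨h1, h2, h3⟩ := ih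
    simp only [pick]
    split_ifs with h
    · refine ⟨⟨_, rfl⟩, Or.inl ?_, fun h0 s hs => ?_⟩
      · rcases h2 with h2 | h2
        · exact h2
        · rw [← h2, h]
      · rcases Nat.lt_succ_iff_lt_or_eq.1 hs with hs | rfl
        · exact h3 h s hs
        · exact h0
    · exact ⟨h1, h2, fun h0 => absurd h0 h⟩

theorem gramSchmidtPick_stable (e : ℕ → H) (j : ℕ) (u : ℕ → H) {l l' : ℕ} (h : l ≤ l') {s : ℕ}
    (hs : s < l) : gramSchmidtPick e j u l' s = gramSchmidtPick e j u l s := by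
  induction l', h using Nat.le_induction with
  | base => rfl
  | succ l' h ih =>
    simp only [gramSchmidtPick]
    rw [Function.update_of_ne (by omega), ih]

/-- The spare vectors ensure that exactly `j` nonzero directions are produced even if the sampled
vectors are dependent. Enlarging the span can only reduce distances. -/
theorem gramSchmidtPick_spec {e : ℕ → H} {j : ℕ}
    (he : LinearIndependent ℝ fun r : Fin j => e r) (u : ℕ → H) {l : ℕ} (hl : l ≤ j) :
    OrthFamily (gramSchmidtPick e j u l) l ∧
      ∀ s < l, u s ∈ Submodule.span ℝ (gramSchmidtPick e j u l '' Set.Iio l) := by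
  induction l with
  | zero => exact ⟨⟨fun s hs => by omega, fun s hs => by omega⟩, fun s hs => by omega⟩
  | succ l ih =>
    obtain ⟨ho, hu⟩ := ih (by omega)
    set b := gramSchmidtPick e j u l with hb
    set β := gramSchmidtPick e j u (l + 1) with hb'
    set y := pick e b l (u l) j with hy
    have hstab : ∀ s < l, β s = b s := fun s hs => gramSchmidtPick_stable e j u (by omega) hs
    have hl' : β l = y := by simp [hb', gramSchmidtPick, hy, hb]
    obtain ⟨⟨z, hz⟩, h2, h3⟩ := pick_spec e b l (u l) j
    have horth : ∀ s < l, inner ℝ (b s) y = 0 := fun s hs => by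
      rw [hy, hz]; exact inner_resid ho z s hs
    -- Otherwise the `j` independent vectors `e r` would all lie in a span of `l < j` vectors.
    have hyne : y ≠ 0 := by
      intro h0
      have hall := h3 h0
      have hmem : ∀ r : Fin j, e r ∈ Submodule.span ℝ (b '' Set.Iio l) := fun r => by
        have := sub_resid_mem b l (e r)
        rwa [hall r r.2, sub_zero] at this
      have hfin : (b '' Set.Iio l).Finite := (Set.finite_Iio l).image b
      have hcard : Module.finrank ℝ (Submodule.span ℝ (b '' Set.Iio l)) ≤ l := by
        classical
        have h5 : b '' Set.Iio l = (((Finset.range l).image b : Finset H) : Set H) := by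
          ext; simp
        rw [h5]
        exact (finrank_span_finset_le_card _).trans
          (Finset.card_image_le.trans (Finset.card_range l).le)
      have : FiniteDimensional ℝ (Submodule.span ℝ (b '' Set.Iio l)) :=
        FiniteDimensional.span_of_finite ℝ hfin
      have hli : LinearIndependent ℝ fun r : Fin j =>
          (⟨e r, hmem r⟩ : Submodule.span ℝ (b '' Set.Iio l)) :=
        LinearIndependent.of_comp (Submodule.subtype _) he
      have := hli.fintype_card_le_finrank
      rw [Fintype.card_fin] at this
      omega
    have himg : β '' Set.Iio (l + 1) = insert y (b '' Set.Iio l) := by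
      have h1 : Set.Iio (l + 1) = insert l (Set.Iio l) := by
        ext q; simp only [Set.mem_Iio, Set.mem_insert_iff]; omega
      have h2 : β '' Set.Iio l = b '' Set.Iio l := Set.image_congr fun s hs => hstab s hs
      rw [h1, Set.image_insert_eq, hl', h2]
    refine ⟨⟨fun s hs => ?_, fun s hs s' hs' hne => ?_⟩, fun s hs => ?_⟩
    · rcases Nat.lt_succ_iff_lt_or_eq.1 hs with hs | rfl
      · rw [hstab s hs]; exact ho.1 s hs
      · rwa [hl']
    · rcases Nat.lt_succ_iff_lt_or_eq.1 hs with hs | rfl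
      · rw [hstab s hs]
        rcases Nat.lt_succ_iff_lt_or_eq.1 hs' with hs' | rfl
        · rw [hstab s' hs']; exact ho.2 s hs s' hs' hne
        · rw [hl']; exact horth s hs
      · rw [hl']
        rcases Nat.lt_succ_iff_lt_or_eq.1 hs' with hs' | rfl
        · rw [hstab s' hs', real_inner_comm]; exact horth s' hs'
        · exact absurd rfl hne
    · rw [himg]
      have hmono : Submodule.span ℝ (b '' Set.Iio l) ≤ Submodule.span ℝ (insert y (b '' Set.Iio l)) :=
        Submodule.span_mono (Set.subset_insert _ _)
      rcases Nat.lt_succ_iff_lt_or_eq.1 hs with hs | rfl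
      · exact hmono (hu s hs)
      · have h1 := hmono (sub_resid_mem b s (u s))
        rcases h2 with h2 | h2
        · rwa [h2, sub_zero] at h1
        · rw [← h2] at h1
          have := Submodule.add_mem _ h1 (Submodule.subset_span (Set.mem_insert y _))
          rwa [← hy, sub_add_cancel] at this

/-- The flat through `a` spanned by an orthogonal family: dimension and distances. -/
theorem isFlat_of_orthFamily {d j : ℕ} {a : EuclideanSpace ℝ (Fin d)}
    {b : ℕ → EuclideanSpace ℝ (Fin d)} (hb : OrthFamily b j) :
    IsFlat j (AffineSubspace.mk' a (Submodule.span ℝ (Set.range fun v : Fin j => b v))) := by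
  refine ⟨⟨a, AffineSubspace.self_mem_mk' _ _⟩, ?_⟩
  rw [AffineSubspace.direction_mk']
  have hli : LinearIndependent ℝ fun v : Fin j => b v :=
    linearIndependent_of_ne_zero_of_inner_eq_zero (fun v => hb.1 v v.2)
      fun v v' hne => hb.2 v v.2 v' v'.2 fun h => hne (Fin.ext h)
  rw [finrank_span_eq_card hli, Fintype.card_fin]

/-- The foot `x - resid b j (x - a)` lies on the flat, and no point of the flat is nearer, by
`norm_resid_le`. -/
theorem infDist_eq_norm_resid {d j : ℕ} {a : EuclideanSpace ℝ (Fin d)}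
    {b : ℕ → EuclideanSpace ℝ (Fin d)} (hb : OrthFamily b j) (x : EuclideanSpace ℝ (Fin d)) :
    Metric.infDist x (AffineSubspace.mk' a (Submodule.span ℝ (Set.range fun v : Fin j => b v)) :
      Set (EuclideanSpace ℝ (Fin d))) = ‖resid b j (x - a)‖ := by
  have himg : (Set.range fun v : Fin j => b v) = b '' Set.Iio j := by
    ext y
    constructor
    · rintro ⟨v, rfl⟩; exact ⟨v, v.2, rfl⟩
    · rintro ⟨s, hs, rfl⟩; exact ⟨⟨s, hs⟩, rfl⟩
  rw [himg]
  have hmem : ∀ y, y ∈ (AffineSubspace.mk' a (Submodule.span ℝ (b '' Set.Iio j)) :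
      Set (EuclideanSpace ℝ (Fin d))) ↔ y - a ∈ Submodule.span ℝ (b '' Set.Iio j) := fun y => by
    rw [SetLike.mem_coe, AffineSubspace.mem_mk', vsub_eq_sub]
  refine le_antisymm ?_ ?_
  · have h1 : x - resid b j (x - a) ∈ (AffineSubspace.mk' a (Submodule.span ℝ (b '' Set.Iio j)) :
        Set (EuclideanSpace ℝ (Fin d))) := by
      rw [hmem, sub_right_comm]; exact sub_resid_mem b j (x - a)
    refine (Metric.infDist_le_dist_of_mem h1).trans ?_
    rw [dist_eq_norm, sub_sub_cancel]
  · rw [Metric.le_infDist ⟨a, AffineSubspace.self_mem_mk' _ _⟩]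
    intro y hy
    rw [hmem] at hy
    refine (norm_resid_le hb hy).trans ?_
    rw [sub_sub_sub_cancel_right, dist_eq_norm]

/-- The standard basis vectors, indexed by the natural numbers. -/
noncomputable def stdVec (d r : ℕ) : EuclideanSpace ℝ (Fin d) :=
  WithLp.toLp 2 fun q : Fin d => if (q : ℕ) = r then 1 else 0

theorem linearIndependent_stdVec {d j : ℕ} (hj : j ≤ d) :
    LinearIndependent ℝ fun r : Fin j => stdVec d r := by
  have h : (fun r : Fin j => stdVec d r) =
      (EuclideanSpace.basisFun (Fin d) ℝ) ∘ Fin.castLE hj := by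
    funext r
    ext q
    simp only [stdVec, Function.comp, EuclideanSpace.basisFun_apply, PiLp.single_apply,
      Fin.ext_iff, Fin.val_castLE]
  rw [h]
  exact (EuclideanSpace.basisFun (Fin d) ℝ).orthonormal.linearIndependent.comp _
    (Fin.castLE_injective hj)

/-! ### Trimming at a random pivot -/

open Classical in
/-- The indices that do not come after the pivot `π` when they are ordered by `f`, ties being
broken by the index. -/
noncomputable def trimmed (n : ℕ) (f : ℕ → ℝ) (π : ℕ) : Finset ℕ :=
  (Finset.range n).filter fun i => f i < f π ∨ (¬ f π < f i ∧ ¬ π < i)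

theorem mem_trimmed {n : ℕ} {f : ℕ → ℝ} {π i : ℕ} :
    i ∈ trimmed n f π ↔ i < n ∧ (f i < f π ∨ (¬ f π < f i ∧ ¬ π < i)) := by
  simp [trimmed]

/-- Ties are broken by the index, so the pivots are linearly ordered and the trimmed sets are
strictly nested. -/
theorem card_trimmed_lt {n : ℕ} {f : ℕ → ℝ} {π π' : ℕ} (hπ' : π' < n)
    (h : f π < f π' ∨ (f π = f π' ∧ π < π')) :
    (trimmed n f π).card < (trimmed n f π').card := by
  refine Finset.card_lt_card ((Finset.ssubset_iff_of_subset fun i hi => ?_).2 ⟨π', ?_, ?_⟩)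
  · rw [mem_trimmed] at hi ⊢
    refine ⟨hi.1, ?_⟩
    rcases hi.2 with h1 | ⟨h1, h2⟩
    · rcases h with h | h
      · exact Or.inl (h1.trans h)
      · exact Or.inl (h.1 ▸ h1)
    · rcases h with h | h
      · exact Or.inl ((not_lt.1 h1).trans_lt h)
      · exact Or.inr ⟨h.1 ▸ h1, by omega⟩
  · rw [mem_trimmed]; exact ⟨hπ', Or.inr ⟨lt_irrefl _, lt_irrefl _⟩⟩
  · rw [mem_trimmed]
    rintro ⟨_, h1 | ⟨h1, h2⟩⟩
    · rcases h with h | h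
      · exact absurd h1 h.not_gt
      · rw [h.1] at h1; exact lt_irrefl _ h1
    · rcases h with h | h
      · exact h1 h
      · exact h2 h.2

theorem card_trimmed_injOn (n : ℕ) (f : ℕ → ℝ) :
    Set.InjOn (fun π => (trimmed n f π).card) (Finset.range n : Set ℕ) := by
  intro π hπ π' hπ' h
  have h1 := Finset.mem_range.1 (Finset.mem_coe.1 hπ)
  have h2 := Finset.mem_range.1 (Finset.mem_coe.1 hπ')
  by_contra hne
  rcases lt_trichotomy (f π) (f π') with hf | hf | hf
  · exact (card_trimmed_lt h2 (Or.inl hf)).ne h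
  · rcases Nat.lt_or_gt_of_ne hne with hlt | hlt
    · exact (card_trimmed_lt h2 (Or.inr ⟨hf, hlt⟩)).ne h
    · exact (card_trimmed_lt h1 (Or.inr ⟨hf.symm, hlt⟩)).ne h.symm
  · exact (card_trimmed_lt h1 (Or.inl hf)).ne h.symm

/-- The sizes are distinct and lie between `1` and `n`, so each occurs for exactly one pivot. A
uniform pivot thus means a uniform number of kept points. -/
theorem image_card_trimmed (n : ℕ) (f : ℕ → ℝ) :
    (Finset.range n).image (fun π => (trimmed n f π).card) = Finset.Icc 1 n := by
  refine Finset.eq_of_subset_of_card_le ?_ ?_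
  · intro q hq
    obtain ⟨π, hπ, rfl⟩ := Finset.mem_image.1 hq
    rw [Finset.mem_Icc]
    refine ⟨Finset.card_pos.2 ⟨π, mem_trimmed.2 ⟨Finset.mem_range.1 hπ,
      Or.inr ⟨lt_irrefl _, lt_irrefl _⟩⟩⟩, ?_⟩
    exact (Finset.card_le_card (Finset.filter_subset _ _)).trans (Finset.card_range n).le
  · rw [Finset.card_image_of_injOn (card_trimmed_injOn n f)]; simp

/-- Trimming to no more than `Q.card` indices does not increase the mean. -/
theorem sum_trimmed_le {n : ℕ} {f : ℕ → ℝ} {π : ℕ} {Q : Finset ℕ} (hQ : Q ⊆ Finset.range n)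
    {B : ℝ} (hB : ∑ i ∈ Q, f i ≤ B * Q.card) (hc : (trimmed n f π).card ≤ Q.card) :
    ∑ i ∈ trimmed n f π, f i ≤ B * (trimmed n f π).card := by
  set P := trimmed n f π
  have hP : ∀ i ∈ P, f i - f π ≤ 0 := fun i hi => by
    rcases (mem_trimmed.1 hi).2 with h | h
    · linarith
    · linarith [not_lt.1 h.1]
  -- The trimmed set contains every index with a negative term and none with a positive one, so it
  -- minimizes this sum.
  have h1 : ∑ i ∈ P, (f i - f π) ≤ ∑ i ∈ Q, (f i - f π) := by
    calc ∑ i ∈ P, (f i - f π) ≤ ∑ i ∈ P ∩ Q, (f i - f π) := by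
          rw [← Finset.sum_inter_add_sum_sdiff P Q]
          have : ∑ i ∈ P \ Q, (f i - f π) ≤ 0 :=
            Finset.sum_nonpos fun i hi => hP i (Finset.mem_sdiff.1 hi).1
          linarith
      _ ≤ ∑ i ∈ Q, (f i - f π) := by
          refine Finset.sum_le_sum_of_subset_of_nonneg Finset.inter_subset_right fun i hi hn => ?_
          by_contra hneg
          exact hn (Finset.mem_inter.2 ⟨mem_trimmed.2 ⟨Finset.mem_range.1 (hQ hi),
            Or.inl (by linarith)⟩, hi⟩)
  have h0 : ∑ i ∈ P, (f i - f π) ≤ 0 := Finset.sum_nonpos hP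
  rw [Finset.sum_sub_distrib, Finset.sum_sub_distrib, Finset.sum_const, Finset.sum_const,
    nsmul_eq_mul, nsmul_eq_mul] at h1
  rw [Finset.sum_sub_distrib, Finset.sum_const, nsmul_eq_mul] at h0
  have hc' : (P.card : ℝ) ≤ Q.card := by exact_mod_cast hc
  -- If `f π ≤ B`, every kept value is at most `B`. If `f π ≥ B`, the surplus of `Q` over `P` is
  -- charged at least `B` per index in the comparison `h1`.
  rcases le_total (f π) B with h | h
  · have : (0 : ℝ) ≤ P.card := Nat.cast_nonneg _
    nlinarith
  · nlinarith

/-- A random pivot is good with probability at least `γ / 2`. -/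
theorem card_good_pivots {n : ℕ} {f : ℕ → ℝ} {Q : Finset ℕ} (hQ : Q ⊆ Finset.range n)
    {B γ : ℝ} (hγ : γ ≤ 1) (hn : 1 ≤ n) (hB : ∑ i ∈ Q, f i ≤ B * Q.card)
    (hQc : (1 - γ / 2) * n ≤ Q.card) :
    γ / 2 * n ≤ (((Finset.range n).filter fun π => (1 - γ) * n ≤ ((trimmed n f π).card : ℝ) ∧
      ∑ i ∈ trimmed n f π, f i ≤ B * (trimmed n f π).card).card : ℝ) := by
  have hn' : (1 : ℝ) ≤ n := by exact_mod_cast hn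
  set r := ⌈(1 - γ) * n⌉₊ with hr
  have hrlt : (r : ℝ) < (1 - γ) * n + 1 := Nat.ceil_lt_add_one (by nlinarith)
  have hQn : Q.card ≤ n := (Finset.card_le_card hQ).trans (Finset.card_range n).le
  -- Every size from `(1 - γ) n` up to `|Q|` is good, and there are at least `γ n / 2` such sizes,
  -- one pivot for each. The maximum with `1` excludes the impossible size zero.
  have hsub : Finset.Icc (max r 1) Q.card ⊆ ((Finset.range n).filter fun π =>
      (1 - γ) * n ≤ ((trimmed n f π).card : ℝ) ∧
      ∑ i ∈ trimmed n f π, f i ≤ B * (trimmed n f π).card).image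
        fun π => (trimmed n f π).card := by
    intro q hq
    obtain ⟨h1, h2⟩ := Finset.mem_Icc.1 hq
    have hq' : q ∈ Finset.Icc 1 n := Finset.mem_Icc.2 ⟨by omega, by omega⟩
    rw [← image_card_trimmed n f] at hq'
    obtain ⟨π, hπ, rfl⟩ := Finset.mem_image.1 hq'
    refine Finset.mem_image.2 ⟨π, Finset.mem_filter.2 ⟨hπ, ?_, sum_trimmed_le hQ hB h2⟩, rfl⟩
    have h3 : r ≤ (trimmed n f π).card := by omega
    exact (Nat.le_ceil _).trans (by exact_mod_cast h3)
  have hcard := (Finset.card_le_card hsub).trans Finset.card_image_le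
  rw [Nat.card_Icc] at hcard
  have h4 : (Q.card : ℝ) + 1 ≤ (((Finset.range n).filter fun π =>
      (1 - γ) * n ≤ ((trimmed n f π).card : ℝ) ∧
      ∑ i ∈ trimmed n f π, f i ≤ B * (trimmed n f π).card).card : ℝ) + max (r : ℝ) 1 := by
    have : Q.card + 1 ≤ ((Finset.range n).filter fun π =>
      (1 - γ) * n ≤ ((trimmed n f π).card : ℝ) ∧
      ∑ i ∈ trimmed n f π, f i ≤ B * (trimmed n f π).card).card + max r 1 := by omega
    exact_mod_cast this
  rcases max_cases (r : ℝ) 1 with ⟨h5, _⟩ | ⟨h5, _⟩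
  · rw [h5] at h4; nlinarith
  · rw [h5] at h4; nlinarith

end ProjectiveClustering

/-! ### The success probability of one trial -/

namespace ProjectiveClustering

open Tape Filter Topology

/-- The points, indexed by the natural numbers. -/
noncomputable def pts {n d : ℕ} (p : Fin n → EuclideanSpace ℝ (Fin d)) (i : ℕ) :
    EuclideanSpace ℝ (Fin d) := if h : i < n then p ⟨i, h⟩ else 0

/-- The point of the flat computed from the draws at the position `b`. -/
noncomputable def flatCentre {n d : ℕ} (E : ℕ) (p : Fin n → EuclideanSpace ℝ (Fin d))
    (A : ℕ → ℕ × ℕ) (b : ℕ) : EuclideanSpace ℝ (Fin d) :=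
  centre (coefBound E) (sampleSize E) (pts p) A b

/-- The orthogonal directions of the flat computed from the draws at the position `b`. -/
noncomputable def flatBasis {n d : ℕ} (E j : ℕ) (p : Fin n → EuclideanSpace ℝ (Fin d))
    (A : ℕ → ℕ × ℕ) (b : ℕ) : ℕ → EuclideanSpace ℝ (Fin d) :=
  gramSchmidtPick (stdVec d) j (dirVec (coefBound E) (sampleSize E) (pts p) A b) j

/-- The squared distance of the point number `i` to the flat computed at the position `b`. -/
noncomputable def flatCost {n d : ℕ} (E j : ℕ) (p : Fin n → EuclideanSpace ℝ (Fin d))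
    (A : ℕ → ℕ × ℕ) (b i : ℕ) : ℝ :=
  ‖resid (flatBasis E j p A b) j (pts p i - flatCentre E p A b)‖ ^ 2

/-- The squared distance of the point number `i` to the nearest flat of the trial that starts at the
position `b`. -/
noncomputable def trialCost {n d : ℕ} (E k j : ℕ) (p : Fin n → EuclideanSpace ℝ (Fin d))
    (A : ℕ → ℕ × ℕ) (b i : ℕ) : ℝ :=
  ⨅ c : Fin k, flatCost E j p A (b + c * ((j + 1) * sampleSize E)) i

/-- The indices kept by the trial that starts at the position `b`. -/
noncomputable def trialKept {n d : ℕ} (E k j : ℕ) (p : Fin n → EuclideanSpace ℝ (Fin d))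
    (A : ℕ → ℕ × ℕ) (b : ℕ) : Finset ℕ :=
  trimmed n (trialCost E k j p A b) (A (b + k * ((j + 1) * sampleSize E))).1

/-- The trial that starts at the position `b` yields a good solution. -/
def TrialSuccess {n d : ℕ} (E k j : ℕ) (ε γ : ℝ) (p : Fin n → EuclideanSpace ℝ (Fin d))
    (A : ℕ → ℕ × ℕ) (b : ℕ) : Prop :=
  (1 - γ) * n ≤ ((trialKept E k j p A b).card : ℝ) ∧
    ∑ i ∈ trialKept E k j p A b, trialCost E k j p A b i ≤
      (1 + ε) * opt k j p * ((trialKept E k j p A b).card : ℝ)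

theorem flatBasis_orthFamily {n d : ℕ} (E : ℕ) {j : ℕ} (hj : j ≤ d)
    (p : Fin n → EuclideanSpace ℝ (Fin d)) (A : ℕ → ℕ × ℕ) (b : ℕ) :
    OrthFamily (flatBasis E j p A b) j :=
  (gramSchmidtPick_spec (linearIndependent_stdVec hj) _ le_rfl).1

/-- The orthogonalized family spans at least the sampled directions, so its residue is no longer
than any residual modulo those. -/
theorem flatCost_le {n d : ℕ} (E : ℕ) {j : ℕ} (hj : j ≤ d)
    (p : Fin n → EuclideanSpace ℝ (Fin d)) (A : ℕ → ℕ × ℕ) (b i : ℕ) {w : EuclideanSpace ℝ (Fin d)}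
    (hw : pts p i - flatCentre E p A b - w ∈ Submodule.span ℝ
      (dirVec (coefBound E) (sampleSize E) (pts p) A b '' Set.Iio j)) :
    flatCost E j p A b i ≤ ‖w‖ ^ 2 := by
  have hspec := gramSchmidtPick_spec (linearIndependent_stdVec hj)
    (dirVec (coefBound E) (sampleSize E) (pts p) A b) le_rfl
  have hle : Submodule.span ℝ (dirVec (coefBound E) (sampleSize E) (pts p) A b '' Set.Iio j) ≤
      Submodule.span ℝ (flatBasis E j p A b '' Set.Iio j) := by
    rw [Submodule.span_le]
    rintro _ ⟨s, hs, rfl⟩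
    exact hspec.2 s hs
  have := norm_resid_le (v := pts p i - flatCentre E p A b) (flatBasis_orthFamily E hj p A b)
    (hle hw)
  rw [sub_sub_cancel] at this
  exact pow_le_pow_left₀ (norm_nonneg _) this 2

theorem trialCost_le {n d : ℕ} (E : ℕ) {k j : ℕ} (hj : j ≤ d)
    (p : Fin n → EuclideanSpace ℝ (Fin d)) (A : ℕ → ℕ × ℕ) (b i : ℕ) {w : EuclideanSpace ℝ (Fin d)}
    {c : ℕ} (hc : c < k)
    (hw : pts p i - flatCentre E p A (b + c * ((j + 1) * sampleSize E)) - w ∈ Submodule.span ℝ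
      (dirVec (coefBound E) (sampleSize E) (pts p) A (b + c * ((j + 1) * sampleSize E)) ''
        Set.Iio j)) :
    trialCost E k j p A b i ≤ ‖w‖ ^ 2 :=
  (ciInf_le (Set.finite_range _).bddBelow (⟨c, hc⟩ : Fin k)).trans (flatCost_le E hj p A _ i hw)

theorem flatCentre_congr {n d : ℕ} {E : ℕ} {p : Fin n → EuclideanSpace ℝ (Fin d)}
    {A A' : ℕ → ℕ × ℕ} {b : ℕ} (h : ∀ q, b ≤ q → q < b + sampleSize E → A' q = A q) :
    flatCentre E p A' b = flatCentre E p A b := centre_congr h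

theorem gramSchmidtPick_congr {H : Type*} [NormedAddCommGroup H] [InnerProductSpace ℝ H]
    {e : ℕ → H} {j : ℕ} {u u' : ℕ → H} {l : ℕ} (h : ∀ s < l, u s = u' s) :
    gramSchmidtPick e j u l = gramSchmidtPick e j u' l := by
  induction l with
  | zero => rfl
  | succ l ih => simp only [gramSchmidtPick, ih fun s hs => h s (by omega), h l (by omega)]

theorem flatCost_congr {n d : ℕ} {E j : ℕ} {p : Fin n → EuclideanSpace ℝ (Fin d)}
    {A A' : ℕ → ℕ × ℕ} {b : ℕ} (h : ∀ q, b ≤ q → q < b + (j + 1) * sampleSize E → A' q = A q)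
    (i : ℕ) : flatCost E j p A' b i = flatCost E j p A b i := by
  have h1 : flatCentre E p A' b = flatCentre E p A b := flatCentre_congr fun q h1 h2 =>
    h q h1 (h2.trans_le (Nat.add_le_add_left (Nat.le_mul_of_pos_left _ (by omega)) b))
  have h2 : flatBasis E j p A' b = flatBasis E j p A b := by
    refine gramSchmidtPick_congr fun s hs => dirVec_congr fun q h1 h2 => h q h1 (h2.trans_le ?_)
    exact Nat.add_le_add_left (Nat.mul_le_mul_right _ (by omega)) b
  simp only [flatCost, h1, h2]

theorem trialCost_congr {n d : ℕ} {E k j : ℕ} {p : Fin n → EuclideanSpace ℝ (Fin d)}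
    {A A' : ℕ → ℕ × ℕ} {b : ℕ}
    (h : ∀ q, b ≤ q → q < b + k * ((j + 1) * sampleSize E) → A' q = A q) :
    trialCost E k j p A' b = trialCost E k j p A b := by
  funext i
  unfold trialCost
  congr 1
  funext c
  refine flatCost_congr (fun q h1 h2 => h q (by omega) (h2.trans_le ?_)) i
  have h3 : (c + 1) * ((j + 1) * sampleSize E) ≤ k * ((j + 1) * sampleSize E) :=
    Nat.mul_le_mul_right _ c.2
  have h4 : ((c : ℕ) + 1) * ((j + 1) * sampleSize E)
      = c * ((j + 1) * sampleSize E) + (j + 1) * sampleSize E := by ring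
  omega

theorem TrialSuccess.congr {n d : ℕ} {E k j : ℕ} {ε γ : ℝ} {p : Fin n → EuclideanSpace ℝ (Fin d)}
    {A A' : ℕ → ℕ × ℕ} {b : ℕ}
    (h : ∀ q, b ≤ q → q < b + (k * ((j + 1) * sampleSize E) + 1) → A' q = A q)
    (hA : TrialSuccess E k j ε γ p A b) : TrialSuccess E k j ε γ p A' b := by
  have h1 := trialCost_congr (E := E) (k := k) (j := j) (p := p) fun q h1 h2 => h q h1 (h2.trans (by omega))
  have h2 := h (b + k * ((j + 1) * sampleSize E)) (by omega) (by omega)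
  simpa only [TrialSuccess, trialKept, h1, h2] using hA

/-- The data of a family of reference flats. -/
theorem exists_reference {n d k j : ℕ} (hk : 1 ≤ k) (p : Fin n → EuclideanSpace ℝ (Fin d))
    {F : Fin k → AffineSubspace ℝ (EuclideanSpace ℝ (Fin d))} (hF : ∀ l, IsFlat j (F l)) :
    ∃ (κ : ℕ → ℕ) (f : ℕ → EuclideanSpace ℝ (Fin d)) (v : ℕ → ℕ → EuclideanSpace ℝ (Fin d))
      (w : ℕ → EuclideanSpace ℝ (Fin d)), (∀ i < n, κ i < k) ∧
      (∀ i < n, pts p i - f (κ i) - w i ∈ Submodule.span ℝ (v (κ i) '' Set.Iio j)) ∧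
      ∑ i ∈ Finset.range n, ‖w i‖ ^ 2 = n * avgCost p Finset.univ F := by
  have : Nonempty (Fin k) := ⟨⟨0, by omega⟩⟩
  have h1 : ∀ c : Fin k, ∃ (f : EuclideanSpace ℝ (Fin d)) (v : ℕ → EuclideanSpace ℝ (Fin d)),
      f ∈ F c ∧ (F c).direction = Submodule.span ℝ (v '' Set.Iio j) := by
    intro c
    obtain ⟨⟨f, hf⟩, hdim⟩ := hF c
    let B := Module.finBasisOfFinrankEq ℝ (F c).direction hdim
    refine ⟨f, fun s => if h : s < j then (B ⟨s, h⟩ : EuclideanSpace ℝ (Fin d)) else 0, hf, ?_⟩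
    have h2 : (fun s => if h : s < j then (B ⟨s, h⟩ : EuclideanSpace ℝ (Fin d)) else 0) ''
        Set.Iio j = (F c).direction.subtype '' Set.range B := by
      ext y
      constructor
      · rintro ⟨s, hs, rfl⟩
        have hs' : s < j := hs
        exact ⟨B ⟨s, hs'⟩, ⟨_, rfl⟩, by simp [hs']⟩
      · rintro ⟨_, ⟨s, rfl⟩, rfl⟩
        exact ⟨s, s.2, by simp⟩
    rw [h2, ← Submodule.map_span, B.span_eq, Submodule.map_top, Submodule.range_subtype]
  choose f v hf hv using h1
  have h2 : ∀ i : Fin n, ∃ c : Fin k, ∀ c', Metric.infDist (p i) (F c : Set _) ^ 2 ≤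
      Metric.infDist (p i) (F c' : Set (EuclideanSpace ℝ (Fin d))) ^ 2 := fun i =>
    Finite.exists_min fun c => Metric.infDist (p i) (F c : Set (EuclideanSpace ℝ (Fin d))) ^ 2
  choose κ hκ using h2
  have h3 : ∀ i : Fin n, ∃ w, p i - f (κ i) - w ∈ (F (κ i)).direction ∧
      ‖w‖ = Metric.infDist (p i) (F (κ i) : Set (EuclideanSpace ℝ (Fin d))) := by
    intro i
    obtain ⟨y, hy, hd⟩ := (AffineSubspace.closed_of_finiteDimensional
      (F (κ i))).exists_infDist_eq_dist ⟨f (κ i), hf _⟩ (p i)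
    refine ⟨p i - y, ?_, by rw [hd, dist_eq_norm]⟩
    have : p i - f (κ i) - (p i - y) = y -ᵥ f (κ i) := by rw [vsub_eq_sub]; abel
    rw [this]
    exact AffineSubspace.vsub_mem_direction hy (hf _)
  choose w hw hwn using h3
  refine ⟨fun i => if h : i < n then κ ⟨i, h⟩ else 0, fun c => if h : c < k then f ⟨c, h⟩ else 0,
    fun c => if h : c < k then v ⟨c, h⟩ else 0, fun i => if h : i < n then w ⟨i, h⟩ else 0,
    fun i hi => ?_, fun i hi => ?_, ?_⟩
  · simp [hi]
  · simp only [hi, dif_pos, pts, Fin.is_lt, Fin.eta]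
    rw [← hv]
    exact hw ⟨i, hi⟩
  · rw [Finset.sum_range, avgCost, Finset.card_univ, Fintype.card_fin]
    rcases Nat.eq_zero_or_pos n with rfl | hn
    · simp
    rw [mul_div_cancel₀ _ (by positivity)]
    refine Finset.sum_congr rfl fun i _ => ?_
    simp only [Fin.is_lt, dif_pos, Fin.eta, hwn]
    exact le_antisymm (le_ciInf fun c' => hκ i c') (ciInf_le (Set.finite_range _).bddBelow (κ i))

/-- Bernoulli bounds `(1 - a) ^ N` below by `1 - N a`, and `(1 + a) ^ N (1 - a) ^ N ≤ 1`. For `y ≤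
1/2` the inverse of `1 - y` is at most `1 + 2y`. -/
theorem one_add_pow_le {a : ℝ} (ha : 0 ≤ a) (N : ℕ) (hN : N * a ≤ 1 / 2) :
    (1 + a) ^ N ≤ 1 + 2 * (N * a) := by
  rcases Nat.eq_zero_or_pos N with rfl | hN0
  · simp
  have ha1 : a ≤ 1 / 2 := by
    have : (1 : ℝ) ≤ N := by exact_mod_cast hN0
    nlinarith
  have h1 := one_add_mul_le_pow (show (-2 : ℝ) ≤ -a by linarith) N
  have h2 : (1 + a) ^ N * (1 + -a) ^ N ≤ 1 := by
    rw [← mul_pow]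
    exact pow_le_one₀ (by nlinarith) (by nlinarith)
  have h3 : 0 ≤ (1 + a) ^ N := by positivity
  have h4 : (1 + a) ^ N * (1 - N * a) ≤ 1 := by nlinarith
  have h5 : 0 ≤ (N : ℝ) * a := by positivity
  by_contra hc
  push Not at hc
  nlinarith

/-- The trial state for near-optimal reference flats suffices. -/
theorem sum_trialCost_le {n d E k j : ℕ} {ε γ : ℝ} (hj : j ≤ d) (hε : 0 < ε)
    (hε1 : ε ≤ 1) (hγ : 0 < γ) (hγ1 : γ ≤ 1)
    (hE0 : 0 < E) (hE : ((2 * k + j + 1 : ℕ) : ℝ) / E ≤ ε * γ / 8)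
    {p : Fin n → EuclideanSpace ℝ (Fin d)} {A : ℕ → ℕ × ℕ} {b : ℕ} {Q : Finset ℕ} {t : ℝ}
    (ht : 0 ≤ t) (hQc : (1 - ((2 * k + j + 1 : ℕ) : ℝ) / E) * n ≤ Q.card)
    (hT : TrialState (coefBound E) (sampleSize E) k j (pts p) b Q
      ((1 + 1 / (E : ℝ)) ^ (j + 1) * (n * t)) A) :
    (1 - γ / 2) * n ≤ Q.card ∧ ∑ i ∈ Q, trialCost E k j p A b i ≤ (1 + ε) * t * Q.card := by
  have hE' : (0 : ℝ) < E := by exact_mod_cast hE0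
  have hn0 : (0 : ℝ) ≤ n := Nat.cast_nonneg _
  have hεγ : ε * γ ≤ ε := mul_le_of_le_one_right hε.le hγ1
  have hεγ' : ε * γ ≤ γ := mul_le_of_le_one_left hγ.le hε1
  obtain ⟨w, hw, hws⟩ := hT
  have hcard : (1 - ε * γ / 8) * n ≤ Q.card := le_trans (by gcongr) hQc
  refine ⟨le_trans (mul_le_mul_of_nonneg_right (by linarith) hn0) hcard, ?_⟩
  have h1 : ∑ i ∈ Q, trialCost E k j p A b i ≤ ∑ i ∈ Q, ‖w i‖ ^ 2 := by
    refine Finset.sum_le_sum fun i hi => ?_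
    obtain ⟨c, hc, hm⟩ := hw i hi
    exact trialCost_le E hj p A b i hc hm
  refine (h1.trans hws).trans ?_
  have h2 : ((j + 1 : ℕ) : ℝ) * (1 / E) ≤ ε * γ / 8 := by
    refine le_trans ?_ hE
    rw [mul_one_div]
    gcongr
    omega
  have h3 := one_add_pow_le (a := 1 / (E : ℝ)) (by positivity) (j + 1) (by linarith)
  have h4 : (1 + 1 / (E : ℝ)) ^ (j + 1) ≤ 1 + ε / 4 := by linarith
  have h5 : (1 - ε / 8) * n ≤ Q.card :=
    le_trans (mul_le_mul_of_nonneg_right (by linarith) hn0) hcard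
  -- The factor `1 + ε` must absorb both the growth of the cost by `1 + ε / 4` and the averaging
  -- over only `(1 - ε / 8) n` points.
  have h6 : 1 + ε / 4 ≤ (1 + ε) * (1 - ε / 8) := by nlinarith
  calc (1 + 1 / (E : ℝ)) ^ (j + 1) * (n * t) ≤ (1 + ε / 4) * (n * t) := by gcongr
    _ ≤ (1 + ε) * (1 - ε / 8) * (n * t) := by gcongr
    _ = (1 + ε) * t * ((1 - ε / 8) * n) := by ring
    _ ≤ (1 + ε) * t * Q.card := by gcongr

theorem avgCost_nonneg {n d k : ℕ} (p : Fin n → EuclideanSpace ℝ (Fin d)) (Q : Finset (Fin n))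
    (F : Fin k → AffineSubspace ℝ (EuclideanSpace ℝ (Fin d))) : 0 ≤ avgCost p Q F :=
  div_nonneg (Finset.sum_nonneg fun _ _ => Real.iInf_nonneg fun _ => sq_nonneg _)
    (Nat.cast_nonneg _)

theorem exists_isFlat {d j : ℕ} (hj : j ≤ d) :
    ∃ F : AffineSubspace ℝ (EuclideanSpace ℝ (Fin d)), IsFlat j F :=
  ⟨_, isFlat_of_orthFamily (a := 0)
    (gramSchmidtPick_spec (linearIndependent_stdVec hj) (fun _ => 0) le_rfl).1⟩

/-- The draws of one trial, before the pivot, yield good flats with positive probability. -/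
theorem le_avg_flats {n d E k j : ℕ} {ε γ : ℝ} (hn : 1 ≤ n) (hk : 1 ≤ k) (hj : j ≤ d)
    (hε : 0 < ε) (hε1 : ε ≤ 1) (hγ : 0 < γ) (hγ1 : γ ≤ 1) (hE2 : 2 ≤ E)
    (hEj : 2 * (j + 1) ≤ E) (hE : ((2 * k + j + 1 : ℕ) : ℝ) / E ≤ ε * γ / 8)
    (p : Fin n → EuclideanSpace ℝ (Fin d)) (b : ℕ) (A : ℕ → ℕ × ℕ) :
    (1 / 2 / densityBound E ^ sampleSize E) ^ ((j + 1) * k) ≤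
      avg (draws n (coefBound E)) (unif n (coefBound E)) b (k * ((j + 1) * sampleSize E))
        (ind fun A => ∃ Q ⊆ Finset.range n, (1 - γ / 2) * n ≤ Q.card ∧
          ∑ i ∈ Q, trialCost E k j p A b i ≤ (1 + ε) * opt k j p * Q.card) A := by
  -- The infimum is not assumed to be attained. Reference flats of cost below `opt + δ` give the
  -- bound for `ev δ`, and `δ` then tends to zero.
  set ev : ℝ → (ℕ → ℕ × ℕ) → Prop := fun δ A => ∃ Q ⊆ Finset.range n, (1 - γ / 2) * n ≤ Q.card ∧
    ∑ i ∈ Q, trialCost E k j p A b i ≤ (1 + ε) * (opt k j p + δ) * Q.card with hev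
  have hlim : Tendsto (fun δ => avg (draws n (coefBound E)) (unif n (coefBound E)) b
      (k * ((j + 1) * sampleSize E)) (ind (ev δ)) A) (𝓝[>] 0)
      (𝓝 (avg (draws n (coefBound E)) (unif n (coefBound E)) b
      (k * ((j + 1) * sampleSize E)) (ind (ev 0)) A)) := by
    refine avg_tendsto (fun A => ?_) _ _ _
    refine Tendsto.congr' ?_ tendsto_const_nhds
    by_cases h0 : ev 0 A
    · filter_upwards [self_mem_nhdsWithin] with δ hδ
      have hδ' : (0 : ℝ) < δ := hδ
      rw [ind_of h0, ind_of]
      obtain ⟨Q, h1, h2, h3⟩ := h0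
      refine ⟨Q, h1, h2, h3.trans ?_⟩
      gcongr
    -- For each of the finitely many sets `Q` a strict failure at `δ = 0` persists for small `δ`, so
    -- the indicator of `ev δ` is eventually constant.
    · have hall : ∀ Q ∈ (Finset.range n).powerset, ∀ᶠ δ in 𝓝[>] (0 : ℝ),
          ¬ ((1 - γ / 2) * n ≤ Q.card ∧
            ∑ i ∈ Q, trialCost E k j p A b i ≤ (1 + ε) * (opt k j p + δ) * Q.card) := by
        intro Q hQ
        by_cases hc : (1 - γ / 2) * n ≤ (Q.card : ℝ)
        · have hlt : (1 + ε) * (opt k j p + 0) * Q.card < ∑ i ∈ Q, trialCost E k j p A b i := by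
            by_contra hcon
            exact h0 ⟨Q, Finset.mem_powerset.1 hQ, hc, not_lt.1 hcon⟩
          have hcont : Tendsto (fun δ : ℝ => (1 + ε) * (opt k j p + δ) * Q.card) (𝓝[>] 0)
              (𝓝 ((1 + ε) * (opt k j p + 0) * Q.card)) := by
            refine Tendsto.mono_left ?_ nhdsWithin_le_nhds
            exact (Continuous.tendsto (by fun_prop) 0)
          filter_upwards [hcont.eventually (gt_mem_nhds hlt)] with δ hδ
          exact fun h => absurd h.2 (not_le.2 hδ)
        · exact Eventually.of_forall fun δ h => hc h.1
      have hall' := (Filter.eventually_all_finset _).2 hall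
      filter_upwards [hall'] with δ hδ
      rw [ind_of_not h0, ind_of_not]
      rintro ⟨Q, h1, h2⟩
      exact hδ Q (Finset.mem_powerset.2 h1) h2
  have h0 : (fun A => ∃ Q ⊆ Finset.range n, (1 - γ / 2) * n ≤ (Q.card : ℝ) ∧
      ∑ i ∈ Q, trialCost E k j p A b i ≤ (1 + ε) * opt k j p * Q.card) = ev 0 := by
    simp only [hev, add_zero]
  rw [h0]
  refine ge_of_tendsto hlim ?_
  filter_upwards [self_mem_nhdsWithin] with δ hδ
  have hδ' : (0 : ℝ) < δ := hδ
  obtain ⟨F₀, hF₀⟩ := exists_isFlat hj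
  have : Nonempty (Fin k → {F : AffineSubspace ℝ (EuclideanSpace ℝ (Fin d)) // IsFlat j F}) :=
    ⟨fun _ => ⟨F₀, hF₀⟩⟩
  obtain ⟨F, hF⟩ := exists_lt_of_ciInf_lt (show opt k j p < opt k j p + δ by linarith)
  obtain ⟨κ, f, v, w, hκ, hw, hsum⟩ := exists_reference hk p fun l => (F l).2
  have hmain := le_avg_trialState hn hE2 hEj hκ hw b A
  refine hmain.trans (avg_mono (fun v _ => unif_nonneg _ _ _) _ _ _ fun A' _ => ind_mono ?_)
  rintro ⟨Q, hQ, hQc, hT⟩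
  rw [hsum] at hT
  obtain ⟨h1, h2⟩ := sum_trialCost_le hj hε hε1 hγ hγ1 (by omega) hE (avgCost_nonneg _ _ _) hQc hT
  refine ⟨Q, hQ, h1, h2.trans ?_⟩
  have := hF.le
  gcongr

/-- The pivot is one more draw after those that determine the flats. Conditionally on good flats it
is good with probability at least `γ / 2`. -/
theorem le_avg_trialSuccess {n d E k j : ℕ} {ε γ : ℝ} (hn : 1 ≤ n) (hk : 1 ≤ k) (hj : j ≤ d)
    (hε : 0 < ε) (hε1 : ε ≤ 1) (hγ : 0 < γ) (hγ1 : γ ≤ 1) (hE2 : 2 ≤ E)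
    (hEj : 2 * (j + 1) ≤ E) (hE : ((2 * k + j + 1 : ℕ) : ℝ) / E ≤ ε * γ / 8)
    (p : Fin n → EuclideanSpace ℝ (Fin d)) (b : ℕ) (A : ℕ → ℕ × ℕ) :
    (1 / 2 / densityBound E ^ sampleSize E) ^ ((j + 1) * k) * (γ / 2) ≤
      avg (draws n (coefBound E)) (unif n (coefBound E)) b (k * ((j + 1) * sampleSize E) + 1)
        (ind fun A => TrialSuccess E k j ε γ p A b) A := by
  have hn' : (0 : ℝ) < n := by exact_mod_cast hn
  rw [avg_append]
  have h1 := le_avg_flats hn hk hj hε hε1 hγ hγ1 hE2 hEj hE p b A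
  have h2 := mul_le_mul_of_nonneg_right h1 (show 0 ≤ γ / 2 by linarith)
  rw [mul_comm (avg _ _ _ _ _ _), ← avg_mul_left] at h2
  refine h2.trans (avg_mono (fun v _ => unif_nonneg _ _ _) _ _ _ fun A' _ => ?_)
  by_cases hQ : ∃ Q ⊆ Finset.range n, (1 - γ / 2) * n ≤ (Q.card : ℝ) ∧
      ∑ i ∈ Q, trialCost E k j p A' b i ≤ (1 + ε) * opt k j p * Q.card
  swap
  · rw [ind_of_not hQ, mul_zero]
    exact avg_nonneg (fun v _ => unif_nonneg _ _ _) (ind_nonneg _) _ _ _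
  rw [ind_of hQ, mul_one]
  obtain ⟨Q, hQn, hQc, hQs⟩ := hQ
  have hpiv := card_good_pivots hQn hγ1 hn hQs hQc
  set Gd := (Finset.range n).filter fun π =>
    (1 - γ) * n ≤ ((trimmed n (trialCost E k j p A' b) π).card : ℝ) ∧
      ∑ i ∈ trimmed n (trialCost E k j p A' b) π, trialCost E k j p A' b i ≤
        (1 + ε) * opt k j p * (trimmed n (trialCost E k j p A' b) π).card with hGd
  set pos := b + k * ((j + 1) * sampleSize E) with hpos
  simp only [avg]
  have hsub : Gd ×ˢ Finset.range (2 * coefBound E + 1) ⊆ draws n (coefBound E) :=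
    Finset.product_subset_product_left (Finset.filter_subset _ _)
  have hone : ∀ v ∈ Gd ×ˢ Finset.range (2 * coefBound E + 1),
      ind (fun A => TrialSuccess E k j ε γ p A b) (Function.update A' pos v) = 1 := by
    intro v hv
    have hv1 := (Finset.mem_product.1 hv).1
    refine ind_of (P := fun A => TrialSuccess E k j ε γ p A b) ?_
    have hc : trialCost E k j p (Function.update A' pos v) b = trialCost E k j p A' b :=
      -- The pivot lies just past the entries that determine the flats, so drawing it leaves the
      -- costs unchanged.
      trialCost_congr fun q h1 h2 => Function.update_of_ne (by omega) _ _
    have := (Finset.mem_filter.1 hv1).2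
    simpa only [TrialSuccess, trialKept, hc, ← hpos, Function.update_self] using this
  calc γ / 2 ≤ ∑ v ∈ Gd ×ˢ Finset.range (2 * coefBound E + 1), unif n (coefBound E) v := by
        simp only [unif, Finset.sum_const, Finset.card_product, Finset.card_range, nsmul_eq_mul]
        rw [mul_one_div, le_div_iff₀ (by positivity)]
        push_cast
        rw [← mul_assoc]
        gcongr
    _ = ∑ v ∈ Gd ×ˢ Finset.range (2 * coefBound E + 1), unif n (coefBound E) v *
          ind (fun A => TrialSuccess E k j ε γ p A b) (Function.update A' pos v) :=
        Finset.sum_congr rfl fun v hv => by rw [hone v hv, mul_one]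
    _ ≤ _ := Finset.sum_le_sum_of_subset_of_nonneg hsub fun v _ _ =>
        mul_nonneg (unif_nonneg _ _ _) (ind_nonneg _ _)

/-- Independent repetition. -/
theorem half_le_avg_exists_trialSuccess {n d E k j : ℕ} {ε γ : ℝ} (hn : 1 ≤ n)
    (p : Fin n → EuclideanSpace ℝ (Fin d)) {N : ℕ} {π : ℝ} (hN : 1 ≤ π * N)
    (h : ∀ b A, π ≤ avg (draws n (coefBound E)) (unif n (coefBound E)) b
      (k * ((j + 1) * sampleSize E) + 1) (ind fun A => TrialSuccess E k j ε γ p A b) A)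
    (A : ℕ → ℕ × ℕ) :
    1 / 2 ≤ avg (draws n (coefBound E)) (unif n (coefBound E)) 0
      (N * (k * ((j + 1) * sampleSize E) + 1))
      (ind fun A => ∃ τ < N, TrialSuccess E k j ε γ p A
        (τ * (k * ((j + 1) * sampleSize E) + 1))) A := by
  set D := k * ((j + 1) * sampleSize E) + 1 with hD
  set S := draws n (coefBound E)
  set w := unif n (coefBound E)
  have hw : ∀ v ∈ S, 0 ≤ w v := fun v _ => unif_nonneg _ _ _
  have hw1 : ∑ v ∈ S, w v = 1 := sum_unif hn _
  have hπ1 : π ≤ 1 := (h 0 A).trans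
    ((avg_mono hw _ _ _ fun A' _ => ind_le_one _ _).trans (avg_const hw1 1 _ _ _).le)
  set ev : ℕ → (ℕ → ℕ × ℕ) → Prop := fun T A => ∃ τ < T, TrialSuccess E k j ε γ p A (τ * D) with hev
  have key : ∀ T, avg S w 0 (T * D) (fun A => 1 - ind (ev T) A) A ≤ (1 - π) ^ T := by
    intro T
    induction T with
    | zero => simp [avg, ind, hev]
    | succ T ih =>
      rw [Nat.succ_mul, avg_append, pow_succ']
      refine le_trans ?_ (mul_le_mul_of_nonneg_left ih (by linarith))
      rw [← avg_mul_left]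
      refine avg_mono hw _ _ _ fun A' _ => ?_
      rw [avg_sub, avg_const hw1, zero_add]
      -- A success among the first `T` trials survives the later draws; without one, the next trial
      -- fails with conditional probability at most `1 - π`.
      by_cases hex : ev T A'
      · rw [ind_of hex, sub_self, mul_zero, sub_nonpos]
        rw [← avg_const hw1 1 (T * D) D A']
        refine avg_mono hw _ _ _ fun A'' hA'' => ?_
        rw [ind_of]
        obtain ⟨τ, hτ, hs⟩ := hex
        refine ⟨τ, by omega, hs.congr fun q h1 h2 => hA''.1 q (Or.inl (h2.trans_le ?_))⟩
        have := Nat.mul_le_mul_right D (show τ + 1 ≤ T by omega)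
        rw [Nat.succ_mul] at this
        exact this
      · rw [ind_of_not hex, sub_zero, mul_one]
        have h1 := (h (T * D) A').trans (avg_mono hw _ _ _ fun A'' _ =>
          ind_mono (Q := ev (T + 1))
            fun hs => ⟨T, by omega, hs⟩)
        linarith
  have h1 := key N
  rw [avg_sub, avg_const hw1] at h1
  -- Since `1 ≤ π N`, the failure probability is at most `exp (-1)`, hence at most `1/2`.
  have h2 : (1 - π) ^ N ≤ 1 / 2 := by
    have h3 : (1 - π) ^ N ≤ Real.exp (-π) ^ N :=
      pow_le_pow_left₀ (by linarith) (by linarith [Real.add_one_le_exp (-π)]) N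
    have h4 : Real.exp (-π) ^ N = Real.exp (-(π * N)) := by rw [← Real.exp_nat_mul]; ring_nf
    have h5 : Real.exp (-(π * N)) ≤ Real.exp (-1) := Real.exp_le_exp.2 (by linarith)
    have h6 : Real.exp (-1) ≤ 1 / 2 := by
      rw [Real.exp_neg, one_div]
      exact inv_anti₀ (by norm_num) (by linarith [Real.add_one_le_exp 1])
    linarith
  linarith

end ProjectiveClustering

/-! ### Reasoning about programs -/

namespace RealRAM

theorem runFor_add (x : Config) (t u : ℕ) :
    runFor x (t + u) = (runFor x t).bind fun y => runFor y u := by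
  induction u with
  | zero => simp [runFor]
  | succ u ih =>
    rw [← add_assoc]
    simp only [runFor]
    rw [ih, PMF.bind_bind]

theorem runFor_succ (x : Config) (t : ℕ) :
    runFor x (t + 1) = (step x).bind fun y => runFor y t := by
  rw [add_comm, runFor_add]
  simp [runFor]

theorem runFor_halted (s : Store) (t : ℕ) : runFor ([], s) t = PMF.pure ([], s) := by
  induction t with
  | zero => rfl
  | succ t ih => simp [runFor, ih, step]

/-- Without random choices, the command `c` turns the memory `s` into `s'` in `t` steps. -/
def Run (c : Cmd) (s : Store) (t : ℕ) (s' : Store) : Prop :=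
  ∀ K, runFor (c :: K, s) t = PMF.pure (K, s')

/-- Without random choices, the command `c` started on `s` ends within `B` steps in a memory that
satisfies `Q`. -/
def Ends (c : Cmd) (s : Store) (B : ℕ) (Q : Store → Prop) : Prop :=
  ∃ t ≤ B, ∃ s', Run c s t s' ∧ Q s'

/-- Whether the command writes to the array `x` of natural numbers. -/
def Cmd.writesNat : Cmd → ℕ → Bool
  | .setNat a _ _, x => Nat.beq a x
  | .setReal _ _ _, _ => false
  | .rand a _ _, x => Nat.beq a x
  | .seq c₁ c₂, x => c₁.writesNat x || c₂.writesNat x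
  | .cond _ c₁ c₂, x => c₁.writesNat x || c₂.writesNat x
  | .loop _ c, x => c.writesNat x

/-- Whether the command writes to the array `x` of real numbers. -/
def Cmd.writesReal : Cmd → ℕ → Bool
  | .setNat _ _ _, _ => false
  | .setReal a _ _, x => Nat.beq a x
  | .rand _ _ _, _ => false
  | .seq c₁ c₂, x => c₁.writesReal x || c₂.writesReal x
  | .cond _ c₁ c₂, x => c₁.writesReal x || c₂.writesReal x
  | .loop _ c, x => c.writesReal x

/-- The memories agree on the arrays to which `c` does not write. -/
structure Frame (c : Cmd) (s s' : Store) : Prop where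
  nat : ∀ a, c.writesNat a = false → s'.nat a = s.nat a
  real : ∀ a, c.writesReal a = false → s'.real a = s.real a

theorem Frame.trans {c : Cmd} {s₁ s₂ s₃ : Store} (h : Frame c s₁ s₂) (h' : Frame c s₂ s₃) :
    Frame c s₁ s₃ :=
  ⟨fun a ha => (h'.nat a ha).trans (h.nat a ha), fun a ha => (h'.real a ha).trans (h.real a ha)⟩

theorem Frame.weaken {c c' : Cmd} {s s' : Store} (h : Frame c s s')
    (hn : ∀ a, c'.writesNat a = false → c.writesNat a = false)
    (hr : ∀ a, c'.writesReal a = false → c.writesReal a = false) : Frame c' s s' :=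
  ⟨fun a ha => h.nat a (hn a ha), fun a ha => h.real a (hr a ha)⟩

theorem nat_beq_eq_false {a b : ℕ} (h : Nat.beq a b = false) : b ≠ a := by
  rintro rfl
  simp at h

/-- The induction must also follow the pending commands: none of them may write to the protected
arrays either. This turns the computable test for writes into a fact about runs. -/
theorem support_frame (W : ℕ → Bool) (W' : ℕ → Bool) (x : Config)
    (hx : ∀ c ∈ x.1, ∀ a, (W a = false → c.writesNat a = false) ∧
      (W' a = false → c.writesReal a = false)) (t : ℕ) :
    ∀ y ∈ (runFor x t).support,
      (∀ c ∈ y.1, ∀ a, (W a = false → c.writesNat a = false) ∧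
        (W' a = false → c.writesReal a = false)) ∧
      (∀ a, W a = false → y.2.nat a = x.2.nat a) ∧
      ∀ a, W' a = false → y.2.real a = x.2.real a := by
  induction t with
  | zero =>
    intro y hy
    rw [runFor, PMF.support_pure, Set.mem_singleton_iff] at hy
    subst hy
    exact ⟨hx, fun _ _ => rfl, fun _ _ => rfl⟩
  | succ t ih =>
    intro z hz
    rw [runFor, PMF.mem_support_bind_iff] at hz
    obtain ⟨⟨L, s⟩, hy, hz⟩ := hz
    obtain ⟨h1, h2, h3⟩ := ih _ hy
    have key : (∀ c ∈ z.1, ∀ a, (W a = false → c.writesNat a = false) ∧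
        (W' a = false → c.writesReal a = false)) ∧
      (∀ a, W a = false → z.2.nat a = s.nat a) ∧ ∀ a, W' a = false → z.2.real a = s.real a := by
      rcases L with _ | ⟨c, K⟩
      · simp only [step, PMF.support_pure, Set.mem_singleton_iff] at hz
        subst hz
        exact ⟨h1, fun _ _ => rfl, fun _ _ => rfl⟩
      have hc := h1 c (by simp)
      have hK : ∀ c ∈ K, ∀ a, (W a = false → c.writesNat a = false) ∧
          (W' a = false → c.writesReal a = false) := fun c' hc' => h1 c' (by simp [hc'])
      cases c with
      | setNat a i e =>
        simp only [step, PMF.support_pure, Set.mem_singleton_iff] at hz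
        subst hz
        refine ⟨hK, fun b hb => ?_, fun _ _ => rfl⟩
        simp [Store.setNat, Function.update_of_ne (nat_beq_eq_false ((hc b).1 hb))]
      | setReal a i e =>
        simp only [step, PMF.support_pure, Set.mem_singleton_iff] at hz
        subst hz
        refine ⟨hK, fun _ _ => rfl, fun b hb => ?_⟩
        simp [Store.setReal, Function.update_of_ne (nat_beq_eq_false ((hc b).2 hb))]
      | rand a i e =>
        simp only [step, PMF.support_map, Set.mem_image] at hz
        obtain ⟨v, _, rfl⟩ := hz
        refine ⟨hK, fun b hb => ?_, fun _ _ => rfl⟩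
        simp [Store.setNat, Function.update_of_ne (nat_beq_eq_false ((hc b).1 hb))]
      | seq c₁ c₂ =>
        simp only [step, PMF.support_pure, Set.mem_singleton_iff] at hz
        subst hz
        refine ⟨fun c' hc' a => ?_, fun _ _ => rfl, fun _ _ => rfl⟩
        have := hc a
        simp only [Cmd.writesNat, Cmd.writesReal, Bool.or_eq_false_iff] at this
        rcases List.mem_cons.1 hc' with rfl | hc'
        · exact ⟨fun h => (this.1 h).1, fun h => (this.2 h).1⟩
        rcases List.mem_cons.1 hc' with rfl | hc'
        · exact ⟨fun h => (this.1 h).2, fun h => (this.2 h).2⟩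
        · exact hK c' hc' a
      | cond b c₁ c₂ =>
        simp only [step, PMF.support_pure, Set.mem_singleton_iff] at hz
        have h4 : ∀ a, (W a = false → c₁.writesNat a = false ∧ c₂.writesNat a = false) ∧
            (W' a = false → c₁.writesReal a = false ∧ c₂.writesReal a = false) := fun a => by
          have := hc a
          simpa only [Cmd.writesNat, Cmd.writesReal, Bool.or_eq_false_iff] using this
        split_ifs at hz
        · subst hz
          refine ⟨fun c' hc' a => ?_, fun _ _ => rfl, fun _ _ => rfl⟩
          rcases List.mem_cons.1 hc' with rfl | hc'
          · exact ⟨fun h => ((h4 a).1 h).1, fun h => ((h4 a).2 h).1⟩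
          · exact hK c' hc' a
        · subst hz
          refine ⟨fun c' hc' a => ?_, fun _ _ => rfl, fun _ _ => rfl⟩
          rcases List.mem_cons.1 hc' with rfl | hc'
          · exact ⟨fun h => ((h4 a).1 h).2, fun h => ((h4 a).2 h).2⟩
          · exact hK c' hc' a
      | loop b c =>
        simp only [step, PMF.support_pure, Set.mem_singleton_iff] at hz
        split_ifs at hz
        · subst hz
          refine ⟨fun c' hc' a => ?_, fun _ _ => rfl, fun _ _ => rfl⟩
          rcases List.mem_cons.1 hc' with rfl | hc'
          · exact hc a
          · exact h1 c' hc' a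
        · subst hz
          exact ⟨hK, fun _ _ => rfl, fun _ _ => rfl⟩
    exact ⟨key.1, fun a ha => (key.2.1 a ha).trans (h2 a ha),
      fun a ha => (key.2.2 a ha).trans (h3 a ha)⟩

theorem Run.frame {c : Cmd} {s s' : Store} {t : ℕ} (h : Run c s t s') : Frame c s s' := by
  have := support_frame c.writesNat c.writesReal ([c], s) (by simp) t ([], s')
    (by rw [h []]; simp)
  exact ⟨this.2.1, this.2.2⟩

/-- The frame is handed to the postcondition, so specifications of commands need to mention only
what changes. -/
theorem Ends.mono {c : Cmd} {s : Store} {B B' : ℕ} {Q Q' : Store → Prop} (h : Ends c s B Q)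
    (hB : B ≤ B') (hQ : ∀ s', Frame c s s' → Q s' → Q' s') : Ends c s B' Q' := by
  obtain ⟨t, ht, s', hr, hQ'⟩ := h
  exact ⟨t, ht.trans hB, s', hr, hQ _ hr.frame hQ'⟩

theorem Ends.setNat (a : ℕ) (i e : NExp) (s : Store) :
    Ends (.setNat a i e) s 1 fun s' =>
      s'.nat a = Function.update (s.nat a) (i.eval s) (e.eval s) := by
  refine ⟨1, le_rfl, s.setNat a (i.eval s) (e.eval s), fun K => ?_, ?_⟩
  · simp [runFor, step]
  · simp [Store.setNat]

theorem Ends.setReal (a : ℕ) (i : NExp) (e : RExp) (s : Store) :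
    Ends (.setReal a i e) s 1 fun s' =>
      s'.real a = Function.update (s.real a) (i.eval s) (e.eval s) := by
  refine ⟨1, le_rfl, s.setReal a (i.eval s) (e.eval s), fun K => ?_, ?_⟩
  · simp [runFor, step]
  · simp [Store.setReal]

theorem Run.trans_step {x : Config} {K : List Cmd} {s s' : Store} {c : Cmd} {t u : ℕ}
    (h1 : runFor x t = PMF.pure (c :: K, s)) (h2 : Run c s u s') :
    runFor x (t + u) = PMF.pure (K, s') := by
  rw [runFor_add, h1, PMF.pure_bind, h2 K]

theorem Ends.seq {c₁ c₂ : Cmd} {s : Store} {B₁ B₂ B : ℕ} {R Q : Store → Prop}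
    (h₁ : Ends c₁ s B₁ R) (h₂ : ∀ s', Frame c₁ s s' → R s' → Ends c₂ s' B₂ Q)
    (hB : B₁ + B₂ + 1 ≤ B) : Ends (.seq c₁ c₂) s B Q := by
  obtain ⟨t, ht, s₁, hr, hR⟩ := h₁
  obtain ⟨u, hu, s₂, hr', hQ⟩ := h₂ s₁ hr.frame hR
  refine ⟨1 + t + u, by omega, s₂, fun K => ?_, hQ⟩
  refine Run.trans_step (Run.trans_step (K := c₂ :: K) (s := s) (c := c₁) ?_ hr) hr'
  simp [runFor, step]

theorem Ends.cond {b : Test} {c₁ c₂ : Cmd} {s : Store} {B₁ B : ℕ} {Q : Store → Prop}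
    (h₁ : b.Holds s → Ends c₁ s B₁ Q) (h₂ : ¬ b.Holds s → Ends c₂ s B₁ Q)
    (hB : B₁ + 1 ≤ B) : Ends (.cond b c₁ c₂) s B Q := by
  by_cases hb : b.Holds s
  · obtain ⟨t, ht, s', hr, hQ⟩ := h₁ hb
    refine ⟨1 + t, by omega, s', fun K => Run.trans_step (c := c₁) (s := s) ?_ hr, hQ⟩
    simp [runFor, step, hb]
  · obtain ⟨t, ht, s', hr, hQ⟩ := h₂ hb
    refine ⟨1 + t, by omega, s', fun K => Run.trans_step (c := c₂) (s := s) ?_ hr, hQ⟩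
    simp [runFor, step, hb]

theorem Ends.loop_false {b : Test} {c : Cmd} {s : Store} {Q : Store → Prop}
    (hb : ¬ b.Holds s) (hQ : Q s) : Ends (.loop b c) s 1 Q :=
  ⟨1, le_rfl, s, fun K => by simp [runFor, step, hb], hQ⟩

theorem Ends.loop_true {b : Test} {c : Cmd} {s : Store} {B₁ B₂ B : ℕ} {R Q : Store → Prop}
    (hb : b.Holds s) (h₁ : Ends c s B₁ R) (h₂ : ∀ s', Frame c s s' → R s' → Ends (.loop b c) s' B₂ Q)
    (hB : B₁ + B₂ + 1 ≤ B) : Ends (.loop b c) s B Q := by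
  obtain ⟨t, ht, s₁, hr, hR⟩ := h₁
  obtain ⟨u, hu, s₂, hr', hQ⟩ := h₂ s₁ hr.frame hR
  refine ⟨1 + t + u, by omega, s₂, fun K => ?_, hQ⟩
  refine Run.trans_step (Run.trans_step (K := .loop b c :: K) (s := s) (c := c) ?_ hr) hr'
  simp [runFor, step, hb]

/-- The scalar variable kept in the entry `0` of the array `a`. -/
abbrev var (a : ℕ) : NExp := .get a (.const 0)

/-- The real scalar variable kept in the entry `0` of the array `a`. -/
abbrev rvar (a : ℕ) : RExp := .get a (.const 0)

/-- `a := e`. -/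
abbrev assign (a : ℕ) (e : NExp) : Cmd := .setNat a (.const 0) e

/-- `a := e` for a real scalar variable. -/
abbrev rassign (a : ℕ) (e : RExp) : Cmd := .setReal a (.const 0) e

/-- `for v = 0, …, lim - 1 do body`. -/
abbrev forLoop (v : ℕ) (lim : NExp) (body : Cmd) : Cmd :=
  .seq (assign v (.const 0)) (.loop (.natLT (var v) lim)
    (.seq body (assign v (.add (var v) (.const 1)))))

/-- The invariant must not depend on the counter's own array, because the increment follows the
body. A round costs the body plus a loop test, the unfolding of a sequence and the increment. The
final `3` accounts for the outer sequence, the initialization and the last test. -/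
theorem Ends.forLoop {v : ℕ} {lim : NExp} {body : Cmd} {s : Store} {n b B : ℕ}
    (I : ℕ → Store → Prop) (hv : body.writesNat v = false)
    (hI : ∀ i s s', I i s → (∀ a, a ≠ v → s'.nat a = s.nat a) → s'.real = s.real → I i s')
    (hlim : ∀ i s', Frame (forLoop v lim body) s s' → I i s' → lim.eval s' = n)
    (h0 : I 0 s)
    (hbody : ∀ i < n, ∀ s', Frame (forLoop v lim body) s s' → s'.nat v 0 = i → I i s' →
      Ends body s' b (I (i + 1)))
    (hB : n * (b + 3) + 3 ≤ B) :
    Ends (forLoop v lim body) s B (I n) := by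
  have hreal : ∀ {e : NExp} {s s' : Store}, Frame (assign v e) s s' → s'.real = s.real :=
    fun h => funext fun a => h.real a rfl
  have hne : ∀ {e : NExp} {s s' : Store}, Frame (assign v e) s s' →
      ∀ a, a ≠ v → s'.nat a = s.nat a := by
    intro e s s' h a ha
    refine h.nat a ?_
    simp only [Cmd.writesNat]
    rw [Bool.eq_false_iff]
    intro hb
    exact ha (Nat.eq_of_beq_eq_true hb).symm
  have hfr1 : ∀ {e : NExp} {s s' : Store}, Frame (assign v e) s s' →
      Frame (RealRAM.forLoop v lim body) s s' := fun h => h.weaken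
    (fun a ha => by
      simp only [Cmd.writesNat, Bool.or_eq_false_iff] at ha ⊢; exact ha.1)
    (fun a ha => rfl)
  have hfr2 : ∀ {s s' : Store}, Frame body s s' →
      Frame (RealRAM.forLoop v lim body) s s' := fun h => h.weaken
    (fun a ha => by simp only [Cmd.writesNat, Bool.or_eq_false_iff] at ha; exact ha.2.1)
    (fun a ha => by simp only [Cmd.writesReal, Bool.or_eq_false_iff] at ha; exact ha.2.1)
  have key : ∀ r i, i + r = n → ∀ s', Frame (RealRAM.forLoop v lim body) s s' → s'.nat v 0 = i →
      I i s' → Ends (.loop (.natLT (var v) lim) (.seq body (assign v (.add (var v) (.const 1)))))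
        s' (r * (b + 3) + 1) (I n) := by
    intro r
    induction r with
    | zero =>
      intro i hi s' hf hv' hs'
      have : i = n := by omega
      subst this
      refine (Ends.loop_false ?_ hs').mono (by omega) fun _ _ h => h
      simp [Test.Holds, NExp.eval, hlim _ s' hf hs', hv']
    | succ r ih =>
      intro i hi s' hf hv' hs'
      refine Ends.loop_true (B₁ := b + 2) (R := fun s'' => Frame (RealRAM.forLoop v lim body) s s'' ∧
        s''.nat v 0 = i + 1 ∧ I (i + 1) s'') ?_ ?_ ?_ (B₂ := r * (b + 3) + 1) ?_
      · simp only [Test.Holds, NExp.eval, hlim _ s' hf hs', hv']; omega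
      · refine (hbody i (by omega) s' hf hv' hs').seq (B₂ := 1) (fun s₁ hf₁ h₁ => ?_) (by omega)
        refine (Ends.setNat _ _ _ _).mono le_rfl fun s₂ hf₂ h₂ => ⟨?_, ?_, ?_⟩
        · exact (hf.trans (hfr2 hf₁)).trans (hfr1 hf₂)
        · rw [h₂]; simp [NExp.eval, hf₁.nat v hv, hv']
        · exact hI _ _ _ h₁ (hne hf₂) (hreal hf₂)
      · rintro s'' _ ⟨h1, h2, h3⟩
        exact ih (i + 1) (by omega) s'' h1 h2 h3
      · ring_nf; omega
  refine (Ends.setNat v (.const 0) (.const 0) s).seq (B₂ := n * (b + 3) + 1)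
    (fun s' hf h => ?_) (by omega)
  refine key n 0 (by omega) s' (hfr1 hf) ?_ (hI _ _ _ h0 (hne hf) (hreal hf))
  rw [h]; simp [NExp.eval]

/-- Summation into one entry of an array. -/
theorem Ends.accumulate {v : ℕ} {lim : NExp} {a : ℕ} {i : NExp} {e : RExp} {s : Store}
    {n i₀ B : ℕ} (f : ℕ → ℝ)
    (hlim : ∀ s', Frame (RealRAM.forLoop v lim (.setReal a i (.add (.get a i) e))) s s' →
      lim.eval s' = n)
    (hi : ∀ s', Frame (RealRAM.forLoop v lim (.setReal a i (.add (.get a i) e))) s s' →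
      i.eval s' = i₀)
    (he : ∀ t < n, ∀ s', Frame (RealRAM.forLoop v lim (.setReal a i (.add (.get a i) e))) s s' →
      s'.nat v 0 = t → e.eval s' = f t)
    (hB : 4 * n + 3 ≤ B) :
    Ends (RealRAM.forLoop v lim (.setReal a i (.add (.get a i) e))) s B fun s' =>
      s'.real a = Function.update (s.real a) i₀ (s.real a i₀ + ∑ t ∈ Finset.range n, f t) := by
  refine Ends.forLoop (b := 1) (n := n) (fun m s' =>
    s'.real a = Function.update (s.real a) i₀ (s.real a i₀ + ∑ t ∈ Finset.range m, f t)) rfl ?_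
    (fun _ s' hf _ => hlim s' hf) ?_ ?_ (by omega)
  · intro m s₁ s₂ h _ hr
    rw [hr, h]
  · simp
  · intro t ht s' hf hv h
    refine (Ends.setReal _ _ _ _).mono le_rfl fun s'' _ h' => ?_
    rw [h', h, hi s' hf]
    simp only [RExp.eval, hi s' hf, h, he t ht s' hf hv, Function.update_self,
      Function.update_idem, Finset.sum_range_succ, add_assoc]

/-- Assignment to consecutive entries of an array. -/
theorem Ends.fill {v : ℕ} {lim : NExp} {a : ℕ} {i : NExp} {e : RExp} {s : Store}
    {n i₀ B : ℕ} (f : ℕ → ℝ)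
    (hlim : ∀ s', Frame (RealRAM.forLoop v lim (.setReal a i e)) s s' → lim.eval s' = n)
    (he : ∀ t < n, ∀ s', Frame (RealRAM.forLoop v lim (.setReal a i e)) s s' → s'.nat v 0 = t →
      s'.real a (i₀ + t) = s.real a (i₀ + t) → i.eval s' = i₀ + t ∧ e.eval s' = f t)
    (hB : 4 * n + 3 ≤ B) :
    Ends (RealRAM.forLoop v lim (.setReal a i e)) s B fun s' =>
      (∀ t < n, s'.real a (i₀ + t) = f t) ∧
      ∀ q, (q < i₀ ∨ i₀ + n ≤ q) → s'.real a q = s.real a q := by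
  refine (Ends.forLoop (b := 1) (n := n) (fun m s' => (∀ t < m, s'.real a (i₀ + t) = f t) ∧
      ∀ q, (q < i₀ ∨ i₀ + m ≤ q) → s'.real a q = s.real a q) rfl ?_
    (fun _ s' hf _ => hlim s' hf) ?_ ?_ (by omega))
  · intro m s₁ s₂ h _ hr
    rw [hr]; exact h
  · exact ⟨fun t ht => by omega, fun _ _ => rfl⟩
  · rintro t ht s' hf hv ⟨h1, h2⟩
    -- The entry about to be written still has its original value, so `e` may read it and in-place
    -- updates are covered.
    obtain ⟨h3, h4⟩ := he t ht s' hf hv (h2 _ (by omega))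
    refine (Ends.setReal _ _ _ _).mono le_rfl fun s'' _ h' => ⟨fun u hu => ?_, fun q hq => ?_⟩
    · rw [h', h3, h4]
      rcases Nat.lt_succ_iff_lt_or_eq.1 hu with hu | rfl
      · rw [Function.update_of_ne (by omega), h1 u hu]
      · rw [Function.update_self]
    · rw [h', h3, Function.update_of_ne (by omega), h2 q (by omega)]

end RealRAM

/-! ### The program: computing the flats of one trial -/

namespace ProjectiveClustering

open RealRAM

/-- The coordinates of a vector, indexed by the natural numbers. -/
noncomputable def coord {d : ℕ} (v : EuclideanSpace ℝ (Fin d)) (t : ℕ) : ℝ :=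
  if h : t < d then v ⟨t, h⟩ else 0

section coord

variable {d : ℕ}

theorem coord_sub (v w : EuclideanSpace ℝ (Fin d)) (t : ℕ) :
    coord (v - w) t = coord v t - coord w t := by
  unfold coord; split_ifs <;> simp

theorem coord_smul (c : ℝ) (v : EuclideanSpace ℝ (Fin d)) (t : ℕ) :
    coord (c • v) t = c * coord v t := by
  unfold coord; split_ifs <;> simp

theorem coord_zero (t : ℕ) : coord (0 : EuclideanSpace ℝ (Fin d)) t = 0 := by
  unfold coord; split_ifs <;> simp

theorem coord_add (v w : EuclideanSpace ℝ (Fin d)) (t : ℕ) :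
    coord (v + w) t = coord v t + coord w t := by
  unfold coord; split_ifs <;> simp

theorem coord_sum {ι : Type*} (S : Finset ι) (v : ι → EuclideanSpace ℝ (Fin d)) (t : ℕ) :
    coord (∑ i ∈ S, v i) t = ∑ i ∈ S, coord (v i) t := by
  classical
  induction S using Finset.induction_on with
  | empty => simp [coord_zero]
  | insert a S ha ih => rw [Finset.sum_insert ha, Finset.sum_insert ha, coord_add, ih]

theorem inner_eq_sum_coord (v w : EuclideanSpace ℝ (Fin d)) :
    inner ℝ v w = ∑ t ∈ Finset.range d, coord v t * coord w t := by
  rw [Finset.sum_range, PiLp.inner_apply]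
  refine Finset.sum_congr rfl fun i _ => ?_
  simp [coord, mul_comm]

theorem norm_sq_eq_sum_coord (v : EuclideanSpace ℝ (Fin d)) :
    ‖v‖ ^ 2 = ∑ t ∈ Finset.range d, coord v t * coord v t := by
  rw [← real_inner_self_eq_norm_sq, inner_eq_sum_coord]

theorem coord_stdVec {t : ℕ} (ht : t < d) (r : ℕ) :
    coord (stdVec d r) t = if t = r then 1 else 0 := by
  simp [coord, ht, stdVec]

end coord

/-- The vector `v` is stored in the array `a` from the entry `i` on. -/
def VecAt {d : ℕ} (s : Store) (a i : ℕ) (v : EuclideanSpace ℝ (Fin d)) : Prop :=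
  ∀ t < d, s.real a (i + t) = coord v t

theorem VecAt.congr {d : ℕ} {s s' : Store} {a i : ℕ} {v : EuclideanSpace ℝ (Fin d)}
    (h : VecAt s a i v) (hs : s'.real a = s.real a) : VecAt s' a i v := fun t ht => by
  rw [hs]; exact h t ht

/-! Arrays of natural numbers: parameters (`aM` to `aL`), the table `aRow` of the positions of the
points, the two tapes, loop counters, and addresses. -/

abbrev aM : ℕ := 1
abbrev aE : ℕ := 2
abbrev aSize : ℕ := 3
abbrev aG : ℕ := 4
abbrev aRange : ℕ := 5
abbrev aBlk : ℕ := 7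
abbrev aD : ℕ := 8
abbrev aX : ℕ := 9
abbrev aN : ℕ := 10
abbrev aL : ℕ := 11
abbrev aRow : ℕ := 12
abbrev aTapeI : ℕ := 13
abbrev aTapeG : ℕ := 14
abbrev vMul : ℕ := 15
abbrev vFill : ℕ := 16
abbrev vTrial : ℕ := 17
abbrev vC : ℕ := 18
abbrev vDir : ℕ := 19
abbrev vR : ℕ := 20
abbrev vQ : ℕ := 21
abbrev vS : ℕ := 22
abbrev vI : ℕ := 23
abbrev vPick : ℕ := 24
abbrev aPos : ℕ := 25
abbrev aOff : ℕ := 26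
abbrev aCb : ℕ := 27
abbrev aO : ℕ := 28
abbrev aFlag : ℕ := 29
abbrev aCnt : ℕ := 30
abbrev aPiv : ℕ := 31
abbrev vCopy : ℕ := 32
abbrev aDummy : ℕ := 33

/-! Arrays of real numbers: the candidate flats, the current vector, and scalars. -/

abbrev rOut : ℕ := 2
abbrev rCand : ℕ := 3
abbrev rVec : ℕ := 4
abbrev rSum : ℕ := 5
abbrev rDot : ℕ := 6
abbrev rSq : ℕ := 7
abbrev rNorm : ℕ := 8
abbrev rVal : ℕ := 9
abbrev rBest : ℕ := 10
abbrev rTotal : ℕ := 11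

abbrev eN : NExp := .get 0 (.const 0)
abbrev eD : NExp := .get 0 (.const 1)
abbrev eK : NExp := .get 0 (.const 2)
abbrev eJ : NExp := .get 0 (.const 3)

/-- No effect. -/
abbrev skip : Cmd := assign aDummy (.const 0)

/-- The coefficient and the coordinate of the point at the current position of the tape. -/
abbrev coefE : RExp := .sub (.ofNat (.get aTapeG (.add (var aPos) (var vR)))) (.ofNat (var aG))
abbrev pointE : RExp := .get 0 (.add (.get aRow (.get aTapeI (.add (var aPos) (var vR)))) (var vQ))

/-- `vec := ∑ coef • (point - y)` over the current block of the tape. -/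
abbrev gatherCmd (y : RExp) : Cmd :=
  forLoop vQ eD (.seq (.setReal rVec (var vQ) (.ofNat (.const 0)))
    (forLoop vR (var aSize) (.setReal rVec (var vQ)
      (.add (.get rVec (var vQ)) (.mul coefE (.sub pointE y))))))

/-- The entry of the candidate array with the current offset. -/
abbrev candE (o : ℕ) : RExp := .get rCand (.add (var o) (var vQ))

/-- Subtraction of the component along the vector at the offset `aO`. -/
abbrev projectCmd : Cmd :=
  .seq (rassign rDot (.ofNat (.const 0))) (.seq (rassign rSq (.ofNat (.const 0)))
    (.seq (forLoop vQ eD (rassign rDot (.add (rvar rDot) (.mul (candE aO) (.get rVec (var vQ))))))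
    (.seq (forLoop vQ eD (rassign rSq (.add (rvar rSq) (.mul (candE aO) (candE aO)))))
      (forLoop vQ eD (.setReal rVec (var vQ)
        (.sub (.get rVec (var vQ)) (.mul (.div (rvar rDot) (rvar rSq)) (candE aO))))))))

/-- The residue of `vec` with respect to the first `cnt` directions of the current flat. -/
abbrev residCmd (cnt : NExp) : Cmd :=
  .seq (assign aO (var aCb)) (forLoop vS cnt
    (.seq (assign aO (.add (var aO) eD)) projectCmd))

/-- The squared norm of `vec`. -/
abbrev normCmd : Cmd :=
  .seq (rassign rNorm (.ofNat (.const 0)))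
    (forLoop vQ eD (rassign rNorm (.add (rvar rNorm) (.mul (.get rVec (var vQ)) (.get rVec (var vQ))))))

/-- `vec := e`, for the standard basis vector `e` numbered by `vPick`. -/
abbrev stdCmd : Cmd :=
  .seq (forLoop vQ eD (.setReal rVec (var vQ) (.ofNat (.const 0))))
    (.setReal rVec (var vPick) (.ofNat (.const 1)))

/-- Replacement of a vanishing residue. -/
abbrev pickCmd : Cmd :=
  forLoop vPick eJ (.cond (.realLT (.ofNat (.const 0)) (rvar rNorm)) skip
    (.seq stdCmd (.seq (residCmd (var vDir)) normCmd)))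

/-- Storing `vec` as the next vector of the candidate. -/
abbrev storeCmd : Cmd :=
  .seq (forLoop vQ eD (.setReal rCand (.add (var aOff) (var vQ)) (.get rVec (var vQ))))
    (.seq (assign aOff (.add (var aOff) eD)) (assign aPos (.add (var aPos) (var aSize))))

/-- The data that stay fixed during the trials. -/
structure Base {n d : ℕ} (E k j N : ℕ) (ε γ : ℝ) (p : Fin n → EuclideanSpace ℝ (Fin d))
    (A : ℕ → ℕ × ℕ) (s : Store) : Prop where
  n_eq : s.nat 0 0 = n
  d_eq : s.nat 0 1 = d
  k_eq : s.nat 0 2 = k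
  j_eq : s.nat 0 3 = j
  size_eq : s.nat aSize 0 = sampleSize E
  G_eq : s.nat aG 0 = coefBound E
  N_eq : s.nat aN 0 = N
  row_eq : ∀ i < n, s.nat aRow i = i * d
  tapeI_eq : ∀ q, s.nat aTapeI q = (A q).1
  tapeG_eq : ∀ q, s.nat aTapeG q = (A q).2
  pts_eq : ∀ i < n, ∀ t < d, s.real 0 (i * d + t) = coord (pts p i) t
  ε_eq : s.real 1 0 = ε
  γ_eq : s.real 1 1 = γ

/-- The command does not write to the fixed data. -/
def Safe (c : Cmd) : Prop :=
  (∀ a < 15, c.writesNat a = false) ∧ ∀ a < 2, c.writesReal a = false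

instance (c : Cmd) : Decidable (Safe c) := inferInstanceAs (Decidable (_ ∧ _))

/-! ### Correctness and cost of the vector subroutines. -/

section

variable {n d E k j N : ℕ} {ε γ : ℝ} {p : Fin n → EuclideanSpace ℝ (Fin d)} {A : ℕ → ℕ × ℕ}

theorem Base.frame {c : Cmd} {s s' : Store} (h : Base E k j N ε γ p A s) (hf : Frame c s s')
    (hc : Safe c) : Base E k j N ε γ p A s' := by
  have hn : ∀ a < 15, s'.nat a = s.nat a := fun a ha => hf.nat a (hc.1 a ha)
  have hr : ∀ a < 2, s'.real a = s.real a := fun a ha => hf.real a (hc.2 a ha)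
  constructor
  · rw [hn 0 (by norm_num)]; exact h.n_eq
  · rw [hn 0 (by norm_num)]; exact h.d_eq
  · rw [hn 0 (by norm_num)]; exact h.k_eq
  · rw [hn 0 (by norm_num)]; exact h.j_eq
  · rw [hn _ (by norm_num)]; exact h.size_eq
  · rw [hn _ (by norm_num)]; exact h.G_eq
  · rw [hn _ (by norm_num)]; exact h.N_eq
  · rw [hn _ (by norm_num)]; exact h.row_eq
  · rw [hn _ (by norm_num)]; exact h.tapeI_eq
  · rw [hn _ (by norm_num)]; exact h.tapeG_eq
  · rw [hr _ (by norm_num)]; exact h.pts_eq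
  · rw [hr _ (by norm_num)]; exact h.ε_eq
  · rw [hr _ (by norm_num)]; exact h.γ_eq

theorem gatherCmd_ends {s : Store} (hb : Base E k j N ε γ p A s) {y : RExp} {P : ℕ}
    (hP : s.nat aPos 0 = P) (hA : ∀ r < sampleSize E, (A (P + r)).1 < n)
    (z : EuclideanSpace ℝ (Fin d))
    (hy : ∀ t < d, ∀ s', Frame (gatherCmd y) s s' → s'.nat vQ 0 = t → y.eval s' = coord z t) :
    Ends (gatherCmd y) s (d * (4 * sampleSize E + 8) + 3) fun s' =>
      VecAt s' rVec 0 (∑ r ∈ Finset.range (sampleSize E), coef (coefBound E) (A (P + r)) •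
        (pts p (A (P + r)).1 - z)) := by
  set V := ∑ r ∈ Finset.range (sampleSize E), coef (coefBound E) (A (P + r)) •
        (pts p (A (P + r)).1 - z) with hV
  refine (Ends.forLoop (n := d) (b := 4 * sampleSize E + 5)
    (fun t s' => ∀ u < t, s'.real rVec u = coord V u) rfl ?_ ?_ ?_ ?_ (by ring_nf; omega)).mono
    le_rfl fun s' _ h t ht => by rw [zero_add]; exact h t ht
  · intro i s₁ s₂ h _ hr; rw [hr]; exact h
  · intro i s' hf _
    simp only [NExp.eval]; rw [hf.nat 0 rfl]; exact hb.d_eq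
  · intro u hu; omega
  · intro t ht s' hf hq h
    refine (Ends.setReal _ _ _ _).seq (B₂ := 4 * sampleSize E + 3) (fun s₁ hf₁ h₁ => ?_) (by omega)
    have hf01 : Frame (gatherCmd y) s s₁ := hf.trans (hf₁.weaken (fun _ _ => rfl) fun a ha => by
      simp only [Cmd.writesReal, Bool.or_eq_false_iff] at ha ⊢; exact ha.2.1.1)
    refine (Ends.accumulate (n := sampleSize E) (i₀ := t)
      (fun r => coef (coefBound E) (A (P + r)) * (coord (pts p (A (P + r)).1) t - coord z t))
      ?_ ?_ ?_ le_rfl).mono le_rfl fun s₂ hf₂ h₂ => ?_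
    · intro s₂ hf₂
      simp only [NExp.eval]
      rw [hf₂.nat _ rfl, hf₁.nat _ rfl, hf.nat _ rfl]; exact hb.size_eq
    · intro s₂ hf₂
      simp only [NExp.eval]
      rw [hf₂.nat _ rfl, hf₁.nat _ rfl]; exact hq
    · intro r hr s₂ hf₂ hr'
      have hf02 : Frame (gatherCmd y) s s₂ := hf01.trans (hf₂.weaken (fun a ha => by
        simp only [Cmd.writesNat, Bool.or_eq_false_iff] at ha ⊢; exact ha.2.1.2) fun a ha => by
        simp only [Cmd.writesReal, Bool.or_eq_false_iff] at ha ⊢; exact ha.2.1.2)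
      have hq₂ : s₂.nat vQ 0 = t := by rw [hf₂.nat _ rfl, hf₁.nat _ rfl]; exact hq
      simp only [RExp.eval, NExp.eval, hy t ht s₂ hf02 hq₂, hr', hq₂]
      rw [hf02.nat aPos rfl, hf02.nat aTapeG rfl, hf02.nat aG rfl, hf02.nat aTapeI rfl,
        hf02.nat aRow rfl, hf02.real 0 rfl, hP, hb.tapeG_eq, hb.tapeI_eq, hb.G_eq,
        hb.row_eq _ (hA r hr), hb.pts_eq _ (hA r hr) t ht]
      rfl
    · intro u hu
      have hz : s₁.real rVec t = 0 := by rw [h₁]; simp [NExp.eval, RExp.eval, hq]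
      rw [h₂]
      rcases Nat.lt_succ_iff_lt_or_eq.1 hu with hu | rfl
      · rw [Function.update_of_ne (by omega), h₁]
        simp only [NExp.eval, hq]
        rw [Function.update_of_ne (by omega), h u hu]
      · rw [Function.update_self, hz, zero_add, hV, coord_sum]
        exact Finset.sum_congr rfl fun r _ => by rw [coord_smul, coord_sub]

/-- No hypothesis `u ≠ 0` is needed: division on the machine and in `resid` is the same total
operation. -/
theorem projectCmd_ends {s : Store} (hb : Base E k j N ε γ p A s) {O : ℕ} (hO : s.nat aO 0 = O)
    {u v : EuclideanSpace ℝ (Fin d)} (hu : VecAt s rCand O u) (hv : VecAt s rVec 0 v) :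
    Ends projectCmd s (12 * d + 15) fun s' =>
      VecAt s' rVec 0 (v - (inner ℝ u v / inner ℝ u u) • u) := by
  refine (Ends.setReal _ _ _ _).seq (B₂ := 12 * d + 13) (fun s₁ hf₁ h₁ => ?_) (by omega)
  refine (Ends.setReal _ _ _ _).seq (B₂ := 12 * d + 11) (fun s₂ hf₂ h₂ => ?_) (by omega)
  have hb₂ := (hb.frame hf₁ (by decide)).frame hf₂ (by decide)
  have hO₂ : s₂.nat aO 0 = O := by rw [hf₂.nat _ rfl, hf₁.nat _ rfl, hO]
  have hu₂ : VecAt s₂ rCand O u := hu.congr (by rw [hf₂.real _ rfl, hf₁.real _ rfl])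
  have hv₂ : VecAt s₂ rVec 0 v := hv.congr (by rw [hf₂.real _ rfl, hf₁.real _ rfl])
  have hdot₂ : s₂.real rDot 0 = 0 := by
    rw [hf₂.real _ rfl, h₁]; simp [NExp.eval, RExp.eval]
  have hsq₂ : s₂.real rSq 0 = 0 := by rw [h₂]; simp [NExp.eval, RExp.eval]
  refine (Ends.accumulate (n := d) (i₀ := 0) (fun t => coord u t * coord v t)
    ?_ (fun _ _ => rfl) ?_ le_rfl).seq (B₂ := 8 * d + 7) (fun s₃ hf₃ h₃ => ?_) (by omega)
  · intro s' hf; simp only [NExp.eval]; rw [hf.nat 0 rfl, hb₂.d_eq]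
  · intro t ht s' hf hq
    simp only [RExp.eval, NExp.eval, hq]
    have := hv₂ t ht
    rw [zero_add] at this
    rw [hf.nat aO rfl, hf.real rCand rfl, hf.real rVec rfl, hO₂, hu₂ t ht, this]
  have hb₃ := hb₂.frame hf₃ (by decide)
  have hO₃ : s₃.nat aO 0 = O := by rw [hf₃.nat _ rfl, hO₂]
  have hu₃ : VecAt s₃ rCand O u := hu₂.congr (hf₃.real _ rfl)
  have hv₃ : VecAt s₃ rVec 0 v := hv₂.congr (hf₃.real _ rfl)
  have hdot₃ : s₃.real rDot 0 = inner ℝ u v := by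
    rw [h₃, hdot₂, inner_eq_sum_coord]; simp
  have hsq₃ : s₃.real rSq 0 = 0 := by rw [hf₃.real _ rfl, hsq₂]
  refine (Ends.accumulate (n := d) (i₀ := 0) (fun t => coord u t * coord u t)
    ?_ (fun _ _ => rfl) ?_ le_rfl).seq (B₂ := 4 * d + 3) (fun s₄ hf₄ h₄ => ?_) (by omega)
  · intro s' hf; simp only [NExp.eval]; rw [hf.nat 0 rfl, hb₃.d_eq]
  · intro t ht s' hf hq
    simp only [RExp.eval, NExp.eval, hq]
    rw [hf.nat aO rfl, hf.real rCand rfl, hO₃, hu₃ t ht]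
  have hb₄ := hb₃.frame hf₄ (by decide)
  have hO₄ : s₄.nat aO 0 = O := by rw [hf₄.nat _ rfl, hO₃]
  have hu₄ : VecAt s₄ rCand O u := hu₃.congr (hf₄.real _ rfl)
  have hv₄ : VecAt s₄ rVec 0 v := hv₃.congr (hf₄.real _ rfl)
  have hdot₄ : s₄.real rDot 0 = inner ℝ u v := by rw [hf₄.real _ rfl, hdot₃]
  have hsq₄ : s₄.real rSq 0 = inner ℝ u u := by
    rw [h₄, hsq₃, inner_eq_sum_coord]; simp
  refine (Ends.fill (n := d) (i₀ := 0)
    (fun t => coord (v - (inner ℝ u v / inner ℝ u u) • u) t) ?_ ?_ le_rfl).mono le_rfl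
    fun s₅ _ h₅ => h₅.1
  · intro s' hf; simp only [NExp.eval]; rw [hf.nat 0 rfl, hb₄.d_eq]
  · intro t ht s' hf hq hun
    have h := hv₄ t ht
    rw [zero_add] at hun h
    refine ⟨by simp [NExp.eval, hq], ?_⟩
    simp only [RExp.eval, NExp.eval, hq]
    rw [hun, h, hf.nat aO rfl, hf.real rCand rfl, hf.real rDot rfl, hf.real rSq rfl, hO₄,
      hu₄ t ht, hdot₄, hsq₄, coord_sub, coord_smul]

/-- The final address is recorded because the evaluation uses it to move on to the next flat without
a multiplication. -/
theorem residCmd_ends {s : Store} (hb : Base E k j N ε γ p A s) {cnt : NExp} {l CB : ℕ}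
    (hcnt : ∀ s', Frame (residCmd cnt) s s' → cnt.eval s' = l) (hCB : s.nat aCb 0 = CB)
    {b : ℕ → EuclideanSpace ℝ (Fin d)} (hbs : ∀ r < l, VecAt s rCand (CB + (r + 1) * d) (b r))
    {v : EuclideanSpace ℝ (Fin d)} (hv : VecAt s rVec 0 v) :
    Ends (residCmd cnt) s (l * (12 * d + 20) + 5) fun s' =>
      VecAt s' rVec 0 (resid b l v) ∧ s'.nat aO 0 = CB + l * d := by
  refine (Ends.setNat _ _ _ _).seq (B₂ := l * (12 * d + 20) + 3) (fun s₁ hf₁ h₁ => ?_) (by omega)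
  have hfw : ∀ {s'}, Frame (forLoop vS cnt (.seq (assign aO (.add (var aO) eD)) projectCmd)) s₁ s' →
      Frame (residCmd cnt) s s' := fun hf => Frame.trans
    (hf₁.weaken (fun a ha => by
      simp only [Cmd.writesNat, Bool.or_eq_false_iff] at ha ⊢; exact ha.1) (fun _ _ => rfl))
    (hf.weaken (fun a ha => by
      simp only [Cmd.writesNat, Bool.or_eq_false_iff] at ha ⊢; exact ha.2) (fun a ha => by
      simp only [Cmd.writesReal, Bool.or_eq_false_iff] at ha ⊢; exact ha.2))
  refine Ends.forLoop (n := l) (b := 12 * d + 17)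
    (fun i s' => VecAt s' rVec 0 (resid b i v) ∧ s'.nat aO 0 = CB + i * d) rfl ?_ ?_ ?_ ?_
    le_rfl
  · intro i s₂ s₃ h hn hr
    exact ⟨h.1.congr (by rw [hr]), by rw [hn _ (by decide)]; exact h.2⟩
  · intro i s' hf _
    exact hcnt s' (hfw hf)
  · refine ⟨hv.congr (hf₁.real _ rfl), ?_⟩
    rw [h₁]; simp [NExp.eval, hCB]
  · intro i hi s' hf _ h
    have hb' := (hb.frame hf₁ (by decide)).frame hf
      (show Safe (forLoop vS (.const 0) (.seq (assign aO (.add (var aO) eD)) projectCmd)) by decide)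
    refine (Ends.setNat _ _ _ _).seq (B₂ := 12 * d + 15) (fun s₂ hf₂ h₂ => ?_) (by omega)
    have hb₂ := hb'.frame hf₂ (by decide)
    have hO : s₂.nat aO 0 = CB + (i + 1) * d := by
      rw [h₂]; simp [NExp.eval, hb'.d_eq, h.2]; ring
    have hu : VecAt s₂ rCand (CB + (i + 1) * d) (b i) := (hbs i hi).congr
      (by rw [hf₂.real _ rfl, hf.real _ rfl, hf₁.real _ rfl])
    refine (projectCmd_ends hb₂ hO hu (h.1.congr (hf₂.real _ rfl))).mono le_rfl
      fun s₃ hf₃ h₃ => ⟨h₃, ?_⟩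
    rw [hf₃.nat _ rfl, hO]

theorem normCmd_ends {s : Store} (hb : Base E k j N ε γ p A s)
    {v : EuclideanSpace ℝ (Fin d)} (hv : VecAt s rVec 0 v) :
    Ends normCmd s (4 * d + 5) fun s' => s'.real rNorm 0 = ‖v‖ ^ 2 := by
  refine (Ends.setReal _ _ _ _).seq (B₂ := 4 * d + 3) (fun s₁ hf₁ h₁ => ?_) (by omega)
  refine (Ends.accumulate (n := d) (i₀ := 0) (fun t => coord v t * coord v t)
    ?_ (fun _ _ => rfl) ?_ le_rfl).mono le_rfl fun s₂ hf₂ h₂ => ?_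
  · intro s' hf; simp only [NExp.eval]; rw [hf.nat 0 rfl, hf₁.nat 0 rfl, hb.d_eq]
  · intro t ht s' hf hq
    have := hv t ht
    rw [zero_add] at this
    simp only [RExp.eval, NExp.eval, hq]
    rw [hf.real rVec rfl, hf₁.real rVec rfl, this]
  · rw [h₂, h₁, norm_sq_eq_sum_coord]; simp [NExp.eval, RExp.eval]

theorem stdCmd_ends {s : Store} (hb : Base E k j N ε γ p A s) {r : ℕ} (hr : s.nat vPick 0 = r) :
    Ends stdCmd s (4 * d + 5) fun s' => VecAt s' rVec 0 (stdVec d r) := by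
  refine (Ends.fill (n := d) (i₀ := 0) (fun _ => 0) ?_ ?_ le_rfl).seq (B₂ := 1)
    (fun s₁ hf₁ h₁ => ?_) (by omega)
  · intro s' hf; simp only [NExp.eval]; rw [hf.nat 0 rfl, hb.d_eq]
  · intro t ht s' hf hq _
    simp [NExp.eval, RExp.eval, hq]
  · refine (Ends.setReal _ _ _ _).mono le_rfl fun s₂ hf₂ h₂ t ht => ?_
    have h3 := h₁.1 t ht
    rw [zero_add] at h3 ⊢
    rw [h₂, coord_stdVec ht]
    simp only [NExp.eval, RExp.eval, hf₁.nat vPick rfl, hr]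
    rcases eq_or_ne t r with rfl | hne
    · simp
    · rw [Function.update_of_ne hne, h3, if_neg hne]

/-- A residue vanishes exactly when its squared norm is not positive. Exact comparison of reals thus
decides the case distinction in `pick`. -/
theorem pickCmd_ends {s : Store} (hb : Base E k j N ε γ p A s) {l CB : ℕ} (hl : l ≤ j)
    (hcnt : s.nat vDir 0 = l) (hCB : s.nat aCb 0 = CB)
    {b : ℕ → EuclideanSpace ℝ (Fin d)} (hbs : ∀ r < l, VecAt s rCand (CB + (r + 1) * d) (b r))
    {u : EuclideanSpace ℝ (Fin d)} (hv : VecAt s rVec 0 (resid b l u))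
    (hn : s.real rNorm 0 = ‖resid b l u‖ ^ 2) :
    Ends pickCmd s (j * (j * (12 * d + 20) + 8 * d + 21) + 3) fun s' =>
      VecAt s' rVec 0 (pick (stdVec d) b l u j) := by
  refine (Ends.forLoop (n := j) (b := j * (12 * d + 20) + 8 * d + 18)
    (fun i s' => VecAt s' rVec 0 (pick (stdVec d) b l u i) ∧
      s'.real rNorm 0 = ‖pick (stdVec d) b l u i‖ ^ 2) rfl ?_ ?_ ⟨hv, hn⟩ ?_ le_rfl).mono
    le_rfl fun _ _ h => h.1
  · intro i s₂ s₃ h _ hr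
    exact ⟨h.1.congr (by rw [hr]), by rw [hr]; exact h.2⟩
  · intro i s' hf _; simp only [NExp.eval]; rw [hf.nat 0 rfl, hb.j_eq]
  · intro i hi s' hf hp h
    have hb' := hb.frame hf (by decide)
    have hpos : Test.Holds s' (.realLT (.ofNat (.const 0)) (rvar rNorm)) ↔
        pick (stdVec d) b l u i ≠ 0 := by
      simp only [Test.Holds, RExp.eval, NExp.eval, h.2, Nat.cast_zero]
      rw [sq_pos_iff, norm_ne_zero_iff]
    refine Ends.cond (B₁ := j * (12 * d + 20) + 8 * d + 17) (fun ht => ?_) (fun ht => ?_) (by omega)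
    · refine (Ends.setNat _ _ _ _).mono (by omega) fun s₁ hf₁ _ => ?_
      have hne := hpos.1 ht
      simp only [pick, if_neg hne]
      exact ⟨h.1.congr (hf₁.real _ rfl), by rw [hf₁.real _ rfl]; exact h.2⟩
    · have hz : pick (stdVec d) b l u i = 0 := by
        by_contra hne; exact ht (hpos.2 hne)
      simp only [pick, if_pos hz]
      refine (stdCmd_ends hb' hp).seq (B₂ := j * (12 * d + 20) + 4 * d + 11)
        (fun s₁ hf₁ h₁ => ?_) (by omega)
      have hb₁ := hb'.frame hf₁ (by decide)
      have hlj : l * (12 * d + 20) ≤ j * (12 * d + 20) := Nat.mul_le_mul_right _ hl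
      refine (residCmd_ends (l := l) (CB := CB) (b := b) hb₁ ?_ ?_ ?_ h₁).seq (B₂ := 4 * d + 5)
        (fun s₂ hf₂ h₂ => ?_) (by omega)
      · intro s'' hf''
        simp only [NExp.eval]
        rw [hf''.nat _ rfl, hf₁.nat _ rfl, hf.nat _ rfl, hcnt]
      · rw [hf₁.nat _ rfl, hf.nat _ rfl, hCB]
      · intro r hr
        exact (hbs r hr).congr (by rw [hf₁.real _ rfl, hf.real _ rfl])
      · refine (normCmd_ends (hb₁.frame hf₂ (by decide)) h₂.1).mono le_rfl
          fun s₃ hf₃ h₃ => ⟨h₂.1.congr (hf₃.real _ rfl), h₃⟩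

theorem storeCmd_ends {s : Store} (hb : Base E k j N ε γ p A s) {O P : ℕ}
    (hO : s.nat aOff 0 = O) (hP : s.nat aPos 0 = P) {v : EuclideanSpace ℝ (Fin d)}
    (hv : VecAt s rVec 0 v) :
    Ends storeCmd s (4 * d + 7) fun s' => VecAt s' rCand O v ∧
      (∀ q < O, s'.real rCand q = s.real rCand q) ∧ s'.nat aOff 0 = O + d ∧
      s'.nat aPos 0 = P + sampleSize E := by
  refine (Ends.fill (n := d) (i₀ := O) (fun t => coord v t) ?_ ?_ le_rfl).seq (B₂ := 3)
    (fun s₁ hf₁ h₁ => ?_) (by omega)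
  · intro s' hf; simp only [NExp.eval]; rw [hf.nat 0 rfl, hb.d_eq]
  · intro t ht s' hf hq _
    have := hv t ht
    rw [zero_add] at this
    simp only [NExp.eval, RExp.eval, hq]
    rw [hf.nat _ rfl, hf.real rVec rfl, this, hO]
    exact ⟨rfl, rfl⟩
  · refine (Ends.setNat _ _ _ _).seq (B₂ := 1) (fun s₂ hf₂ h₂ => ?_) (by omega)
    refine (Ends.setNat _ _ _ _).mono le_rfl fun s₃ hf₃ h₃ => ⟨?_, ?_, ?_, ?_⟩
    · intro t ht
      rw [hf₃.real _ rfl, hf₂.real _ rfl]; exact h₁.1 t ht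
    · intro q hq
      rw [hf₃.real _ rfl, hf₂.real _ rfl]; exact h₁.2 q (Or.inl hq)
    · rw [hf₃.nat _ rfl, h₂]
      simp [NExp.eval, hf₁.nat aOff rfl, hf₁.nat 0 rfl, hO, hb.d_eq]
    · rw [h₃]
      simp [NExp.eval, hf₂.nat aPos rfl, hf₁.nat aPos rfl, hf₂.nat aSize rfl, hf₁.nat aSize rfl, hP,
        hb.size_eq]

end

end ProjectiveClustering

/-! ### Assembling centres and directions into flats. -/

namespace ProjectiveClustering

open RealRAM

/-- The weighted mean of the points in the current block of the tape. -/
abbrev centreCmd : Cmd :=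
  .seq (rassign rSum (.ofNat (.const 0)))
    (.seq (forLoop vR (var aSize) (rassign rSum (.add (rvar rSum) coefE)))
    (.seq (gatherCmd (.ofNat (.const 0)))
      (forLoop vQ eD (.setReal rVec (var vQ) (.div (.get rVec (var vQ)) (rvar rSum))))))

/-- The next direction of the current flat. -/
abbrev dirCmd : Cmd :=
  .seq (gatherCmd (candE aCb)) (.seq (residCmd (var vDir)) (.seq normCmd (.seq pickCmd storeCmd)))

/-- The next flat of the candidate. -/
abbrev clusterCmd : Cmd :=
  .seq (assign aCb (var aOff)) (.seq centreCmd (.seq storeCmd (forLoop vDir eJ dirCmd)))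

/-- All the flats of the candidate. -/
abbrev flatsCmd : Cmd := .seq (assign aOff (.const 0)) (forLoop vC eK clusterCmd)

/-- The array `a` holds, from the entry `O` on, the flat computed from the draws at the
position `P`. -/
def FlatAt {n d : ℕ} (E j : ℕ) (p : Fin n → EuclideanSpace ℝ (Fin d)) (A : ℕ → ℕ × ℕ) (s : Store)
    (a O P : ℕ) : Prop :=
  VecAt s a O (flatCentre E p A P) ∧ ∀ r < j, VecAt s a (O + (r + 1) * d) (flatBasis E j p A P r)

/-- Bounds for the numbers of steps, in terms of the dimension, the sample size and `j`. -/
def dirTime (d m j : ℕ) : ℕ :=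
  d * (4 * m + 16) + j * (12 * d + 20) + j * (j * (12 * d + 20) + 8 * d + 21) + 27

def clusterTime (d m j : ℕ) : ℕ := d * (4 * m + 16) + 4 * m + 30 + j * (dirTime d m j + 3)

def flatsTime (d m j k : ℕ) : ℕ := k * (clusterTime d m j + 3) + 5

section

variable {n d E k j N : ℕ} {ε γ : ℝ} {p : Fin n → EuclideanSpace ℝ (Fin d)} {A : ℕ → ℕ × ℕ}

theorem VecAt.congr_of_lt {s s' : Store} {a i O : ℕ} {v : EuclideanSpace ℝ (Fin d)}
    (h : VecAt s a i v) (hs : ∀ q < O, s'.real a q = s.real a q) (hi : i + d ≤ O) :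
    VecAt s' a i v := fun t ht => by
  rw [hs _ (by omega)]; exact h t ht

theorem FlatAt.congr_of_lt {s s' : Store} {a P i O : ℕ} (h : FlatAt E j p A s a i P)
    (hs : ∀ q < O, s'.real a q = s.real a q) (hi : i + (j + 1) * d ≤ O) :
    FlatAt E j p A s' a i P := by
  refine ⟨h.1.congr_of_lt hs (le_trans ?_ hi), fun r hr => (h.2 r hr).congr_of_lt hs (le_trans ?_ hi)⟩
  · have : 1 * d ≤ (j + 1) * d := Nat.mul_le_mul_right _ (by omega)
    omega
  · have : (r + 1) * d + d = (r + 2) * d := by ring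
    have : (r + 2) * d ≤ (j + 1) * d := Nat.mul_le_mul_right _ (by omega)
    omega

theorem FlatAt.congr {s s' : Store} {a P i : ℕ} (h : FlatAt E j p A s a i P)
    (hs : s'.real a = s.real a) : FlatAt E j p A s' a i P :=
  ⟨h.1.congr hs, fun r hr => (h.2 r hr).congr hs⟩

theorem centreCmd_ends {s : Store} (hb : Base E k j N ε γ p A s) {P : ℕ}
    (hP : s.nat aPos 0 = P) (hA : ∀ r < sampleSize E, (A (P + r)).1 < n) :
    Ends centreCmd s (d * (4 * sampleSize E + 12) + 4 * sampleSize E + 13) fun s' =>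
      VecAt s' rVec 0 (flatCentre E p A P) := by
  refine (Ends.setReal _ _ _ _).seq (B₂ := d * (4 * sampleSize E + 12) + 4 * sampleSize E + 11)
    (fun s₁ hf₁ h₁ => ?_) (by linarith)
  have hb₁ := hb.frame hf₁ (by decide)
  refine (Ends.accumulate (n := sampleSize E) (i₀ := 0) (fun r => coef (coefBound E) (A (P + r)))
    ?_ (fun _ _ => rfl) ?_ le_rfl).seq (B₂ := d * (4 * sampleSize E + 12) + 7)
    (fun s₂ hf₂ h₂ => ?_) (by linarith)
  · intro s' hf; simp only [NExp.eval]; rw [hf.nat _ rfl, hb₁.size_eq]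
  · intro r hr s' hf hr'
    simp only [RExp.eval, NExp.eval, hr']
    rw [hf.nat aPos rfl, hf₁.nat aPos rfl, hf.nat aTapeG rfl, hf.nat aG rfl, hP, hb₁.tapeG_eq,
      hb₁.G_eq]
    rfl
  have hb₂ := hb₁.frame hf₂ (by decide)
  have hsum : s₂.real rSum 0 = ∑ r ∈ Finset.range (sampleSize E), coef (coefBound E) (A (P + r)) := by
    rw [h₂, h₁]; simp [NExp.eval, RExp.eval]
  refine (gatherCmd_ends hb₂ (P := P) (by rw [hf₂.nat _ rfl, hf₁.nat _ rfl, hP]) hA 0 ?_).seq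
    (B₂ := 4 * d + 3) (fun s₃ hf₃ h₃ => ?_) (by linarith)
  · intro t ht s' _ _; simp [RExp.eval, NExp.eval, coord_zero]
  simp only [sub_zero] at h₃
  refine (Ends.fill (n := d) (i₀ := 0) (fun t => coord (flatCentre E p A P) t) ?_ ?_ le_rfl).mono
    le_rfl fun s₄ _ h₄ => h₄.1
  · intro s' hf; simp only [NExp.eval]; rw [hf.nat 0 rfl, hf₃.nat 0 rfl, hb₂.d_eq]
  · intro t ht s' hf hq hun
    have h := h₃ t ht
    rw [zero_add] at hun h
    refine ⟨by simp [NExp.eval, hq], ?_⟩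
    simp only [RExp.eval, NExp.eval, hq]
    rw [hun, h, hf.real rSum rfl, hf₃.real rSum rfl, hsum, flatCentre, centre, coord_smul, div_eq_inv_mul]

theorem dirCmd_ends {s : Store} (hb : Base E k j N ε γ p A s) {P CB l : ℕ} (hl : l < j)
    (hdir : s.nat vDir 0 = l) (hCB : s.nat aCb 0 = CB) (hO : s.nat aOff 0 = CB + (l + 1) * d)
    (hP : s.nat aPos 0 = P + (l + 1) * sampleSize E)
    (hA : ∀ r < sampleSize E, (A (P + (l + 1) * sampleSize E + r)).1 < n)
    (hc : VecAt s rCand CB (flatCentre E p A P))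
    {b : ℕ → EuclideanSpace ℝ (Fin d)} (hbs : ∀ r < l, VecAt s rCand (CB + (r + 1) * d) (b r)) :
    Ends dirCmd s (dirTime d (sampleSize E) j) fun s' =>
      VecAt s' rCand (CB + (l + 1) * d) (pick (stdVec d) b l
        (dirVec (coefBound E) (sampleSize E) (pts p) A P l) j) ∧
      (∀ q < CB + (l + 1) * d, s'.real rCand q = s.real rCand q) ∧
      s'.nat aOff 0 = CB + (l + 2) * d ∧ s'.nat aPos 0 = P + (l + 2) * sampleSize E := by
  have hlj : l * (12 * d + 20) ≤ j * (12 * d + 20) := Nat.mul_le_mul_right _ hl.le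
  refine (gatherCmd_ends hb hP hA (flatCentre E p A P) ?_).seq
    (B₂ := 8 * d + j * (12 * d + 20) + j * (j * (12 * d + 20) + 8 * d + 21) + 23)
    (fun s₁ hf₁ h₁ => ?_) (by unfold dirTime; linarith)
  · intro t ht s' hf hq
    simp only [RExp.eval, NExp.eval, hq]
    rw [hf.nat aCb rfl, hf.real rCand rfl, hCB, hc t ht]
  have hb₁ := hb.frame hf₁ (by decide)
  refine (residCmd_ends (l := l) (CB := CB) (b := b) hb₁ ?_ ?_ ?_ h₁).seq
    (B₂ := 8 * d + j * (j * (12 * d + 20) + 8 * d + 21) + 17) (fun s₂ hf₂ h₂ => ?_) (by linarith)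
  · intro s' hf; simp only [NExp.eval]; rw [hf.nat _ rfl, hf₁.nat _ rfl, hdir]
  · rw [hf₁.nat _ rfl, hCB]
  · intro r hr; exact (hbs r hr).congr (hf₁.real _ rfl)
  have hb₂ := hb₁.frame hf₂ (by decide)
  refine (normCmd_ends hb₂ h₂.1).seq
    (B₂ := 4 * d + j * (j * (12 * d + 20) + 8 * d + 21) + 11) (fun s₃ hf₃ h₃ => ?_) (by linarith)
  have hb₃ := hb₂.frame hf₃ (by decide)
  refine (pickCmd_ends (l := l) (CB := CB) (b := b) hb₃ hl.le ?_ ?_ ?_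
    (h₂.1.congr (hf₃.real _ rfl)) h₃).seq (B₂ := 4 * d + 7) (fun s₄ hf₄ h₄ => ?_) (by linarith)
  · rw [hf₃.nat _ rfl, hf₂.nat _ rfl, hf₁.nat _ rfl, hdir]
  · rw [hf₃.nat _ rfl, hf₂.nat _ rfl, hf₁.nat _ rfl, hCB]
  · intro r hr
    exact (hbs r hr).congr (by rw [hf₃.real _ rfl, hf₂.real _ rfl, hf₁.real _ rfl])
  have hb₄ := hb₃.frame hf₄ (by decide)
  refine (storeCmd_ends hb₄ (O := CB + (l + 1) * d) (P := P + (l + 1) * sampleSize E) ?_ ?_ h₄).mono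
    le_rfl fun s₅ hf₅ h₅ => ⟨h₅.1, fun q hq => ?_, ?_, ?_⟩
  · rw [hf₄.nat _ rfl, hf₃.nat _ rfl, hf₂.nat _ rfl, hf₁.nat _ rfl, hO]
  · rw [hf₄.nat _ rfl, hf₃.nat _ rfl, hf₂.nat _ rfl, hf₁.nat _ rfl, hP]
  · rw [h₅.2.1 q hq, hf₄.real _ rfl, hf₃.real _ rfl, hf₂.real _ rfl, hf₁.real _ rfl]
  · rw [h₅.2.2.1]; ring
  · rw [h₅.2.2.2]; ring

theorem clusterCmd_ends {s : Store} (hb : Base E k j N ε γ p A s) {P O : ℕ}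
    (hO : s.nat aOff 0 = O) (hP : s.nat aPos 0 = P)
    (hA : ∀ q, P ≤ q → q < P + (j + 1) * sampleSize E → (A q).1 < n) :
    Ends clusterCmd s (clusterTime d (sampleSize E) j) fun s' =>
      FlatAt E j p A s' rCand O P ∧ (∀ q < O, s'.real rCand q = s.real rCand q) ∧
      s'.nat aOff 0 = O + (j + 1) * d ∧ s'.nat aPos 0 = P + (j + 1) * sampleSize E := by
  have hm : ∀ l ≤ j, (l + 1) * sampleSize E ≤ (j + 1) * sampleSize E := fun l hl =>
    Nat.mul_le_mul_right _ (by omega)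
  refine (Ends.setNat _ _ _ _).seq (B₂ := d * (4 * sampleSize E + 16) + 4 * sampleSize E + 26 +
    j * (dirTime d (sampleSize E) j + 3)) (fun s₁ hf₁ h₁ => ?_) (by unfold clusterTime; linarith)
  have hb₁ := hb.frame hf₁ (by decide)
  have hCB₁ : s₁.nat aCb 0 = O := by rw [h₁]; simp [NExp.eval, hO]
  refine (centreCmd_ends hb₁ (P := P) (by rw [hf₁.nat _ rfl, hP]) fun r hr =>
    hA _ (by omega) (by have := hm 0 (by omega); omega)).seq
    (B₂ := 4 * d + 12 + j * (dirTime d (sampleSize E) j + 3)) (fun s₂ hf₂ h₂ => ?_) (by linarith)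
  have hb₂ := hb₁.frame hf₂ (by decide)
  refine (storeCmd_ends hb₂ (O := O) (P := P) (by rw [hf₂.nat _ rfl, hf₁.nat _ rfl, hO])
    (by rw [hf₂.nat _ rfl, hf₁.nat _ rfl, hP]) h₂).seq
    (B₂ := 3 + j * (dirTime d (sampleSize E) j + 3)) (fun s₃ hf₃ h₃ => ?_) (by linarith)
  have hb₃ := hb₂.frame hf₃ (by decide)
  have hCB₃ : s₃.nat aCb 0 = O := by rw [hf₃.nat _ rfl, hf₂.nat _ rfl, hCB₁]
  have hs₃ : ∀ q < O, s₃.real rCand q = s.real rCand q := fun q hq => by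
    rw [h₃.2.1 q hq, hf₂.real _ rfl, hf₁.real _ rfl]
  set g := gramSchmidtPick (stdVec d) j (dirVec (coefBound E) (sampleSize E) (pts p) A P) with hg
  refine (Ends.forLoop (n := j) (b := dirTime d (sampleSize E) j)
    (fun l s' => (VecAt s' rCand O (flatCentre E p A P) ∧
      ∀ r < l, VecAt s' rCand (O + (r + 1) * d) (g l r)) ∧
      (∀ q < O, s'.real rCand q = s.real rCand q) ∧
      s'.nat aOff 0 = O + (l + 1) * d ∧ s'.nat aPos 0 = P + (l + 1) * sampleSize E)
    rfl ?_ ?_ ?_ ?_ (by linarith)).mono le_rfl fun s' _ h => h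
  · intro l s' s'' h hn hr
    rw [hn aOff (by decide), hn aPos (by decide)]
    refine ⟨⟨h.1.1.congr (by rw [hr]), fun r hr' => (h.1.2 r hr').congr (by rw [hr])⟩, ?_, h.2.2⟩
    rw [hr]; exact h.2.1
  · intro l s' hf _; simp only [NExp.eval]; rw [hf.nat 0 rfl, hb₃.j_eq]
  · refine ⟨⟨h₃.1, fun r hr => by omega⟩, hs₃, ?_, ?_⟩
    · rw [h₃.2.2.1]; ring
    · rw [h₃.2.2.2]; ring
  · rintro l hl s' hf hdir ⟨⟨hc, hbs⟩, hun, hO', hP'⟩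
    have hb' := hb₃.frame hf (by decide)
    refine (dirCmd_ends hb' (P := P) (CB := O) (b := g l) hl hdir (by rw [hf.nat _ rfl, hCB₃]) hO' hP'
      (fun r hr => hA _ (by omega) ?_) hc hbs).mono le_rfl fun s'' _ h => ⟨⟨?_, fun r hr => ?_⟩, ?_, ?_⟩
    · have h5 := hm (l + 1) (by omega)
      have h6 : (l + 1 + 1) * sampleSize E = (l + 1) * sampleSize E + sampleSize E := by ring
      omega
    · refine hc.congr_of_lt h.2.1 ?_
      have : 1 * d ≤ (l + 1) * d := Nat.mul_le_mul_right _ (by omega)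
      omega
    · have hgs : g (l + 1) = Function.update (g l) l (pick (stdVec d) (g l) l
          (dirVec (coefBound E) (sampleSize E) (pts p) A P l) j) := rfl
      rw [hgs]
      rcases Nat.lt_succ_iff_lt_or_eq.1 hr with hr | rfl
      · rw [Function.update_of_ne (by omega)]
        refine (hbs r hr).congr_of_lt h.2.1 ?_
        have h5 : (r + 1) * d + d = (r + 1 + 1) * d := by ring
        have : (r + 1 + 1) * d ≤ (l + 1) * d := Nat.mul_le_mul_right _ (by omega)
        omega
      · rw [Function.update_self]; exact h.1
    · intro q hq
      rw [h.2.1 q (by omega), hun q hq]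
    · exact h.2.2

theorem flatsCmd_ends {s : Store} (hb : Base E k j N ε γ p A s) {P : ℕ} (hP : s.nat aPos 0 = P)
    (hA : ∀ q, P ≤ q → q < P + k * ((j + 1) * sampleSize E) → (A q).1 < n) :
    Ends flatsCmd s (flatsTime d (sampleSize E) j k) fun s' =>
      (∀ c < k, FlatAt E j p A s' rCand (c * ((j + 1) * d)) (P + c * ((j + 1) * sampleSize E))) ∧
      s'.nat aOff 0 = k * ((j + 1) * d) ∧ s'.nat aPos 0 = P + k * ((j + 1) * sampleSize E) := by
  refine (Ends.setNat _ _ _ _).seq (B₂ := k * (clusterTime d (sampleSize E) j + 3) + 3)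
    (fun s₁ hf₁ h₁ => ?_) (by unfold flatsTime; linarith)
  have hb₁ := hb.frame hf₁ (by decide)
  refine (Ends.forLoop (n := k) (b := clusterTime d (sampleSize E) j)
    (fun i s' => (∀ c < i, FlatAt E j p A s' rCand (c * ((j + 1) * d))
      (P + c * ((j + 1) * sampleSize E))) ∧
      s'.nat aOff 0 = i * ((j + 1) * d) ∧ s'.nat aPos 0 = P + i * ((j + 1) * sampleSize E))
    rfl ?_ ?_ ?_ ?_ le_rfl)
  · intro i s' s'' h hn hr
    rw [hn aOff (by decide), hn aPos (by decide)]
    exact ⟨fun c hc => (h.1 c hc).congr (by rw [hr]), h.2⟩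
  · intro i s' hf _; simp only [NExp.eval]; rw [hf.nat 0 rfl, hb₁.k_eq]
  · refine ⟨fun c hc => by omega, ?_, ?_⟩
    · rw [h₁]; simp [NExp.eval]
    · rw [hf₁.nat _ rfl, hP]; simp
  · rintro i hi s' hf hci ⟨hF, hO, hP'⟩
    have hb' := hb₁.frame hf (by decide)
    have h5 : (i + 1) * ((j + 1) * sampleSize E) ≤ k * ((j + 1) * sampleSize E) :=
      Nat.mul_le_mul_right _ (by omega)
    rw [Nat.succ_mul] at h5
    refine (clusterCmd_ends hb' hO hP' fun q h1 h2 => hA q (by omega) (by omega)).mono le_rfl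
      fun s'' _ h => ⟨fun c hc => ?_, ?_, ?_⟩
    · rcases Nat.lt_succ_iff_lt_or_eq.1 hc with hc | rfl
      · refine (hF c hc).congr_of_lt h.2.1 ?_
        have : (c + 1) * ((j + 1) * d) ≤ i * ((j + 1) * d) := Nat.mul_le_mul_right _ (by omega)
        rw [Nat.succ_mul] at this
        exact this
      · exact h.1
    · rw [h.2.2.1]; ring
    · rw [h.2.2.2]; ring

end

end ProjectiveClustering

/-! ### The program: evaluating the candidates -/

namespace ProjectiveClustering

open RealRAM

/-- The squared distance of the current point to the current flat. -/
abbrev distCmd : Cmd :=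
  .seq (forLoop vQ eD (.setReal rVec (var vQ)
      (.sub (.get 0 (.add (.get aRow (var vI)) (var vQ))) (candE aCb))))
    (.seq (residCmd eJ) normCmd)

/-- Update of the squared distance to the nearest flat. -/
abbrev minCmd : Cmd :=
  .cond (.and (.natLT (.const 0) (var vC)) (.not (.realLT (rvar rNorm) (.get rVal (var vI)))))
    skip (.setReal rVal (var vI) (rvar rNorm))

/-- The squared distances of the points to their nearest flats. -/
abbrev evalCmd : Cmd :=
  forLoop vI eN (.seq (assign aCb (.const 0))
    (forLoop vC eK (.seq distCmd (.seq minCmd (assign aCb (.add (var aO) eD))))))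

/-- The current point is kept. -/
abbrev keptTest : Test :=
  .not (.and (.not (.realLT (.get rVal (var vI)) (.get rVal (var aPiv))))
    (.not (.and (.not (.realLT (.get rVal (var aPiv)) (.get rVal (var vI))))
      (.not (.natLT (var aPiv) (var vI))))))

/-- The number of the points that are kept, and their cost. -/
abbrev pivotCmd : Cmd :=
  .seq (assign aPiv (.get aTapeI (var aPos))) (.seq (assign aCnt (.const 0))
    (.seq (rassign rTotal (.ofNat (.const 0)))
    (.seq (forLoop vI eN (.cond keptTest (.seq (assign aCnt (.add (var aCnt) (.const 1)))
        (rassign rTotal (.add (rvar rTotal) (.get rVal (var vI))))) skip))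
      (assign aPos (.add (var aPos) (.const 1))))))

/-- The candidate is better than the best one so far. -/
abbrev betterTest : Test :=
  .and (.not (.realLT (.ofNat (var aCnt))
      (.mul (.sub (.ofNat (.const 1)) (.get 1 (.const 1))) (.ofNat eN))))
    (.not (.and (.natLT (.const 0) (var aFlag))
      (.not (.realLT (.div (rvar rTotal) (.ofNat (var aCnt))) (rvar rBest)))))

/-- The candidate replaces the best one so far if it is better. -/
abbrev decideCmd : Cmd :=
  .cond betterTest (.seq (assign aFlag (.const 1))
    (.seq (rassign rBest (.div (rvar rTotal) (.ofNat (var aCnt))))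
      (forLoop vCopy (var aOff) (.setReal rOut (var vCopy) (.get rCand (var vCopy)))))) skip

abbrev trialCmd : Cmd := .seq flatsCmd (.seq evalCmd (.seq pivotCmd decideCmd))

abbrev searchCmd : Cmd :=
  .seq (assign aPos (.const 0)) (.seq (assign aFlag (.const 0)) (forLoop vTrial (var aN) trialCmd))

def distTime (d j : ℕ) : ℕ := 8 * d + j * (12 * d + 20) + 15

def evalTime (n d j k : ℕ) : ℕ := n * (k * (distTime d j + 9) + 8) + 3

def trialTime (n d m j k : ℕ) : ℕ :=
  flatsTime d m j k + evalTime n d j k + (n * 7 + 12) + (4 * (k * ((j + 1) * d)) + 8) + 3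

/-! ### Correctness and cost of evaluation, trimming and search. -/

section

variable {n d E k j N : ℕ} {ε γ : ℝ} {p : Fin n → EuclideanSpace ℝ (Fin d)} {A : ℕ → ℕ × ℕ}

theorem distCmd_ends {s : Store} (hb : Base E k j N ε γ p A s) {i O P : ℕ} (hi : i < n)
    (hvi : s.nat vI 0 = i) (hO : s.nat aCb 0 = O) (hF : FlatAt E j p A s rCand O P) :
    Ends distCmd s (distTime d j) fun s' =>
      s'.real rNorm 0 = flatCost E j p A P i ∧ s'.nat aO 0 = O + j * d := by
  refine (Ends.fill (n := d) (i₀ := 0) (fun t => coord (pts p i - flatCentre E p A P) t) ?_ ?_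
    le_rfl).seq (B₂ := 4 * d + j * (12 * d + 20) + 11) (fun s₁ hf₁ h₁ => ?_)
    (by unfold distTime; linarith)
  · intro s' hf; simp only [NExp.eval]; rw [hf.nat 0 rfl, hb.d_eq]
  · intro t ht s' hf hq _
    refine ⟨by simp [NExp.eval, hq], ?_⟩
    simp only [RExp.eval, NExp.eval, hq]
    rw [hf.nat aRow rfl, hf.nat vI rfl, hf.real 0 rfl, hf.nat aCb rfl, hf.real rCand rfl, hvi, hO,
      hb.row_eq i hi, hb.pts_eq i hi t ht, hF.1 t ht, coord_sub]
  have hb₁ := hb.frame hf₁ (by decide)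
  refine (residCmd_ends (l := j) (CB := O) (b := flatBasis E j p A P) hb₁ ?_ ?_ ?_ h₁.1).seq
    (B₂ := 4 * d + 5) (fun s₂ hf₂ h₂ => ?_) (by linarith)
  · intro s' hf; simp only [NExp.eval]; rw [hf.nat 0 rfl, hb₁.j_eq]
  · rw [hf₁.nat _ rfl, hO]
  · intro r hr; exact (hF.2 r hr).congr (hf₁.real _ rfl)
  · refine (normCmd_ends (hb₁.frame hf₂ (by decide)) h₂.1).mono le_rfl fun s₃ hf₃ h₃ => ⟨h₃, ?_⟩
    rw [hf₃.nat _ rfl, h₂.2]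

/-- At the first flat the stored value is left over from earlier and is overwritten without
comparison. Hence the minimum is required to be attained only for `0 < c`. -/
theorem minCmd_ends {s : Store} {i c : ℕ} {f : ℕ → ℝ} (hvi : s.nat vI 0 = i)
    (hvc : s.nat vC 0 = c) (hn : s.real rNorm 0 = f c) (hle : ∀ c' < c, s.real rVal i ≤ f c')
    (heq : 0 < c → ∃ c' < c, s.real rVal i = f c') :
    Ends minCmd s 2 fun s' => (∀ c' < c + 1, s'.real rVal i ≤ f c') ∧
      (∃ c' < c + 1, s'.real rVal i = f c') ∧ ∀ q, q ≠ i → s'.real rVal q = s.real rVal q := by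
  refine Ends.cond (B₁ := 1) (fun ht => ?_) (fun ht => ?_) le_rfl
  · simp only [Test.Holds, NExp.eval, RExp.eval, hvi, hvc, hn, not_lt] at ht
    refine (Ends.setNat _ _ _ _).mono le_rfl fun s' hf _ => ?_
    rw [hf.real rVal rfl]
    obtain ⟨c', hc', h⟩ := heq ht.1
    refine ⟨fun c'' hc'' => ?_, ⟨c', by omega, h⟩, fun _ _ => rfl⟩
    rcases Nat.lt_succ_iff_lt_or_eq.1 hc'' with hc'' | rfl
    · exact hle _ hc''
    · exact ht.2
  · simp only [Test.Holds, NExp.eval, RExp.eval, hvi, hvc, hn, not_and, not_not] at ht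
    refine (Ends.setReal _ _ _ _).mono le_rfl fun s' hf h => ?_
    rw [h]
    simp only [NExp.eval, RExp.eval, hvi, hn, Function.update_self]
    refine ⟨fun c' hc' => ?_, ⟨c, by omega, rfl⟩, fun q hq => Function.update_of_ne hq _ _⟩
    rcases Nat.lt_succ_iff_lt_or_eq.1 hc' with hc' | rfl
    · exact (ht (by omega)).le.trans (hle _ hc')
    · exact le_rfl

theorem evalCmd_ends {s : Store} (hk : 1 ≤ k) (hb : Base E k j N ε γ p A s) {P : ℕ}
    (hF : ∀ c < k, FlatAt E j p A s rCand (c * ((j + 1) * d)) (P + c * ((j + 1) * sampleSize E))) :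
    Ends evalCmd s (evalTime n d j k) fun s' =>
      ∀ i < n, s'.real rVal i = trialCost E k j p A P i := by
  refine Ends.forLoop (n := n) (b := k * (distTime d j + 9) + 5)
    (fun m s' => ∀ i < m, s'.real rVal i = trialCost E k j p A P i) rfl ?_ ?_ ?_ ?_
    (by unfold evalTime; linarith)
  · intro m s₁ s₂ h _ hr; rw [hr]; exact h
  · intro i s' hf _; simp only [NExp.eval]; rw [hf.nat 0 rfl, hb.n_eq]
  · intro i hi; omega
  · intro i hi s₁ hf₁ hvi hval
    have hb₁ := hb.frame hf₁ (by decide)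
    refine (Ends.setNat _ _ _ _).seq (B₂ := k * (distTime d j + 9) + 3) (fun s₂ hf₂ h₂ => ?_)
      (by omega)
    have hb₂ := hb₁.frame hf₂ (by decide)
    set f : ℕ → ℝ := fun c => flatCost E j p A (P + c * ((j + 1) * sampleSize E)) i with hf
    refine (Ends.forLoop (n := k) (b := distTime d j + 6)
      (fun c s' => s'.nat aCb 0 = c * ((j + 1) * d) ∧ (∀ q < i, s'.real rVal q = s₂.real rVal q) ∧
        (∀ c' < c, s'.real rVal i ≤ f c') ∧ (0 < c → ∃ c' < c, s'.real rVal i = f c'))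
      rfl ?_ ?_ ?_ ?_ (by linarith)).mono le_rfl fun s₃ hf₃ h₃ q hq => ?_
    · intro c s' s'' h hn hr
      rw [hr, hn _ (by decide)]; exact h
    · intro c s' hf' _; simp only [NExp.eval]; rw [hf'.nat 0 rfl, hb₂.k_eq]
    · refine ⟨by rw [h₂]; simp [NExp.eval], fun _ _ => rfl, fun c' hc' => by omega, fun h => by omega⟩
    · rintro c hc s₃ hf₃ hvc ⟨hcb, hun, hle, heq⟩
      have hb₃ := hb₂.frame hf₃ (by decide)
      refine (distCmd_ends hb₃ (i := i) (O := c * ((j + 1) * d))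
        (P := P + c * ((j + 1) * sampleSize E)) hi ?_ hcb ((hF c hc).congr ?_)).seq (B₂ := 5)
        (fun s₄ hf₄ h₄ => ?_) (by omega)
      · rw [hf₃.nat _ rfl, hf₂.nat _ rfl, hvi]
      · rw [hf₃.real _ rfl, hf₂.real _ rfl, hf₁.real _ rfl]
      have hb₄ := hb₃.frame hf₄ (by decide)
      have hv₄ : s₄.real rVal = s₃.real rVal := hf₄.real _ rfl
      refine (minCmd_ends (s := s₄) (i := i) (c := c) (f := f) ?_ ?_ h₄.1 ?_ ?_).seq (B₂ := 2)
        (fun s₅ hf₅ h₅ => ?_) (by omega)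
      · rw [hf₄.nat _ rfl, hf₃.nat _ rfl, hf₂.nat _ rfl, hvi]
      · rw [hf₄.nat _ rfl, hvc]
      · rw [hv₄]; exact hle
      · rw [hv₄]; exact heq
      · refine (Ends.setNat _ _ _ _).mono (by omega) fun s₆ hf₆ h₆ => ⟨?_, fun q hq => ?_, ?_, ?_⟩
        · rw [h₆]
          simp only [NExp.eval, Function.update_self]
          rw [hf₅.nat aO rfl, h₄.2, hf₅.nat 0 rfl, hb₄.d_eq]; ring
        · rw [hf₆.real _ rfl, h₅.2.2 q (by omega), hv₄, hun q hq]
        · rw [hf₆.real _ rfl]; exact h₅.1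
        · rw [hf₆.real _ rfl]; exact fun _ => h₅.2.1
    · rcases Nat.lt_succ_iff_lt_or_eq.1 hq with hq | rfl
      · rw [h₃.2.1 q hq, hf₂.real _ rfl, hval q hq]
      · have : Nonempty (Fin k) := ⟨⟨0, by omega⟩⟩
        obtain ⟨c', hc', h⟩ := h₃.2.2.2 (by omega)
        refine le_antisymm (le_ciInf fun c => h₃.2.2.1 c c.2) ?_
        rw [h]
        exact ciInf_le (Set.finite_range _).bddBelow (⟨c', hc'⟩ : Fin k)

theorem pivotCmd_ends {s : Store} (hb : Base E k j N ε γ p A s) {P D : ℕ} (hP : s.nat aPos 0 = P)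
    {f : ℕ → ℝ} (hval : ∀ i < n, s.real rVal i = f i) (hA : (A P).1 < n) (hD : P + 1 = D) :
    Ends pivotCmd s (n * 7 + 12) fun s' =>
      s'.nat aCnt 0 = (trimmed n f (A P).1).card ∧
      s'.real rTotal 0 = ∑ i ∈ trimmed n f (A P).1, f i ∧ s'.nat aPos 0 = D := by
  classical
  refine (Ends.setNat _ _ _ _).seq (B₂ := n * 7 + 10) (fun s₁ hf₁ h₁ => ?_) (by omega)
  refine (Ends.setNat _ _ _ _).seq (B₂ := n * 7 + 8) (fun s₂ hf₂ h₂ => ?_) (by omega)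
  refine (Ends.setReal _ _ _ _).seq (B₂ := n * 7 + 6) (fun s₃ hf₃ h₃ => ?_) (by omega)
  have hb₃ := ((hb.frame hf₁ (by decide)).frame hf₂ (by decide)).frame hf₃ (by decide)
  set π := (A P).1 with hπ
  have hpiv₃ : s₃.nat aPiv 0 = π := by
    rw [hf₃.nat _ rfl, hf₂.nat _ rfl, h₁]; simp [NExp.eval, hP, hb.tapeI_eq, hπ]
  have hval₃ : ∀ i < n, s₃.real rVal i = f i := by
    rw [hf₃.real _ rfl, hf₂.real _ rfl, hf₁.real _ rfl]; exact hval
  have hcnt₃ : s₃.nat aCnt 0 = 0 := by rw [hf₃.nat _ rfl, h₂]; simp [NExp.eval]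
  have htot₃ : s₃.real rTotal 0 = 0 := by rw [h₃]; simp [RExp.eval, NExp.eval]
  have hpos₃ : s₃.nat aPos 0 = P := by rw [hf₃.nat _ rfl, hf₂.nat _ rfl, hf₁.nat _ rfl, hP]
  set K : ℕ → Prop := fun i => f i < f π ∨ (¬ f π < f i ∧ ¬ π < i) with hK
  refine (Ends.forLoop (n := n) (b := 4)
    (fun m s' => s'.nat aCnt 0 = (∑ i ∈ Finset.range m, if K i then 1 else 0) ∧
      s'.real rTotal 0 = ∑ i ∈ Finset.range m, if K i then f i else 0) rfl ?_ ?_ ?_ ?_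
    (B := n * 7 + 3) (by omega)).seq (B₂ := 2) (fun s₄ hf₄ h₄ => ?_) (by omega)
  · intro m s' s'' h hn hr
    rw [hr, hn _ (by decide)]; exact h
  · intro i s' hf _; simp only [NExp.eval]; rw [hf.nat 0 rfl, hb₃.n_eq]
  · simpa using ⟨hcnt₃, htot₃⟩
  · rintro i hi s₄ hf₄ hvi ⟨hc, ht⟩
    have hKt : keptTest.Holds s₄ ↔ K i := by
      simp only [Test.Holds, NExp.eval, RExp.eval, hvi]
      rw [hf₄.nat aPiv rfl, hf₄.real rVal rfl, hpiv₃, hval₃ i hi, hval₃ π hA, hK]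
      tauto
    refine Ends.cond (B₁ := 3) (fun h => ?_) (fun h => ?_) (by omega)
    · rw [hKt] at h
      refine (Ends.setNat _ _ _ _).seq (B₂ := 1) (fun s₅ hf₅ h₅ => ?_) (by omega)
      refine (Ends.setReal _ _ _ _).mono le_rfl fun s₆ hf₆ h₆ => ⟨?_, ?_⟩
      · rw [hf₆.nat _ rfl, h₅, Finset.sum_range_succ, if_pos h]
        simp [NExp.eval, hc]
      · rw [h₆, Finset.sum_range_succ, if_pos h]
        simp only [NExp.eval, RExp.eval, Function.update_self]
        rw [hf₅.real rTotal rfl, hf₅.real rVal rfl, hf₅.nat vI rfl, hvi, hf₄.real rVal rfl,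
          hval₃ i hi, ht]
    · rw [hKt] at h
      refine (Ends.setNat _ _ _ _).mono (by omega) fun s₅ hf₅ _ => ?_
      rw [hf₅.nat aCnt rfl, hf₅.real rTotal rfl, Finset.sum_range_succ, Finset.sum_range_succ,
        if_neg h, if_neg h, add_zero, add_zero]
      exact ⟨hc, ht⟩
  · refine (Ends.setNat _ _ _ _).mono (by omega) fun s₅ hf₅ h₅ => ⟨?_, ?_, ?_⟩
    · rw [hf₅.nat _ rfl, h₄.1, ← Finset.card_filter]
      congr 1
    · rw [hf₅.real _ rfl, h₄.2, ← Finset.sum_filter]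
      refine Finset.sum_congr ?_ fun _ _ => rfl
      ext i
      simp [mem_trimmed, hK]
    · rw [h₅]
      simp only [NExp.eval, Function.update_self]
      rw [hf₄.nat _ rfl, hpos₃, hD]

theorem outVec_eq {s : Store} {b : ℕ} {v : EuclideanSpace ℝ (Fin d)}
    (h : VecAt s rOut (b * d) v) : outVec d s b = v := by
  ext t
  have := h t t.2
  simp only [coord, Fin.is_lt, dif_pos, Fin.eta] at this
  simpa [outVec] using this

/-- The flats of a candidate, and their cost on the points that are kept. -/
theorem output_of_flatAt {s : Store} {P : ℕ} (hj : j ≤ d) (hA : (A (P + k * ((j + 1) * sampleSize E))).1 < n)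
    (hF : ∀ c < k, FlatAt E j p A s rOut (c * ((j + 1) * d)) (P + c * ((j + 1) * sampleSize E))) :
    (∀ l, IsFlat j (output d k j s l)) ∧ ∃ Q : Finset (Fin n), Q.Nonempty ∧
      Q.card = (trialKept E k j p A P).card ∧ avgCost p Q (output d k j s) =
        (∑ i ∈ trialKept E k j p A P, trialCost E k j p A P i) / (trialKept E k j p A P).card := by
  have hout : ∀ l : Fin k, output d k j s l = AffineSubspace.mk'
      (flatCentre E p A (P + l * ((j + 1) * sampleSize E))) (Submodule.span ℝ (Set.range
        fun v : Fin j => flatBasis E j p A (P + l * ((j + 1) * sampleSize E)) v)) := by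
    intro l
    have h1 : outVec d s (l * (j + 1)) = flatCentre E p A (P + l * ((j + 1) * sampleSize E)) := by
      refine outVec_eq ?_
      rw [mul_assoc]; exact (hF l l.2).1
    have h2 : ∀ v : Fin j, outVec d s (l * (j + 1) + 1 + v)
        = flatBasis E j p A (P + l * ((j + 1) * sampleSize E)) v := fun v => by
      refine outVec_eq ?_
      have := (hF l l.2).2 v v.2
      have h3 : ((l : ℕ) * (j + 1) + 1 + v) * d = l * ((j + 1) * d) + (v + 1) * d := by ring
      rw [h3]; exact this
    simp only [output, h1, h2]
  have hcost : ∀ i : Fin n, (⨅ l : Fin k, Metric.infDist (p i) (output d k j s l : Set _) ^ 2)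
      = trialCost E k j p A P i := by
    intro i
    unfold trialCost flatCost
    congr 1
    funext l
    rw [hout, infDist_eq_norm_resid (flatBasis_orthFamily E hj p A _)]
    simp [pts]
  refine ⟨fun l => by rw [hout]; exact isFlat_of_orthFamily (flatBasis_orthFamily E hj p A _), ?_⟩
  have hsub : ∀ i ∈ trialKept E k j p A P, i < n := fun i hi => (mem_trimmed.1 hi).1
  have hcard : (((trialKept E k j p A P).attachFin hsub)).card = (trialKept E k j p A P).card :=
    Finset.card_attachFin _ _
  refine ⟨(trialKept E k j p A P).attachFin hsub, ?_, hcard, ?_⟩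
  · refine ⟨⟨_, hA⟩, ?_⟩
    rw [Finset.mem_attachFin]
    exact mem_trimmed.2 ⟨hA, Or.inr ⟨lt_irrefl _, lt_irrefl _⟩⟩
  · rw [avgCost, hcard]
    congr 1
    rw [Finset.sum_congr rfl fun i _ => hcost i]
    refine Finset.sum_nbij (fun i => (i : ℕ)) ?_ ?_ ?_ ?_
    · intro i hi; exact Finset.mem_attachFin _ |>.1 hi
    · intro i _ i' _ h; exact Fin.ext h
    · intro i hi; exact ⟨⟨i, hsub i hi⟩, by simpa using hi, rfl⟩
    · intro _ _; rfl

/-- After `T` trials: the output is a solution on enough points with the recorded cost, and it is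
at least as good as that of every successful trial. -/
def SearchState (E k j : ℕ) (ε γ : ℝ) (p : Fin n → EuclideanSpace ℝ (Fin d)) (A : ℕ → ℕ × ℕ)
    (T : ℕ) (s : Store) : Prop :=
  (0 < s.nat aFlag 0 → (∀ l, IsFlat j (output d k j s l)) ∧ ∃ Q : Finset (Fin n), Q.Nonempty ∧
    (1 - γ) * n ≤ Q.card ∧ avgCost p Q (output d k j s) = s.real rBest 0) ∧
  ∀ τ < T, TrialSuccess E k j ε γ p A (τ * (k * ((j + 1) * sampleSize E) + 1)) →
    0 < s.nat aFlag 0 ∧ s.real rBest 0 ≤ (1 + ε) * opt k j p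

theorem output_congr {s s' : Store} (h : s'.real rOut = s.real rOut) :
    output d k j s' = output d k j s := by
  have : ∀ b, outVec d s' b = outVec d s b := fun b => by simp only [outVec, h]
  funext l
  simp only [output, this]

theorem SearchState.congr {T : ℕ} {s s' : Store} (h : SearchState E k j ε γ p A T s)
    (h1 : s'.nat aFlag = s.nat aFlag) (h2 : s'.real rOut = s.real rOut)
    (h3 : s'.real rBest = s.real rBest) : SearchState E k j ε γ p A T s' := by
  unfold SearchState
  rw [output_congr h2, h1, h3]
  exact h

theorem SearchState.isGoodSolution {T : ℕ} {s : Store} (h : SearchState E k j ε γ p A T s)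
    (hs : ∃ τ < T, TrialSuccess E k j ε γ p A (τ * (k * ((j + 1) * sampleSize E) + 1))) :
    IsGoodSolution j ε γ p (output d k j s) := by
  obtain ⟨τ, hτ, hs⟩ := hs
  obtain ⟨h1, h2⟩ := h.2 τ hτ hs
  obtain ⟨h3, Q, h4, h5, h6⟩ := h.1 h1
  exact ⟨h3, Q, h4, h5, h6.trans_le h2⟩

/-- A candidate is accepted if it keeps enough points and nothing recorded has an average cost at
most its own; the program never needs `opt`. A successful trial that is rejected must have met a
record at least as good, so the bound passes to the record in either case. -/
theorem decideCmd_ends {s : Store} (hj : j ≤ d) (hb : Base E k j N ε γ p A s) {T P : ℕ}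
    (hPT : P = T * (k * ((j + 1) * sampleSize E) + 1))
    (hA : (A (P + k * ((j + 1) * sampleSize E))).1 < n)
    (hF : ∀ c < k, FlatAt E j p A s rCand (c * ((j + 1) * d)) (P + c * ((j + 1) * sampleSize E)))
    (hO : s.nat aOff 0 = k * ((j + 1) * d))
    (hcnt : s.nat aCnt 0 = (trialKept E k j p A P).card)
    (htot : s.real rTotal 0 = ∑ i ∈ trialKept E k j p A P, trialCost E k j p A P i)
    (hS : SearchState E k j ε γ p A T s) :
    Ends decideCmd s (4 * (k * ((j + 1) * d)) + 8) (SearchState E k j ε γ p A (T + 1)) := by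
  have hcpos : 0 < (trialKept E k j p A P).card := Finset.card_pos.2
    ⟨_, mem_trimmed.2 ⟨hA, Or.inr ⟨lt_irrefl _, lt_irrefl _⟩⟩⟩
  have hcpos' : (0 : ℝ) < (trialKept E k j p A P).card := by exact_mod_cast hcpos
  have hsuc : TrialSuccess E k j ε γ p A P →
      (∑ i ∈ trialKept E k j p A P, trialCost E k j p A P i) / (trialKept E k j p A P).card ≤
        (1 + ε) * opt k j p := fun h => by
    rw [div_le_iff₀ hcpos']; exact h.2
  refine Ends.cond (B₁ := 4 * (k * ((j + 1) * d)) + 7) (fun ht => ?_) (fun ht => ?_) le_rfl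
  all_goals
    simp only [Test.Holds, NExp.eval, RExp.eval] at ht
    rw [hcnt, htot, hb.γ_eq, hb.n_eq, Nat.cast_one] at ht
  · refine (Ends.setNat _ _ _ _).seq (B₂ := 4 * (k * ((j + 1) * d)) + 5) (fun s₁ hf₁ h₁ => ?_)
      (by omega)
    refine (Ends.setReal _ _ _ _).seq (B₂ := 4 * (k * ((j + 1) * d)) + 3) (fun s₂ hf₂ h₂ => ?_)
      (by omega)
    refine (Ends.fill (n := k * ((j + 1) * d)) (i₀ := 0) (fun t => s.real rCand t) ?_ ?_ le_rfl).mono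
      le_rfl fun s₃ hf₃ h₃ => ?_
    · intro s' hf; simp only [NExp.eval]; rw [hf.nat _ rfl, hf₂.nat _ rfl, hf₁.nat _ rfl, hO]
    · intro t _ s' hf hv _
      simp only [NExp.eval, RExp.eval, hv, zero_add]
      rw [hf.real rCand rfl, hf₂.real rCand rfl, hf₁.real rCand rfl]
      exact ⟨trivial, rfl⟩
    have hflag : s₃.nat aFlag 0 = 1 := by
      rw [hf₃.nat _ rfl, hf₂.nat _ rfl, h₁]; simp [NExp.eval]
    have hbest : s₃.real rBest 0 = (∑ i ∈ trialKept E k j p A P, trialCost E k j p A P i) /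
        (trialKept E k j p A P).card := by
      rw [hf₃.real _ rfl, h₂]
      simp only [NExp.eval, RExp.eval, Function.update_self]
      rw [hf₁.real _ rfl, hf₁.nat _ rfl, hcnt, htot]
    have hcopy : ∀ q < k * ((j + 1) * d), s₃.real rOut q = s.real rCand q := fun q hq => by
      have := h₃.1 q hq
      rwa [zero_add] at this
    have hF₃ : ∀ c < k, FlatAt E j p A s₃ rOut (c * ((j + 1) * d))
        (P + c * ((j + 1) * sampleSize E)) := by
      intro c hc
      have h5 : (c + 1) * ((j + 1) * d) ≤ k * ((j + 1) * d) := Nat.mul_le_mul_right _ (by omega)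
      rw [Nat.succ_mul] at h5
      refine ⟨fun t ht' => ?_, fun r hr t ht' => ?_⟩
      · have : 1 * d ≤ (j + 1) * d := Nat.mul_le_mul_right _ (by omega)
        rw [hcopy _ (by omega)]; exact (hF c hc).1 t ht'
      · have h6 : (r + 1) * d + d = (r + 1 + 1) * d := by ring
        have : (r + 1 + 1) * d ≤ (j + 1) * d := Nat.mul_le_mul_right _ (by omega)
        rw [hcopy _ (by omega)]; exact (hF c hc).2 r hr t ht'
    obtain ⟨h4, Q, h5, h6, h7⟩ := output_of_flatAt hj hA hF₃
    refine ⟨fun _ => ⟨h4, Q, h5, ?_, by rw [h7, hbest]⟩, fun τ hτ hs => ⟨by omega, ?_⟩⟩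
    · rw [h6]; exact not_lt.1 ht.1
    · rw [hbest]
      rcases Nat.lt_succ_iff_lt_or_eq.1 hτ with hτ | rfl
      · obtain ⟨h8, h9⟩ := hS.2 τ hτ hs
        have : ¬ ¬ _ := fun h => ht.2 ⟨h8, h⟩
        exact (not_not.1 this).le.trans h9
      · rw [← hPT] at hs; exact hsuc hs
  · refine (Ends.setNat _ _ _ _).mono (by omega) fun s₁ hf₁ _ => ?_
    have hS₁ := hS.congr (hf₁.nat _ rfl) (hf₁.real _ rfl) (hf₁.real _ rfl)
    refine ⟨hS₁.1, fun τ hτ hs => ?_⟩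
    rcases Nat.lt_succ_iff_lt_or_eq.1 hτ with hτ | rfl
    · exact hS₁.2 τ hτ hs
    · rw [← hPT] at hs
      have h8 := not_not.1 fun h => ht ⟨not_lt.2 hs.1, h⟩
      rw [hf₁.nat _ rfl, hf₁.real _ rfl]
      exact ⟨h8.1, (not_lt.1 h8.2).trans (hsuc hs)⟩

theorem trialCmd_ends {s : Store} (hk : 1 ≤ k) (hj : j ≤ d)
    (hb : Base E k j N ε γ p A s) {T : ℕ}
    (hP : s.nat aPos 0 = T * (k * ((j + 1) * sampleSize E) + 1))
    (hA : ∀ q < (T + 1) * (k * ((j + 1) * sampleSize E) + 1), (A q).1 < n)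
    (hS : SearchState E k j ε γ p A T s) :
    Ends trialCmd s (trialTime n d (sampleSize E) j k) fun s' =>
      SearchState E k j ε γ p A (T + 1) s' ∧
      s'.nat aPos 0 = (T + 1) * (k * ((j + 1) * sampleSize E) + 1) := by
  set P := T * (k * ((j + 1) * sampleSize E) + 1) with hPdef
  have hP1 : (T + 1) * (k * ((j + 1) * sampleSize E) + 1) = P + k * ((j + 1) * sampleSize E) + 1 := by
    rw [hPdef]; ring
  rw [hP1] at hA ⊢
  refine (flatsCmd_ends hb hP fun q _ h2 => hA q (by omega)).seq
    (B₂ := evalTime n d j k + (n * 7 + 12) + (4 * (k * ((j + 1) * d)) + 8) + 2)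
    (fun s₁ hf₁ h₁ => ?_) (by unfold trialTime; linarith)
  have hb₁ := hb.frame hf₁ (by decide)
  have hS₁ := hS.congr (hf₁.nat _ rfl) (hf₁.real _ rfl) (hf₁.real _ rfl)
  obtain ⟨hF₁, hO₁, hP₁⟩ := h₁
  refine (evalCmd_ends hk hb₁ hF₁).seq
    (B₂ := (n * 7 + 12) + (4 * (k * ((j + 1) * d)) + 8) + 1) (fun s₂ hf₂ h₂ => ?_) (by omega)
  have hb₂ := hb₁.frame hf₂ (by decide)
  have hS₂ := hS₁.congr (hf₂.nat _ rfl) (hf₂.real _ rfl) (hf₂.real _ rfl)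
  refine (pivotCmd_ends hb₂ (P := P + k * ((j + 1) * sampleSize E))
    (by rw [hf₂.nat _ rfl, hP₁]) h₂ (hA _ (by omega)) rfl).seq
    (B₂ := 4 * (k * ((j + 1) * d)) + 8) (fun s₃ hf₃ h₃ => ?_) (by omega)
  have hb₃ := hb₂.frame hf₃ (by decide)
  have hS₃ := hS₂.congr (hf₃.nat _ rfl) (hf₃.real _ rfl) (hf₃.real _ rfl)
  refine (decideCmd_ends hj hb₃ hPdef (hA _ (by omega)) (fun c hc => (hF₁ c hc).congr ?_) ?_ h₃.1
    h₃.2.1 hS₃).mono le_rfl fun s₄ hf₄ h₄ => ⟨h₄, ?_⟩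
  · rw [hf₃.real _ rfl, hf₂.real _ rfl]
  · rw [hf₃.nat _ rfl, hf₂.nat _ rfl, hO₁]
  · rw [hf₄.nat _ rfl, h₃.2.2]

theorem searchCmd_ends {s : Store} (hk : 1 ≤ k) (hj : j ≤ d)
    (hb : Base E k j N ε γ p A s)
    (hA : ∀ q < N * (k * ((j + 1) * sampleSize E) + 1), (A q).1 < n) :
    Ends searchCmd s (N * (trialTime n d (sampleSize E) j k + 3) + 7)
      (SearchState E k j ε γ p A N) := by
  refine (Ends.setNat _ _ _ _).seq (B₂ := N * (trialTime n d (sampleSize E) j k + 3) + 5)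
    (fun s₁ hf₁ h₁ => ?_) (by omega)
  refine (Ends.setNat _ _ _ _).seq (B₂ := N * (trialTime n d (sampleSize E) j k + 3) + 3)
    (fun s₂ hf₂ h₂ => ?_) (by omega)
  have hb₂ := (hb.frame hf₁ (by decide)).frame hf₂ (by decide)
  refine (Ends.forLoop (n := N) (b := trialTime n d (sampleSize E) j k)
    (fun T s' => SearchState E k j ε γ p A T s' ∧
      s'.nat aPos 0 = T * (k * ((j + 1) * sampleSize E) + 1)) rfl ?_ ?_ ?_ ?_ le_rfl).mono le_rfl
    fun _ _ h => h.1
  · intro T s' s'' h hn hr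
    refine ⟨h.1.congr (hn _ (by decide)) (by rw [hr]) (by rw [hr]), ?_⟩
    rw [hn _ (by decide)]; exact h.2
  · intro T s' hf _; simp only [NExp.eval]; rw [hf.nat _ rfl, hb₂.N_eq]
  -- Before the first trial the flag is zero, so no claim is made about the output.
  · refine ⟨⟨fun h => ?_, fun τ hτ => by omega⟩, ?_⟩
    · rw [h₂] at h; simp [NExp.eval] at h
    · rw [hf₂.nat _ rfl, h₁]; simp [NExp.eval]
  · intro T hT s' hf _ h
    refine trialCmd_ends hk hj (hb₂.frame hf (by decide)) h.2 (fun q hq => hA q (hq.trans_le ?_)) h.1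
    exact Nat.mul_le_mul_right _ (by omega)

end

end ProjectiveClustering

/-! ### Random choices -/

namespace RealRAM

/-- From the configuration `x`, all runs halt within `t` steps, and they end in `G` with probability
at least `π`. -/
def Succeeds (x : Config) (t : ℕ) (G : Set Store) (π : ℝ) : Prop :=
  (∀ y ∈ (runFor x t).support, y.1 = []) ∧
    ENNReal.ofReal π ≤ (runFor x t).toOuterMeasure {y | y.1 = [] ∧ y.2 ∈ G}

/-- All runs have halted, and a halted configuration no longer moves. Unequal running times can thus
be padded to a common bound. -/
theorem Succeeds.mono {x : Config} {t t' : ℕ} {G : Set Store} {π : ℝ} (h : Succeeds x t G π)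
    (ht : t ≤ t') : Succeeds x t' G π := by
  obtain ⟨u, rfl⟩ := Nat.exists_eq_add_of_le ht
  have : runFor x (t + u) = runFor x t := by
    rw [runFor_add]
    conv_rhs => rw [← PMF.bind_pure (runFor x t)]
    ext z
    rw [PMF.bind_apply, PMF.bind_apply]
    refine tsum_congr fun y => ?_
    by_cases hy : y ∈ (runFor x t).support
    · obtain ⟨L, s⟩ := y
      have : L = [] := h.1 _ hy
      subst this
      rw [runFor_halted]
    · rw [(PMF.apply_eq_zero_iff _ _).2 hy, zero_mul, zero_mul]
  unfold Succeeds
  rw [this]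
  exact h

theorem Succeeds.anti {x : Config} {t : ℕ} {G : Set Store} {π π' : ℝ} (h : Succeeds x t G π)
    (hπ : π' ≤ π) : Succeeds x t G π' :=
  ⟨h.1, (ENNReal.ofReal_le_ofReal hπ).trans h.2⟩

theorem Succeeds.of_run {x y : Config} {t u : ℕ} {G : Set Store} {π : ℝ}
    (hx : runFor x u = PMF.pure y) (h : Succeeds y t G π) : Succeeds x (u + t) G π := by
  unfold Succeeds
  rw [runFor_add, hx, PMF.pure_bind]
  exact h

theorem Succeeds.of_step {x y : Config} {t : ℕ} {G : Set Store} {π : ℝ}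
    (hx : step x = PMF.pure y) (h : Succeeds y t G π) : Succeeds x (t + 1) G π := by
  rw [add_comm]
  exact Succeeds.of_run (by simp [runFor, hx]) h

theorem Succeeds.of_ends {c : Cmd} {K : List Cmd} {s : Store} {B t : ℕ} {Q : Store → Prop}
    {G : Set Store} {π : ℝ} (h : Ends c s B Q)
    (hK : ∀ s', Frame c s s' → Q s' → Succeeds (K, s') t G π) : Succeeds (c :: K, s) (B + t) G π := by
  obtain ⟨u, hu, s', hr, hQ⟩ := h
  exact (Succeeds.of_run (hr K) (hK s' hr.frame hQ)).mono (by omega)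

/-- The alternative `π ≤ 0` admits tapes without a successful trial, so the indicator of success can
serve as the guaranteed probability. -/
theorem Succeeds.halted {s : Store} {G : Set Store} {π : ℝ} (hπ : π ≤ 1) (h : s ∈ G ∨ π ≤ 0) :
    Succeeds ([], s) 0 G π := by
  refine ⟨by simp [runFor], ?_⟩
  rw [runFor, PMF.toOuterMeasure_pure_apply]
  rcases h with h | h
  · simp [h, hπ]
  · rw [ENNReal.ofReal_of_nonpos h]; exact zero_le

theorem uniformBelow_eq (r : ℕ) :
    ∃ h : (Finset.range (max r 1)).Nonempty, uniformBelow r = PMF.uniformOfFinset _ h :=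
  ⟨⟨0, by simp⟩, rfl⟩

theorem uniformBelow_apply {r v : ℕ} (hv : v < r) : uniformBelow r v = (r : ENNReal)⁻¹ := by
  obtain ⟨h, heq⟩ := uniformBelow_eq r
  rw [heq, PMF.uniformOfFinset_apply_of_mem _ (by simp; omega), Finset.card_range,
    max_eq_left (by omega)]

theorem lt_of_mem_support_uniformBelow {r v : ℕ} (hr : 1 ≤ r) (hv : v ∈ (uniformBelow r).support) :
    v < r := by
  obtain ⟨h, heq⟩ := uniformBelow_eq r
  rw [heq, PMF.mem_support_uniformOfFinset_iff, Finset.mem_range, max_eq_left hr] at hv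
  exact hv

/-- The law of total probability, with a separate guarantee for each outcome. -/
theorem Succeeds.rand {a : ℕ} {i e : NExp} {K : List Cmd} {s : Store} {t r : ℕ} {G : Set Store}
    {π : ℕ → ℝ} (hr : 1 ≤ r) (he : e.eval s = r) (hπ : ∀ v, 0 ≤ π v)
    (h : ∀ v < r, Succeeds (K, s.setNat a (i.eval s) v) t G (π v)) :
    Succeeds (.rand a i e :: K, s) (t + 1) G (∑ v ∈ Finset.range r, (1 / r : ℝ) * π v) := by
  have hr' : (0 : ℝ) < r := by exact_mod_cast hr
  have hrun : runFor (.rand a i e :: K, s) (t + 1) = (uniformBelow r).bind fun v =>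
      runFor (K, s.setNat a (i.eval s) v) t := by
    rw [runFor_succ]
    simp only [step, he]
    rw [PMF.bind_map]
    rfl
  unfold Succeeds
  rw [hrun]
  refine ⟨fun y hy => ?_, ?_⟩
  · obtain ⟨v, hv, hy⟩ := (PMF.mem_support_bind_iff _ _ _).1 hy
    exact (h v (lt_of_mem_support_uniformBelow hr hv)).1 y hy
  · rw [PMF.toOuterMeasure_bind_apply]
    refine le_trans ?_ (ENNReal.sum_le_tsum (Finset.range r))
    rw [ENNReal.ofReal_sum_of_nonneg fun v _ => mul_nonneg (by positivity) (hπ v)]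
    refine Finset.sum_le_sum fun v hv => ?_
    have hv' := Finset.mem_range.1 hv
    rw [uniformBelow_apply hv', ENNReal.ofReal_mul (by positivity), one_div,
      ENNReal.ofReal_inv_of_pos hr', ENNReal.ofReal_natCast]
    gcongr
    exact (h v hv').2

end RealRAM

/-! ### Drawing the random tape. -/

namespace ProjectiveClustering

open RealRAM Tape

/-- Drawing the tape. -/
abbrev drawCmd : Cmd :=
  .seq (.rand aTapeI (var vFill) eN) (.seq (.rand aTapeG (var vFill) (var aRange))
    (assign vFill (.add (var vFill) (.const 1))))

abbrev drawLoop : Cmd := .loop (.natLT (var vFill) (var aL)) drawCmd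

abbrev fillCmd : Cmd := .seq (assign vFill (.const 0)) drawLoop

section

variable {n d E k j N : ℕ} {ε γ : ℝ} {p : Fin n → EuclideanSpace ℝ (Fin d)} {A : ℕ → ℕ × ℕ}

/-- The first `i` entries of the tape have been drawn. -/
structure Filling (E k j N : ℕ) (ε γ : ℝ) (p : Fin n → EuclideanSpace ℝ (Fin d)) (L i : ℕ)
    (A : ℕ → ℕ × ℕ) (s : Store) : Prop where
  base : Base E k j N ε γ p A s
  range_eq : s.nat aRange 0 = 2 * coefBound E + 1
  length_eq : s.nat aL 0 = L
  counter_eq : s.nat vFill 0 = i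
  index_lt : ∀ q < i, (A q).1 < n

theorem Filling.succ {L i v g : ℕ} {s : Store} (h : Filling E k j N ε γ p L i A s) (hv : v < n) :
    Filling E k j N ε γ p L (i + 1) (Function.update A i (v, g))
      (((s.setNat aTapeI i v).setNat aTapeG i g).setNat vFill 0 (i + 1)) := by
  obtain ⟨⟨h1, h2, h3, h4, h5, h6, h7, h8, h9, h10, h11, h12, h13⟩, h14, h15, h16, h17⟩ := h
  refine ⟨⟨?_, ?_, ?_, ?_, ?_, ?_, ?_, ?_, ?_, ?_, h11, h12, h13⟩, ?_, ?_, ?_, ?_⟩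
  · simpa [Store.setNat]
  · simpa [Store.setNat]
  · simpa [Store.setNat]
  · simpa [Store.setNat]
  · simpa [Store.setNat]
  · simpa [Store.setNat]
  · simpa [Store.setNat]
  · simpa [Store.setNat]
  · intro q
    rcases eq_or_ne q i with rfl | hq
    · simp [Store.setNat]
    · simp [Store.setNat, Function.update_of_ne hq, h9]
  · intro q
    rcases eq_or_ne q i with rfl | hq
    · simp [Store.setNat]
    · simp [Store.setNat, Function.update_of_ne hq, h10]
  · simpa [Store.setNat]
  · simpa [Store.setNat]
  · simp [Store.setNat]
  · intro q hq
    rcases Nat.lt_succ_iff_lt_or_eq.1 hq with hq | rfl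
    · rw [Function.update_of_ne (by omega)]; exact h17 q hq
    · simpa using hv

/-- One draw of a pair is realized by two successive random instructions. -/
theorem sum_draws_eq (n G : ℕ) (φ : ℕ × ℕ → ℝ) :
    ∑ v ∈ draws n G, unif n G v * φ v = ∑ a ∈ Finset.range n, (1 / n : ℝ) *
      ∑ b ∈ Finset.range (2 * G + 1), (1 / (2 * G + 1 : ℕ) : ℝ) * φ (a, b) := by
  rw [draws, Finset.sum_product]
  refine Finset.sum_congr rfl fun a _ => ?_
  rw [Finset.mul_sum]
  refine Finset.sum_congr rfl fun b _ => ?_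
  rw [unif, ← mul_assoc, one_div_mul_one_div]

/-- Conditionally on the entries drawn so far, the success probability is the average over the `r`
entries that are left. The recursion of `avg` matches the loop, with six steps per entry: the test,
two sequences, two random instructions and the increment. -/
theorem drawLoop_succeeds (hn : 1 ≤ n) {L B : ℕ} {K : List Cmd} {G : Set Store}
    {ev : (ℕ → ℕ × ℕ) → Prop}
    (hK : ∀ A s, Filling E k j N ε γ p L L A s → Succeeds (K, s) B G (ind ev A)) :
    ∀ r i, i + r = L → ∀ A s, Filling E k j N ε γ p L i A s →
      Succeeds (drawLoop :: K, s) (B + 6 * r + 1) G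
        (avg (draws n (coefBound E)) (unif n (coefBound E)) i r (ind ev) A) := by
  intro r
  induction r with
  | zero =>
    intro i hi A s h
    have : i = L := by omega
    subst this
    refine Succeeds.of_step (y := (K, s)) ?_ (hK A s h)
    simp [step, Test.Holds, NExp.eval, h.length_eq, h.counter_eq]
  | succ r ih =>
    intro i hi A s h
    have hnn : ∀ i r A, 0 ≤ avg (draws n (coefBound E)) (unif n (coefBound E)) i r (ind ev) A :=
      fun i r A => avg_nonneg (fun v _ => unif_nonneg _ _ _) (ind_nonneg _) _ _ _
    rw [show B + 6 * (r + 1) + 1 = B + 6 * r + 1 + 1 + 1 + 1 + 1 + 1 + 1 by ring]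
    refine Succeeds.of_step (y := (drawCmd :: drawLoop :: K, s)) ?_ ?_
    · have : i < L := by omega
      simp [step, Test.Holds, NExp.eval, h.length_eq, h.counter_eq, this]
    refine Succeeds.of_step rfl ?_
    simp only [avg]
    rw [sum_draws_eq]
    refine Succeeds.rand hn h.base.n_eq (fun v => Finset.sum_nonneg fun _ _ =>
      mul_nonneg (by positivity) (hnn _ _ _)) fun v hv => ?_
    refine Succeeds.of_step rfl ?_
    refine Succeeds.rand (by omega) ?_ (fun _ => hnn _ _ _) fun g _ => ?_
    · simpa [NExp.eval, Store.setNat] using h.range_eq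
    refine Succeeds.of_step rfl ?_
    have h1 : (NExp.get vFill (.const 0)).eval s = i := h.counter_eq
    have h2 := ih (i + 1) (by omega) _ _ (h.succ (g := g) hv)
    have h3 : (NExp.get vFill (.const 0)).eval (s.setNat aTapeI i v) = i := by
      simpa [NExp.eval, Store.setNat] using h1
    have h4 : (NExp.add (var vFill) (.const 1)).eval ((s.setNat aTapeI i v).setNat aTapeG i g)
        = i + 1 := by
      simpa [NExp.eval, Store.setNat] using h1
    rw [h1, h3, h4]
    exact h2

/-- Drawing the tape, and searching. -/
theorem fillCmd_succeeds (hn : 1 ≤ n) (hk : 1 ≤ k) (hj : j ≤ d) {L : ℕ} {s : Store}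
    (hL : L = N * (k * ((j + 1) * sampleSize E) + 1))
    (hb : Base E k j N ε γ p A s) (hR : s.nat aRange 0 = 2 * coefBound E + 1)
    (hLs : s.nat aL 0 = L) (hhalf : 1 / 2 ≤ avg (draws n (coefBound E)) (unif n (coefBound E)) 0 L
      (ind fun A => ∃ τ < N, TrialSuccess E k j ε γ p A
        (τ * (k * ((j + 1) * sampleSize E) + 1))) A) :
    Succeeds ([fillCmd, searchCmd], s)
      (N * (trialTime n d (sampleSize E) j k + 3) + 6 * L + 10)
      {s | IsGoodSolution j ε γ p (output d k j s)} (1 / 2) := by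
  have h0 : Filling E k j N ε γ p L 0 A (s.setNat vFill 0 0) := by
    obtain ⟨h1, h2, h3, h4, h5, h6, h7, h8, h9, h10, h11, h12, h13⟩ := hb
    refine ⟨⟨?_, ?_, ?_, ?_, ?_, ?_, ?_, ?_, ?_, ?_, h11, h12, h13⟩, ?_, ?_, by simp [Store.setNat], by simp⟩
    all_goals simpa [Store.setNat]
  have h1 := drawLoop_succeeds (K := [searchCmd]) (B := N * (trialTime n d (sampleSize E) j k + 3) + 7)
    (G := {s | IsGoodSolution j ε γ p (output d k j s)}) (ev := fun A => ∃ τ < N,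
      TrialSuccess E k j ε γ p A (τ * (k * ((j + 1) * sampleSize E) + 1))) hn ?_ L 0 (by simp) A _ h0
  · have h2 : Succeeds ([fillCmd, searchCmd], s) _ _ _ :=
      Succeeds.of_step rfl (Succeeds.of_step rfl h1)
    exact (h2.anti hhalf).mono (by omega)
  · intro A' s' h
    refine (Succeeds.of_ends (t := 0) (searchCmd_ends hk hj h.base ?_) fun s'' _ hS =>
      Succeeds.halted (ind_le_one _ _) ?_)
    · rw [← hL]; exact h.index_lt
    · by_cases hs : ∃ τ < N, TrialSuccess E k j ε γ p A' (τ * (k * ((j + 1) * sampleSize E) + 1))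
      · exact Or.inl (hS.isGoodSolution hs)
      · exact Or.inr (ind_of_not (P := fun A => ∃ τ < N, TrialSuccess E k j ε γ p A
          (τ * (k * ((j + 1) * sampleSize E) + 1))) hs).le

end

end ProjectiveClustering

/-! ### The program: computing the parameters -/

namespace RealRAM

/-- `dst := x * y`, with the loop counter `v`. -/
abbrev mulCmd (dst v : ℕ) (x y : NExp) : Cmd :=
  .seq (assign dst (.const 0)) (forLoop v x (assign dst (.add (var dst) y)))

theorem Ends.mul {dst v : ℕ} {x y : NExp} {s : Store} {a b B : ℕ} (hd : Nat.beq dst v = false)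
    (hx : ∀ s', Frame (mulCmd dst v x y) s s' → x.eval s' = a)
    (hy : ∀ s', Frame (mulCmd dst v x y) s s' → y.eval s' = b) (hB : 4 * a + 5 ≤ B) :
    Ends (mulCmd dst v x y) s B fun s' => s'.nat dst 0 = a * b := by
  refine (Ends.setNat _ _ _ _).seq (B₂ := 4 * a + 3) (fun s₁ hf₁ h₁ => ?_) (by omega)
  have hfr : ∀ {s'}, Frame (RealRAM.forLoop v x (assign dst (.add (var dst) y))) s₁ s' →
      Frame (mulCmd dst v x y) s s' := fun hf => Frame.trans
    (hf₁.weaken (fun a ha => by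
      simp only [Cmd.writesNat, Bool.or_eq_false_iff] at ha ⊢; exact ha.1) (fun _ _ => rfl))
    (hf.weaken (fun a ha => by
      simp only [Cmd.writesNat, Bool.or_eq_false_iff] at ha ⊢; exact ha.2) (fun _ _ => rfl))
  refine Ends.forLoop (n := a) (b := 1) (fun i s' => s'.nat dst 0 = i * b) hd ?_ ?_ ?_ ?_
    (by omega)
  · intro i s' s'' h hn _
    rw [hn _ (nat_beq_eq_false hd).symm]; exact h
  · intro i s' hf _; exact hx s' (hfr hf)
  · rw [h₁]; simp [NExp.eval]
  · intro i _ s' hf _ h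
    refine (Ends.setNat _ _ _ _).mono le_rfl fun s'' _ h' => ?_
    rw [h']
    simp only [NExp.eval, Function.update_self]
    rw [h, hy s' (hfr hf)]; ring

/-- `2 * e`. -/
abbrev dbl (e : NExp) : NExp := .add e e

/-- `dst := 2 ^ x`, with the loop counter `v`. -/
abbrev powCmd (dst v : ℕ) (x : NExp) : Cmd :=
  .seq (assign dst (.const 1)) (forLoop v x (assign dst (dbl (var dst))))

theorem Ends.pow {dst v : ℕ} {x : NExp} {s : Store} {a B : ℕ} (hd : Nat.beq dst v = false)
    (hx : ∀ s', Frame (powCmd dst v x) s s' → x.eval s' = a) (hB : 4 * a + 5 ≤ B) :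
    Ends (powCmd dst v x) s B fun s' => s'.nat dst 0 = 2 ^ a := by
  refine (Ends.setNat _ _ _ _).seq (B₂ := 4 * a + 3) (fun s₁ hf₁ h₁ => ?_) (by omega)
  have hfr : ∀ {s'}, Frame (RealRAM.forLoop v x (assign dst (dbl (var dst)))) s₁ s' →
      Frame (powCmd dst v x) s s' := fun hf => Frame.trans
    (hf₁.weaken (fun a ha => by
      simp only [Cmd.writesNat, Bool.or_eq_false_iff] at ha ⊢; exact ha.1) (fun _ _ => rfl))
    (hf.weaken (fun a ha => by
      simp only [Cmd.writesNat, Bool.or_eq_false_iff] at ha ⊢; exact ha.2) (fun _ _ => rfl))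
  refine Ends.forLoop (n := a) (b := 1) (fun i s' => s'.nat dst 0 = 2 ^ i) hd ?_ ?_ ?_ ?_
    (by omega)
  · intro i s' s'' h hn _
    rw [hn _ (nat_beq_eq_false hd).symm]; exact h
  · intro i s' hf _; exact hx s' (hfr hf)
  · rw [h₁]; simp [NExp.eval]
  · intro i _ s' hf _ h
    refine (Ends.setNat _ _ _ _).mono le_rfl fun s'' _ h' => ?_
    rw [h']
    simp only [NExp.eval, Function.update_self]
    rw [h]; ring

end RealRAM

/-! ### Computing the accuracy, the sample size and the number of trials. -/

namespace ProjectiveClustering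

open RealRAM

/-- `M := ⌈1 / (ε γ)⌉ + k + j`. -/
abbrev scaleCmd : Cmd :=
  .seq (assign aM (.const 1))
    (.seq (.loop (.realLT (.mul (.ofNat (var aM)) (.mul (.get 1 (.const 0)) (.get 1 (.const 1))))
        (.ofNat (.const 1))) (assign aM (.add (var aM) (.const 1))))
      (assign aM (.add (var aM) (.add eK eJ))))

/-- `16 * e`. -/
abbrev times16 (e : NExp) : NExp := dbl (dbl (dbl (dbl e)))

/-- The accuracy, the sample size and the bound for the coefficients. -/
abbrev boundsCmd : Cmd :=
  .seq (mulCmd aE vMul (var aM) (var aM)) (.seq (assign aE (times16 (var aE)))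
    (.seq (assign aSize (times16 (var aE))) (.seq (mulCmd aX vMul (var aE) (var aE))
    (.seq (assign aX (dbl (dbl (dbl (var aX))))) (.seq (mulCmd aG vMul (var aX) (var aX))
      (assign aRange (.add (dbl (var aG)) (.const 1))))))))

/-- The number of trials and the length of the tape. -/
abbrev countsCmd : Cmd :=
  .seq (mulCmd aBlk vMul (.add eJ (.const 1)) (var aSize)) (.seq (mulCmd aD vMul eK (var aBlk))
    (.seq (mulCmd aX vMul (var aE) (var aD)) (.seq (assign aX (times16 (var aX)))
    (.seq (powCmd aN vMul (var aX)) (.seq (assign aD (.add (var aD) (.const 1)))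
      (mulCmd aL vMul (var aN) (var aD)))))))

/-- The table of the positions of the points. -/
abbrev rowsCmd : Cmd :=
  .seq (assign aO (.const 0)) (forLoop vI eN (.seq (.setNat aRow (var vI) (var aO))
    (assign aO (.add (var aO) eD))))

abbrev paramsCmd : Cmd := .seq scaleCmd (.seq boundsCmd (.seq countsCmd rowsCmd))

/-- The complete program. -/
abbrev mainCmd : Cmd := .seq paramsCmd (.seq fillCmd searchCmd)

/-- The accuracy for the scale `M`. -/
def accuracy (M : ℕ) : ℕ := 16 * M ^ 2

/-- The number of draws that determine the flats of one trial. -/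
def trialDraws (M k j : ℕ) : ℕ := k * ((j + 1) * sampleSize (accuracy M))

/-- The binary logarithm of the number of trials. -/
def logTrials (M k j : ℕ) : ℕ := 16 * (accuracy M * trialDraws M k j)

/-- The number of steps for the parameters. -/
def paramsTime (n M k j : ℕ) : ℕ :=
  7 * M + 4 * accuracy M + 4 * (8 * accuracy M ^ 2) + 4 * j + 4 * k + 4 * accuracy M +
    4 * logTrials M k j + 4 * 2 ^ logTrials M k j + 6 * n + 100

/-- The scale of the parameters. -/
noncomputable def scale (k j : ℕ) (ε γ : ℝ) : ℕ := ⌈1 / (ε * γ)⌉₊ + (k + j)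

section

variable {n d k j : ℕ} {ε γ : ℝ}

/-- Real numbers cannot be rounded on this machine, so the ceiling is found by counting up. The two
conditions on `U` characterize it as the least natural number with `1 ≤ U ε γ`. -/
theorem scaleLoop_ends {s : Store} {m U : ℕ} (hε : s.real 1 0 = ε) (hγ : s.real 1 1 = γ)
    (hm : s.nat aM 0 = m) (hU : 1 ≤ U * (ε * γ)) (hlt : ∀ i < U, (i : ℝ) * (ε * γ) < 1)
    (hmU : m ≤ U) :
    Ends (.loop (.realLT (.mul (.ofNat (var aM)) (.mul (.get 1 (.const 0)) (.get 1 (.const 1))))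
        (.ofNat (.const 1))) (assign aM (.add (var aM) (.const 1)))) s (2 * (U - m) + 1) fun s' =>
      s'.nat aM 0 = U := by
  obtain ⟨r, hr⟩ : ∃ r, m + r = U := ⟨U - m, by omega⟩
  induction r generalizing s m with
  | zero =>
    have : m = U := by omega
    subst this
    refine (Ends.loop_false ?_ hm).mono (by omega) fun _ _ h => h
    simpa [Test.Holds, RExp.eval, NExp.eval, hm, hε, hγ] using hU
  | succ r ih =>
    refine Ends.loop_true ?_ (Ends.setNat _ _ _ _) (fun s' hf h => ih (m := m + 1) (s := s') ?_ ?_ ?_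
      (by omega) (by omega)) (by omega)
    · simpa [Test.Holds, RExp.eval, NExp.eval, hm, hε, hγ] using hlt m (by omega)
    · rw [hf.real _ rfl, hε]
    · rw [hf.real _ rfl, hγ]
    · rw [h]; simp [NExp.eval, hm]

theorem scaleCmd_ends {s : Store} (hk : s.nat 0 2 = k) (hj : s.nat 0 3 = j)
    (hε : s.real 1 0 = ε) (hγ : s.real 1 1 = γ) (hpos : 0 < ε * γ) :
    Ends scaleCmd s (2 * scale k j ε γ + 5) fun s' => s'.nat aM 0 = scale k j ε γ := by
  have hU0 : 1 ≤ ⌈1 / (ε * γ)⌉₊ := Nat.one_le_ceil_iff.2 (by positivity)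
  refine (Ends.setNat _ _ _ _).seq (B₂ := 2 * scale k j ε γ + 3) (fun s₁ hf₁ h₁ => ?_) (by omega)
  refine (scaleLoop_ends (m := 1) (U := ⌈1 / (ε * γ)⌉₊) (by rw [hf₁.real _ rfl, hε])
    (by rw [hf₁.real _ rfl, hγ]) (by rw [h₁]; simp [NExp.eval]) ?_ ?_ hU0).seq (B₂ := 1)
    (fun s₂ hf₂ h₂ => ?_) (by unfold scale; omega)
  · rw [← div_le_iff₀ hpos]; exact Nat.le_ceil _
  · intro i hi
    rw [← lt_div_iff₀ hpos]; exact Nat.lt_ceil.1 hi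
  · refine (Ends.setNat _ _ _ _).mono le_rfl fun s₃ _ h₃ => ?_
    rw [h₃]
    simp only [NExp.eval, Function.update_self]
    rw [h₂, hf₂.nat 0 rfl, hf₁.nat 0 rfl, hk, hj, scale]

theorem boundsCmd_ends {s : Store} {M : ℕ} (hM : s.nat aM 0 = M) :
    Ends boundsCmd s (4 * M + 4 * accuracy M + 4 * (8 * accuracy M ^ 2) + 30) fun s' =>
      s'.nat aE 0 = accuracy M ∧ s'.nat aSize 0 = sampleSize (accuracy M) ∧
      s'.nat aG 0 = coefBound (accuracy M) ∧ s'.nat aRange 0 = 2 * coefBound (accuracy M) + 1 := by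
  refine (Ends.mul (a := M) (b := M) rfl ?_ ?_ le_rfl).seq
    (B₂ := 4 * accuracy M + 4 * (8 * accuracy M ^ 2) + 24) (fun s₁ hf₁ h₁ => ?_) (by omega)
  · intro s' hf; simp only [NExp.eval]; rw [hf.nat _ rfl, hM]
  · intro s' hf; simp only [NExp.eval]; rw [hf.nat _ rfl, hM]
  refine (Ends.setNat _ _ _ _).seq
    (B₂ := 4 * accuracy M + 4 * (8 * accuracy M ^ 2) + 22) (fun s₂ hf₂ h₂ => ?_) (by omega)
  have hE₂ : s₂.nat aE 0 = accuracy M := by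
    rw [h₂]; simp only [NExp.eval, Function.update_self]; rw [h₁, accuracy]; ring
  refine (Ends.setNat _ _ _ _).seq
    (B₂ := 4 * accuracy M + 4 * (8 * accuracy M ^ 2) + 20) (fun s₃ hf₃ h₃ => ?_) (by omega)
  have hE₃ : s₃.nat aE 0 = accuracy M := by rw [hf₃.nat _ rfl, hE₂]
  have hm₃ : s₃.nat aSize 0 = sampleSize (accuracy M) := by
    rw [h₃]; simp only [NExp.eval, Function.update_self]; rw [hE₂, sampleSize]; ring
  refine (Ends.mul (a := accuracy M) (b := accuracy M) rfl ?_ ?_ le_rfl).seq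
    (B₂ := 4 * (8 * accuracy M ^ 2) + 14) (fun s₄ hf₄ h₄ => ?_) (by omega)
  · intro s' hf; simp only [NExp.eval]; rw [hf.nat _ rfl, hE₃]
  · intro s' hf; simp only [NExp.eval]; rw [hf.nat _ rfl, hE₃]
  refine (Ends.setNat _ _ _ _).seq
    (B₂ := 4 * (8 * accuracy M ^ 2) + 12) (fun s₅ hf₅ h₅ => ?_) (by omega)
  have hX₅ : s₅.nat aX 0 = 8 * accuracy M ^ 2 := by
    rw [h₅]; simp only [NExp.eval, Function.update_self]; rw [h₄]; ring
  refine (Ends.mul (a := 8 * accuracy M ^ 2) (b := 8 * accuracy M ^ 2) rfl ?_ ?_ le_rfl).seq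
    (B₂ := 1) (fun s₆ hf₆ h₆ => ?_) (by omega)
  · intro s' hf; simp only [NExp.eval]; rw [hf.nat _ rfl, hX₅]
  · intro s' hf; simp only [NExp.eval]; rw [hf.nat _ rfl, hX₅]
  have hG : s₆.nat aG 0 = coefBound (accuracy M) := by
    rw [h₆, coefBound, scaleBound]; ring
  refine (Ends.setNat _ _ _ _).mono le_rfl fun s₇ hf₇ h₇ => ⟨?_, ?_, ?_, ?_⟩
  · rw [hf₇.nat _ rfl, hf₆.nat _ rfl, hf₅.nat _ rfl, hf₄.nat _ rfl, hE₃]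
  · rw [hf₇.nat _ rfl, hf₆.nat _ rfl, hf₅.nat _ rfl, hf₄.nat _ rfl, hm₃]
  · rw [hf₇.nat _ rfl, hG]
  · rw [h₇]; simp only [NExp.eval, Function.update_self]; rw [hG]; ring

theorem countsCmd_ends {s : Store} {M : ℕ} (hk : s.nat 0 2 = k) (hj : s.nat 0 3 = j)
    (hE : s.nat aE 0 = accuracy M) (hm : s.nat aSize 0 = sampleSize (accuracy M)) :
    Ends countsCmd s (4 * j + 4 * k + 4 * accuracy M + 4 * logTrials M k j +
      4 * 2 ^ logTrials M k j + 40) fun s' => s'.nat aN 0 = 2 ^ logTrials M k j ∧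
      s'.nat aL 0 = 2 ^ logTrials M k j * (trialDraws M k j + 1) := by
  refine (Ends.mul (a := j + 1) (b := sampleSize (accuracy M)) rfl ?_ ?_ le_rfl).seq
    (B₂ := 4 * k + 4 * accuracy M + 4 * logTrials M k j + 4 * 2 ^ logTrials M k j + 30)
    (fun s₁ hf₁ h₁ => ?_) (by omega)
  · intro s' hf; simp only [NExp.eval]; rw [hf.nat _ rfl, hj]
  · intro s' hf; simp only [NExp.eval]; rw [hf.nat _ rfl, hm]
  refine (Ends.mul (a := k) (b := (j + 1) * sampleSize (accuracy M)) rfl ?_ ?_ le_rfl).seq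
    (B₂ := 4 * accuracy M + 4 * logTrials M k j + 4 * 2 ^ logTrials M k j + 24)
    (fun s₂ hf₂ h₂ => ?_) (by omega)
  · intro s' hf; simp only [NExp.eval]; rw [hf.nat _ rfl, hf₁.nat _ rfl, hk]
  · intro s' hf; simp only [NExp.eval]; rw [hf.nat _ rfl, h₁]
  change s₂.nat aD 0 = trialDraws M k j at h₂
  refine (Ends.mul (a := accuracy M) (b := trialDraws M k j) rfl ?_ ?_ le_rfl).seq
    (B₂ := 4 * logTrials M k j + 4 * 2 ^ logTrials M k j + 18) (fun s₃ hf₃ h₃ => ?_) (by omega)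
  · intro s' hf; simp only [NExp.eval]
    rw [hf.nat _ rfl, hf₂.nat _ rfl, hf₁.nat _ rfl, hE]
  · intro s' hf; simp only [NExp.eval]; rw [hf.nat _ rfl, h₂]
  refine (Ends.setNat _ _ _ _).seq
    (B₂ := 4 * logTrials M k j + 4 * 2 ^ logTrials M k j + 16) (fun s₄ hf₄ h₄ => ?_) (by omega)
  have hX₄ : s₄.nat aX 0 = logTrials M k j := by
    rw [h₄]; simp only [NExp.eval, Function.update_self]; rw [h₃, logTrials]; ring
  refine (Ends.pow (a := logTrials M k j) rfl ?_ le_rfl).seq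
    (B₂ := 4 * 2 ^ logTrials M k j + 10) (fun s₅ hf₅ h₅ => ?_) (by omega)
  · intro s' hf; simp only [NExp.eval]; rw [hf.nat _ rfl, hX₄]
  refine (Ends.setNat _ _ _ _).seq
    (B₂ := 4 * 2 ^ logTrials M k j + 8) (fun s₆ hf₆ h₆ => ?_) (by omega)
  have hD₆ : s₆.nat aD 0 = trialDraws M k j + 1 := by
    rw [h₆]; simp only [NExp.eval, Function.update_self]
    rw [hf₅.nat _ rfl, hf₄.nat _ rfl, hf₃.nat _ rfl, h₂]
  have hN₆ : s₆.nat aN 0 = 2 ^ logTrials M k j := by rw [hf₆.nat _ rfl, h₅]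
  refine (Ends.mul (a := 2 ^ logTrials M k j) (b := trialDraws M k j + 1) rfl ?_ ?_ le_rfl).mono
    (by omega) fun s₇ hf₇ h₇ => ⟨?_, h₇⟩
  · intro s' hf; simp only [NExp.eval]; rw [hf.nat _ rfl, hN₆]
  · intro s' hf; simp only [NExp.eval]; rw [hf.nat _ rfl, hD₆]
  · rw [hf₇.nat _ rfl, hN₆]

/-- Natural numbers have no multiplication on this machine. The offsets of the points are tabulated
once, by repeated addition, so that a point can later be addressed in one step. -/
theorem rowsCmd_ends {s : Store} (hn : s.nat 0 0 = n) (hd : s.nat 0 1 = d) :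
    Ends rowsCmd s (6 * n + 5) fun s' => ∀ i < n, s'.nat aRow i = i * d := by
  refine (Ends.setNat _ _ _ _).seq (B₂ := 6 * n + 3) (fun s₁ hf₁ h₁ => ?_) (by omega)
  refine (Ends.forLoop (n := n) (b := 3) (fun m s' => (∀ i < m, s'.nat aRow i = i * d) ∧
    s'.nat aO 0 = m * d) rfl ?_ ?_ ?_ ?_ (by omega)).mono le_rfl fun _ _ h => h.1
  · intro m s' s'' h hn' _
    rw [hn' _ (by decide), hn' aO (by decide)]; exact h
  · intro m s' hf _; simp only [NExp.eval]; rw [hf.nat _ rfl, hf₁.nat _ rfl, hn]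
  · refine ⟨fun i hi => by omega, ?_⟩
    rw [h₁]; simp [NExp.eval]
  · rintro m hm s₂ hf₂ hv ⟨hrow, hO⟩
    refine (Ends.setNat _ _ _ _).seq (B₂ := 1) (fun s₃ hf₃ h₃ => ?_) (by omega)
    refine (Ends.setNat _ _ _ _).mono le_rfl fun s₄ hf₄ h₄ => ⟨fun i hi => ?_, ?_⟩
    · rw [hf₄.nat _ rfl, h₃]
      simp only [NExp.eval, hv, hO]
      rcases Nat.lt_succ_iff_lt_or_eq.1 hi with hi | rfl
      · rw [Function.update_of_ne (by omega), hrow i hi]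
      · rw [Function.update_self]
    · rw [h₄]
      simp only [NExp.eval, Function.update_self]
      rw [hf₃.nat _ rfl, hO, hf₃.nat 0 rfl, hf₂.nat 0 rfl, hf₁.nat 0 rfl, hd]; ring

theorem input_point (k j : ℕ) (ε γ : ℝ) (p : Fin n → EuclideanSpace ℝ (Fin d)) {i t : ℕ} (hi : i < n)
    (ht : t < d) : (input k j ε γ p).real 0 (i * d + t) = coord (pts p i) t := by
  have h1 : (i * d + t) / d = i := by
    rw [Nat.add_comm, Nat.add_mul_div_right _ _ (by omega), Nat.div_eq_of_lt ht, zero_add]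
  have h2 : (i * d + t) % d = t := by
    rw [Nat.add_comm, Nat.add_mul_mod_self_right, Nat.mod_eq_of_lt ht]
  simp [input, coord, pts, h1, h2, hi, ht]

theorem paramsCmd_ends (p : Fin n → EuclideanSpace ℝ (Fin d)) (hpos : 0 < ε * γ) {M X D : ℕ}
    (hM : M = scale k j ε γ) (hX : X = logTrials M k j) (hD : D = trialDraws M k j) :
    Ends paramsCmd (input k j ε γ p) (paramsTime n M k j) fun s' =>
      Base (accuracy M) k j (2 ^ X) ε γ p (fun _ => (0, 0)) s' ∧
      s'.nat aRange 0 = 2 * coefBound (accuracy M) + 1 ∧ s'.nat aL 0 = 2 ^ X * (D + 1) := by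
  subst hX hD
  set s := input k j ε γ p with hs
  refine (scaleCmd_ends (s := s) (k := k) (j := j) (ε := ε) (γ := γ) rfl rfl rfl rfl hpos).seq
    (B₂ := 4 * M + 4 * accuracy M + 4 * (8 * accuracy M ^ 2) + 30 + (4 * j + 4 * k + 4 * accuracy M +
      4 * logTrials M k j + 4 * 2 ^ logTrials M k j + 40) + (6 * n + 5) + 2)
    (fun s₁ hf₁ h₁ => ?_) (by unfold paramsTime; omega)
  rw [← hM] at h₁
  refine (boundsCmd_ends h₁).seq (B₂ := (4 * j + 4 * k + 4 * accuracy M +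
      4 * logTrials M k j + 4 * 2 ^ logTrials M k j + 40) + (6 * n + 5) + 1)
    (fun s₂ hf₂ h₂ => ?_) (by omega)
  obtain ⟨hE, hm, hG, hR⟩ := h₂
  refine (countsCmd_ends (k := k) (j := j) (M := M) (by rw [hf₂.nat 0 rfl, hf₁.nat 0 rfl]; rfl)
    (by rw [hf₂.nat 0 rfl, hf₁.nat 0 rfl]; rfl) hE hm).seq (B₂ := 6 * n + 5)
    (fun s₃ hf₃ h₃ => ?_) (by omega)
  have h0₃ : s₃.nat 0 = s.nat 0 := by rw [hf₃.nat 0 rfl, hf₂.nat 0 rfl, hf₁.nat 0 rfl]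
  refine (rowsCmd_ends (n := n) (d := d) (by rw [h0₃]; rfl) (by rw [h0₃]; rfl)).mono le_rfl
    fun s₄ hf₄ h₄ => ?_
  have h0₄ : s₄.nat 0 = s.nat 0 := by rw [hf₄.nat 0 rfl, h0₃]
  have hr₄ : s₄.real = s.real := funext fun a => by
    rw [hf₄.real a rfl, hf₃.real a rfl, hf₂.real a rfl, hf₁.real a rfl]
  refine ⟨⟨by rw [h0₄]; rfl, by rw [h0₄]; rfl, by rw [h0₄]; rfl, by rw [h0₄]; rfl, ?_, ?_, ?_, h₄,
    fun q => ?_, fun q => ?_, fun i hi t ht => ?_, by rw [hr₄]; rfl, by rw [hr₄]; rfl⟩, ?_, ?_⟩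
  · rw [hf₄.nat _ rfl, hf₃.nat _ rfl, hm]
  · rw [hf₄.nat _ rfl, hf₃.nat _ rfl, hG]
  · rw [hf₄.nat _ rfl, h₃.1]
  · rw [hf₄.nat _ rfl, hf₃.nat _ rfl, hf₂.nat _ rfl, hf₁.nat _ rfl]; rfl
  · rw [hf₄.nat _ rfl, hf₃.nat _ rfl, hf₂.nat _ rfl, hf₁.nat _ rfl]; rfl
  · rw [hr₄]; exact input_point k j ε γ p hi ht
  · rw [hf₄.nat _ rfl, hf₃.nat _ rfl, hR]
  · rw [hf₄.nat _ rfl, h₃.2]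

end

end ProjectiveClustering

/-! ### The number of trials and the running time -/

namespace ProjectiveClustering

open RealRAM Tape

/-- After the substitution of `1 +` a natural number for each variable, the difference of the two
sides has nonnegative coefficients only. -/
theorem dirTime_le {d m j : ℕ} (hd : 1 ≤ d) (hm : 1 ≤ m) (hj : 1 ≤ j) :
    dirTime d m j ≤ 140 * (d * m * j ^ 2) := by
  obtain ⟨d, rfl⟩ := Nat.exists_eq_add_of_le hd
  obtain ⟨m, rfl⟩ := Nat.exists_eq_add_of_le hm
  obtain ⟨j, rfl⟩ := Nat.exists_eq_add_of_le hj
  unfold dirTime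
  zify
  rw [← sub_nonneg]
  ring_nf
  positivity

theorem clusterTime_le {d m j : ℕ} (hd : 1 ≤ d) (hm : 1 ≤ m) (hj : 1 ≤ j) :
    clusterTime d m j ≤ 200 * (d * m * j ^ 3) := by
  have h := Nat.mul_le_mul_left j (Nat.add_le_add_right (dirTime_le hd hm hj) 3)
  refine (Nat.add_le_add_left h _).trans ?_
  obtain ⟨d, rfl⟩ := Nat.exists_eq_add_of_le hd
  obtain ⟨m, rfl⟩ := Nat.exists_eq_add_of_le hm
  obtain ⟨j, rfl⟩ := Nat.exists_eq_add_of_le hj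
  zify
  rw [← sub_nonneg]
  ring_nf
  positivity

theorem trialTime_le {n d m j k : ℕ} (hn : 1 ≤ n) (hd : 1 ≤ d) (hm : 1 ≤ m) (hj : 1 ≤ j)
    (hk : 1 ≤ k) : trialTime n d m j k ≤ 400 * (n * d * k * m * j ^ 3) := by
  have h := Nat.mul_le_mul_left k (Nat.add_le_add_right (clusterTime_le hd hm hj) 3)
  unfold trialTime flatsTime evalTime distTime
  refine (Nat.add_le_add_right (Nat.add_le_add_right (Nat.add_le_add_right (Nat.add_le_add_right
    (Nat.add_le_add_right h _) _) _) _) _).trans ?_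
  obtain ⟨n, rfl⟩ := Nat.exists_eq_add_of_le hn
  obtain ⟨d, rfl⟩ := Nat.exists_eq_add_of_le hd
  obtain ⟨m, rfl⟩ := Nat.exists_eq_add_of_le hm
  obtain ⟨j, rfl⟩ := Nat.exists_eq_add_of_le hj
  obtain ⟨k, rfl⟩ := Nat.exists_eq_add_of_le hk
  zify
  rw [← sub_nonneg]
  ring_nf
  positivity

/-! ### Choice of the accuracy and of the number of trials. -/

section

variable {k j : ℕ} {ε γ : ℝ}

theorem one_le_scale_mul (hpos : 0 < ε * γ) : 1 ≤ scale k j ε γ * (ε * γ) := by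
  rw [← div_le_iff₀ hpos]
  refine (Nat.le_ceil _).trans ?_
  rw [scale]
  exact_mod_cast Nat.le_add_right _ _

theorem three_le_scale (hk : 1 ≤ k) (hj : 1 ≤ j) (hpos : 0 < ε * γ) : 3 ≤ scale k j ε γ := by
  have : 1 ≤ ⌈1 / (ε * γ)⌉₊ := Nat.one_le_ceil_iff.2 (by positivity)
  unfold scale
  omega

/-- With `E = 16 M²`, `2k + j + 1 ≤ 2M` and `1 ≤ M ε γ`, the quotient is at most `1 / (8M) ≤ ε γ /
8`. -/
theorem accuracy_spec (hk : 1 ≤ k) (hj : 1 ≤ j) (hpos : 0 < ε * γ) :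
    ((2 * k + j + 1 : ℕ) : ℝ) / accuracy (scale k j ε γ) ≤ ε * γ / 8 := by
  have h1 := one_le_scale_mul (k := k) (j := j) hpos
  have h3 := three_le_scale hk hj hpos
  have h2 : 2 * k + j + 1 ≤ 2 * scale k j ε γ := by
    unfold scale; omega
  set M := scale k j ε γ
  have hM : (0 : ℝ) < M := by exact_mod_cast (show 0 < M by omega)
  have h2' : ((2 * k + j + 1 : ℕ) : ℝ) ≤ 2 * M := by exact_mod_cast h2
  rw [accuracy, div_le_iff₀ (by positivity)]
  push_cast at h2' ⊢
  nlinarith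

/-- The density is a polynomial in `E` with leading term `16384 E¹⁰`. For `E ≥ 144` the factor `E²`
exceeds its constants, and `E ≤ 2 ^ E` then gives the exponential form. -/
theorem densityBound_le {E : ℕ} (hE : 144 ≤ E) : densityBound E ≤ 2 ^ (12 * E) := by
  have hE' : (144 : ℝ) ≤ E := by exact_mod_cast hE
  have h1 : (E : ℝ) ≤ 2 ^ E := by exact_mod_cast Nat.lt_two_pow_self.le
  have h2 : densityBound E ≤ (E : ℝ) ^ 12 := by
    unfold densityBound coefBound scaleBound
    push_cast
    have h4 : (1 : ℝ) ≤ (E : ℝ) ^ 4 := one_le_pow₀ (by linarith)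
    have h5 : (16512 : ℝ) ≤ (E : ℝ) ^ 2 := by nlinarith
    calc 2 * (8 * (E : ℝ) ^ 2) ^ 2 * (E : ℝ) ^ 2 * (2 * (8 * (E : ℝ) ^ 2) ^ 2 + 1)
        = 128 * (E : ℝ) ^ 6 * (128 * (E : ℝ) ^ 4 + 1) := by ring
      _ ≤ 128 * (E : ℝ) ^ 6 * (128 * (E : ℝ) ^ 4 + (E : ℝ) ^ 4) := by gcongr
      _ = 16512 * (E : ℝ) ^ 10 := by ring
      _ ≤ (E : ℝ) ^ 2 * (E : ℝ) ^ 10 := by gcongr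
      _ = (E : ℝ) ^ 12 := by ring
  refine h2.trans ?_
  rw [mul_comm, pow_mul]
  gcongr

/-- The factor `16` in `logTrials` splits as `13 + 3`. Thirteen parts pay for the draws, as `2 κ ^ m
≤ 2 ^ (13 E m)` for the density `κ`. Three parts pay for the pivot, as `1 / γ ≤ M`. -/
theorem one_le_mul_trials (hk : 1 ≤ k) (hj : 1 ≤ j) (hε : 0 < ε) (hε1 : ε ≤ 1) (hγ : 0 < γ) {M E : ℕ}
    (hM : M = scale k j ε γ) (hE : E = accuracy M) :
    1 ≤ (1 / 2 / densityBound E ^ sampleSize E) ^ ((j + 1) * k) * (γ / 2) *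
      (2 ^ logTrials M k j : ℕ) := by
  have hpos : 0 < ε * γ := mul_pos hε hγ
  have h1 := one_le_scale_mul (k := k) (j := j) hpos
  have h3 := three_le_scale hk hj hpos
  rw [← hM] at h1 h3
  have hEM : 2 * M ≤ E := by rw [hE, accuracy]; nlinarith
  have hE144 : 144 ≤ E := by rw [hE, accuracy]; nlinarith
  have hκ1 := one_le_densityBound (E := E) (by omega)
  have hκ := densityBound_le hE144
  set m := sampleSize E with hm
  have hm1 : 1 ≤ m := by rw [hm, sampleSize]; omega
  have hc1 : 1 ≤ (j + 1) * k := Nat.one_le_iff_ne_zero.2 (by positivity)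
  have ha : 2 * densityBound E ^ m ≤ 2 ^ (13 * E * m) := by
    have h5 : densityBound E ^ m ≤ 2 ^ (12 * E * m) := by
      rw [pow_mul]; exact pow_le_pow_left₀ (by linarith) hκ m
    have h6 : (2 : ℝ) ≤ 2 ^ (E * m) := by
      calc (2 : ℝ) = 2 ^ 1 := by norm_num
        _ ≤ _ := pow_le_pow_right₀ (by norm_num) (Nat.one_le_iff_ne_zero.2 (by positivity))
    calc 2 * densityBound E ^ m ≤ 2 ^ (E * m) * 2 ^ (12 * E * m) := by gcongr
      _ = 2 ^ (13 * E * m) := by rw [← pow_add]; ring_nf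
  have hb : 2 ≤ γ * 2 ^ (3 * E * m * ((j + 1) * k)) := by
    have h5 : 1 ≤ M * γ := by
      have : ε * γ ≤ γ := mul_le_of_le_one_left hγ.le hε1
      have hM0 : (0 : ℝ) ≤ M := Nat.cast_nonneg _
      nlinarith
    have h6 : 2 * M ≤ 3 * E * m * ((j + 1) * k) := by
      calc 2 * M ≤ 3 * E * 1 * 1 := by omega
        _ ≤ _ := by gcongr
    have h7 : ((2 * M : ℕ) : ℝ) ≤ 2 ^ (3 * E * m * ((j + 1) * k)) := by
      have : 2 * M ≤ 2 ^ (3 * E * m * ((j + 1) * k)) :=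
        Nat.lt_two_pow_self.le.trans (Nat.pow_le_pow_right (by norm_num) h6)
      exact_mod_cast this
    push_cast at h7
    nlinarith
  have hX : logTrials M k j = 13 * E * m * ((j + 1) * k) + 3 * E * m * ((j + 1) * k) := by
    rw [logTrials, trialDraws, ← hE, ← hm]; ring
  rw [hX, pow_add]
  push_cast
  have hapos : 0 < 2 * densityBound E ^ m := by positivity
  have hac : (2 * densityBound E ^ m) ^ ((j + 1) * k) ≤ 2 ^ (13 * E * m * ((j + 1) * k)) := by
    rw [pow_mul _ (13 * E * m)]
    exact pow_le_pow_left₀ hapos.le ha _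
  have hρ : 1 / 2 / densityBound E ^ m = (2 * densityBound E ^ m)⁻¹ := by
    rw [div_div, one_div]
  rw [hρ, inv_pow]
  set a := (2 * densityBound E ^ m) ^ ((j + 1) * k) with hadef
  have ha0 : 0 < a := by positivity
  have h8 : 1 ≤ a⁻¹ * 2 ^ (13 * E * m * ((j + 1) * k)) := by
    rw [inv_mul_eq_div, one_le_div₀ ha0]; exact hac
  calc (1 : ℝ) ≤ (a⁻¹ * 2 ^ (13 * E * m * ((j + 1) * k))) *
        (γ * 2 ^ (3 * E * m * ((j + 1) * k)) / 2) :=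
        one_le_mul_of_one_le_of_one_le h8 (by linarith)
    _ = _ := by ring

/-- The number of steps of the program. -/
def mainTime (n d M k j : ℕ) : ℕ :=
  paramsTime n M k j + (2 ^ logTrials M k j * (trialTime n d (sampleSize (accuracy M)) j k + 3) +
    6 * (2 ^ logTrials M k j * (trialDraws M k j + 1)) + 10) + 2

/-- With `b` the number of trials, `k`, `j` and the sample size are at most `b`. A trial then takes
`O(n d b⁵)` steps, and the `b` trials together take `O(n d b⁶)`, which also covers drawing the tape
and computing the parameters. -/
theorem mainTime_le {n d M : ℕ} (hn : 1 ≤ n) (hd : 1 ≤ d) (hk : 1 ≤ k) (hj : 1 ≤ j) (hM : 1 ≤ M)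
    (hkM : k ≤ M) (hjM : j ≤ M) :
    mainTime n d M k j ≤ 1000 * (n * d * (2 ^ logTrials M k j) ^ 6) := by
  set b := 2 ^ logTrials M k j with hb
  set E := accuracy M with hE
  have hXb : logTrials M k j ≤ b := Nat.lt_two_pow_self.le
  have hMM : M ≤ E := by rw [hE, accuracy]; nlinarith
  have hE1 : 1 ≤ E := by omega
  have hD : trialDraws M k j = k * ((j + 1) * (16 * E)) := by rw [trialDraws, sampleSize]
  have hED : 16 * E ≤ trialDraws M k j := by
    rw [hD]
    calc 16 * E = 1 * (1 * (16 * E)) := by ring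
      _ ≤ _ := by gcongr; omega
  have hX : logTrials M k j = 16 * (E * trialDraws M k j) := rfl
  have hDX : trialDraws M k j ≤ logTrials M k j := by rw [hX]; nlinarith
  have hE2X : 8 * E ^ 2 ≤ logTrials M k j := by rw [hX]; nlinarith
  have hm1 : 1 ≤ sampleSize E := by rw [sampleSize]; omega
  have hmb : sampleSize E ≤ b := by rw [sampleSize]; omega
  have hkb : k ≤ b := by omega
  have hjb : j ≤ b := by omega
  have hb1 : 1 ≤ b := by omega
  have ht : trialTime n d (sampleSize E) j k ≤ 400 * (n * d * b ^ 5) := by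
    refine (trialTime_le hn hd hm1 hj hk).trans ?_
    calc 400 * (n * d * k * sampleSize E * j ^ 3) ≤ 400 * (n * d * b * b * b ^ 3) := by gcongr
      _ = _ := by ring
  have hnd : 1 ≤ n * d := Nat.one_le_iff_ne_zero.2 (by positivity)
  have hp : paramsTime n M k j ≤ 150 * (n * d * b ^ 6) := by
    have h6 : b ≤ b ^ 6 := Nat.le_self_pow (by norm_num) b
    have h7 : b ^ 6 ≤ n * d * b ^ 6 := Nat.le_mul_of_pos_left _ hnd
    have h8 : n ≤ n * d * b ^ 6 := by
      rw [mul_assoc]; exact Nat.le_mul_of_pos_right _ (by positivity)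
    unfold paramsTime
    rw [← hb, ← hE]
    omega
  have h5 : 1 ≤ n * d * b ^ 5 := Nat.one_le_iff_ne_zero.2 (by positivity)
  have h6 : b * (trialTime n d (sampleSize E) j k + 3) ≤ 403 * (n * d * b ^ 6) := by
    calc b * (trialTime n d (sampleSize E) j k + 3) ≤ b * (403 * (n * d * b ^ 5)) := by
          gcongr; omega
      _ = _ := by ring
  have h7 : b * (trialDraws M k j + 1) ≤ 2 * (n * d * b ^ 6) := by
    calc b * (trialDraws M k j + 1) ≤ b * (2 * b) := by gcongr; omega
      _ = 2 * (1 * b ^ 2) := by ring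
      _ ≤ 2 * (n * d * b ^ 6) := by gcongr; norm_num
  have h8 : 1 ≤ n * d * b ^ 6 := Nat.one_le_iff_ne_zero.2 (by positivity)
  unfold mainTime
  rw [← hb, ← hE]
  omega

/-- All of `1 / (ε γ)`, `k`, `j` and `1` are at most `x`, so the scale is at most `4x`. It enters to
the fourth power: the accuracy is quadratic in it, and it occurs once explicitly and once through
the sample size. The last factor `x` comes from `k (j + 1)`. -/
theorem logTrials_le (hk : 1 ≤ k) (hj : 1 ≤ j) (hε : 0 < ε) (hε1 : ε ≤ 1) (hγ : 0 < γ) (hγ1 : γ ≤ 1)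
    {x : ℝ} (hx : x = (k : ℝ) * j / (ε * γ)) :
    (logTrials (scale k j ε γ) k j : ℝ) ≤ 2 ^ 25 * x ^ 5 := by
  have hpos : 0 < ε * γ := mul_pos hε hγ
  have hεγ : ε * γ ≤ 1 := mul_le_one₀ hε1 hγ.le hγ1
  have hk' : (1 : ℝ) ≤ k := by exact_mod_cast hk
  have hj' : (1 : ℝ) ≤ j := by exact_mod_cast hj
  have hkj : (k : ℝ) * j ≤ x := by
    rw [hx, le_div_iff₀ hpos]
    exact mul_le_of_le_one_right (by positivity) hεγ
  have hinv : 1 / (ε * γ) ≤ x := by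
    rw [hx]; gcongr; nlinarith
  have hkx : (k : ℝ) ≤ x := by nlinarith
  have hjx : (j : ℝ) ≤ x := by nlinarith
  have hM : (scale k j ε γ : ℝ) ≤ 4 * x := by
    have := Nat.ceil_lt_add_one (show 0 ≤ 1 / (ε * γ) by positivity)
    rw [scale]
    push_cast
    linarith
  have hkj2 : (k : ℝ) * (j + 1) ≤ 2 * x := by nlinarith
  have hx0 : 0 ≤ x := by linarith
  calc (logTrials (scale k j ε γ) k j : ℝ)
      = 65536 * (scale k j ε γ : ℝ) ^ 4 * (k * (j + 1)) := by
        rw [logTrials, trialDraws, sampleSize, accuracy]; push_cast; ring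
    _ ≤ 65536 * (4 * x) ^ 4 * (2 * x) := by gcongr
    _ = 2 ^ 25 * x ^ 5 := by ring

end

/-- The exponent of the running time. -/
noncomputable def timeExponent : Polynomial ℝ := Polynomial.C (6 * 2 ^ 25) * Polynomial.X ^ 5

theorem mainCmd_succeeds {n d k j : ℕ} {ε γ : ℝ} (p : Fin n → EuclideanSpace ℝ (Fin d)) (hn : 1 ≤ n)
    (hk : 1 ≤ k) (hj : 1 ≤ j) (hjd : j ≤ d) (hε : 0 < ε) (hε1 : ε ≤ 1) (hγ : 0 < γ) (hγ1 : γ ≤ 1) :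
    Succeeds ([mainCmd], input k j ε γ p) (mainTime n d (scale k j ε γ) k j)
      {s | IsGoodSolution j ε γ p (output d k j s)} (1 / 2) := by
  have hpos : 0 < ε * γ := mul_pos hε hγ
  have h3 := three_le_scale hk hj hpos
  have hspec := accuracy_spec hk hj hpos
  have hN := one_le_mul_trials hk hj hε hε1 hγ rfl rfl
  have hjM : j < scale k j ε γ := by
    have : 1 ≤ ⌈1 / (ε * γ)⌉₊ := Nat.one_le_ceil_iff.2 (by positivity)
    unfold scale; omega
  set M := scale k j ε γ with hM
  have hEM : 2 * M ≤ accuracy M := by rw [accuracy]; nlinarith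
  have hhalf := half_le_avg_exists_trialSuccess (ε := ε) (γ := γ) hn p hN
    (fun b A => le_avg_trialSuccess hn hk hjd hε hε1 hγ hγ1 (by omega) (by omega) hspec p b A)
    fun _ => (0, 0)
  have h1 := Succeeds.of_ends (K := [.seq fillCmd searchCmd]) (π := 1 / 2)
    (G := {s | IsGoodSolution j ε γ p (output d k j s)}) (paramsCmd_ends p hpos hM rfl rfl)
    fun s' _ hs => Succeeds.of_step rfl (fillCmd_succeeds hn hk hjd rfl hs.1 hs.2.1 hs.2.2 hhalf)
  exact (Succeeds.of_step rfl h1).mono (by unfold mainTime; rw [trialDraws]; omega)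

end ProjectiveClustering

theorem theorem3 :
    ∃ (prog : RealRAM.Cmd) (q : Polynomial ℝ) (C c : ℝ), 0 < C ∧ 0 < c ∧
      ∀ (n d k j : ℕ) (ε γ : ℝ) (p : Fin n → EuclideanSpace ℝ (Fin d)),
        1 ≤ n → 1 ≤ k → 1 ≤ j → j ≤ d → 0 < ε → ε ≤ 1 → 0 < γ → γ ≤ 1 →
        ∃ T : ℕ,
          (T : ℝ) ≤ C * (2 : ℝ) ^ (q.eval ((k : ℝ) * (j : ℝ) / (ε * γ))) * (n : ℝ) * (d : ℝ) ∧
          RealRAM.HaltsWithin prog (ProjectiveClustering.input k j ε γ p) T ∧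
          ENNReal.ofReal c ≤
            RealRAM.probHaltsIn prog (ProjectiveClustering.input k j ε γ p) T
              {s | ProjectiveClustering.IsGoodSolution j ε γ p
                (ProjectiveClustering.output d k j s)} := by
  refine ⟨ProjectiveClustering.mainCmd, ProjectiveClustering.timeExponent, 1000, 1 / 2, by norm_num,
    by norm_num, fun n d k j ε γ p hn hk hj hjd hε hε1 hγ hγ1 => ?_⟩
  -- `Succeeds` is by definition the conjunction of halting within the bound and the lower bound for
  -- the probability.
  refine ⟨ProjectiveClustering.mainTime n d (ProjectiveClustering.scale k j ε γ) k j, ?_,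
    ProjectiveClustering.mainCmd_succeeds p hn hk hj hjd hε hε1 hγ hγ1⟩
  have h3 := ProjectiveClustering.three_le_scale hk hj (mul_pos hε hγ)
  have h1 := ProjectiveClustering.mainTime_le (M := ProjectiveClustering.scale k j ε γ) hn
    (hj.trans hjd) hk hj (by omega) (by unfold ProjectiveClustering.scale; omega)
    (by unfold ProjectiveClustering.scale; omega)
  have h2 := ProjectiveClustering.logTrials_le hk hj hε hε1 hγ hγ1 rfl
  set X := ProjectiveClustering.logTrials (ProjectiveClustering.scale k j ε γ) k j
  set x : ℝ := (k : ℝ) * j / (ε * γ)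
  -- The sixth power of the number of trials turns the bound `2 ^ 25 * x ^ 5` for its logarithm into
  -- the coefficient `6 * 2 ^ 25` of `timeExponent`.
  have h4 : (((2 ^ X) ^ 6 : ℕ) : ℝ) ≤
      (2 : ℝ) ^ (ProjectiveClustering.timeExponent.eval x) := by
    push_cast
    rw [← pow_mul, ← Real.rpow_natCast]
    refine Real.rpow_le_rpow_of_exponent_le (by norm_num) ?_
    simp only [ProjectiveClustering.timeExponent, Polynomial.eval_mul, Polynomial.eval_C,
      Polynomial.eval_pow, Polynomial.eval_X]
    push_cast
    linarith
  calc ((ProjectiveClustering.mainTime n d (ProjectiveClustering.scale k j ε γ) k j : ℕ) : ℝ)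
      ≤ ((1000 * (n * d * (2 ^ X) ^ 6) : ℕ) : ℝ) := by exact_mod_cast h1
    _ = 1000 * (((2 ^ X) ^ 6 : ℕ) : ℝ) * n * d := by push_cast; ring
    _ ≤ _ := by gcongr
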